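/- Let $A,A_m\in\mathbb R^{n\times n}$, $B,C\in\mathbb R^{n\times m}$, $\Lambda\in\mathbb R^{m\times m}$, and consider the square plant and the closed-loop reference model $$\dot x=Ax+B\Lambda u,\quad y=C^Tx,\qquad \dot x_m=A_mx_m+Br-L(y-y_m),\quad y_m=C^Tx_m,$$ with $x,x_m\in\mathbb R^n$ and $u,y,r\in\mathbb R^m$, where $r$ is a bounded measurable reference input and $A_m$ is Hurwitz. Assume: 1. $C^TB$ has full rank. 2. The pair $(A_m,C^T)$ is observable. 3. The plant is minimum phase: all zeros of the polynomial $\psi(s)=\det(sI-A)\,\det\big(C^T(sI-A)^{-1}B\big)$ lie in the open left half plane. 4. There are $\Theta^*\in\mathbb R^{n\times m}$ and $K^*\in\mathbb R^{m\times m}$ with $A+B\Lambda\Theta^{*T}=A_m$ and $\Lambda K^{*T}=I$. 5. $\Lambda$ is diagonal with positive diagonal elements. 6. $\|\Theta^*\|\le\bar\theta^*$ and $\|\Lambda\|\le\bar\lambda$ in the induced 2-norm, with known $\bar\theta^*,\bar\lambda$. Let $M=C^TB$, $e_y=y-y_m$, let $\Gamma_\theta\in\mathbb R^{n\times n}$ and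 $\Gamma_k\in\mathbb R^{m\times m}$ be diagonal with positive diagonal elements, and use the controller and update laws $$u=\Theta^Tx_m+K^Tr,\qquad \dot\Theta=-\Gamma_\theta x_me_y^TM,\qquad \dot K=-\Gamma_k\,r\,e_y^TM .$$ A matrix function $Z(s)$ is positive real if for $\mathrm{Re}\,s>0$ it is analytic, $\overline{Z(s)}=Z(\bar s)$, and $Z^T(\bar s)+Z(s)$ is positive semidefinite; it is strictly positive real (SPR) if $Z(s-\epsilon)$ is positive real for some $\epsilon>0$. Then there exists $L_s\in\mathbb R^{n\times m}$ such that $M^TC^T(sI-A_m-L_sC^T)^{-1}B$ is SPR. For every such $L_s$ there exist symmetric positive definite matrices $P,Q_s$ with $$(A_m+L_sC^T)^TP+P(A_m+L_sC^T)=-Q_s,\qquad PB=CM,$$ and for every such pair $(P,Q_s)$ and every $$\rho>\rho^*=\frac{\bar\lambda^2\,\bar\theta^{*2}}{2\lambda_{\min}(Q_s)},$$ the closed-loop adaptive system with $L=L_s-\rho BM^T$ has, for all initial values of $x,x_m,\Theta,K$, a solution on $[0,\infty)$, and every solution $(x,x_m,\Theta,K)$ on $[0,\infty)$ is bounded and satisfies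 $\lim_{t\to\infty}e_y(t)=0$. (Solutions are understood in the sense of Carathéodory.) -/

import Mathlib

open Matrix Set Filter Topology

namespace AdaptiveControl

noncomputable section

/-- The `2`-norm on matrices induced by the Euclidean norms. -/
def inducedNorm {p q : ℕ} (X : Matrix (Fin p) (Fin q) ℝ) : ℝ :=
  ‖LinearMap.toContinuousLinearMap (Matrix.toEuclideanLin X)‖

/-- The complexification of a real matrix. -/
def toComplex {p q : ℕ} (X : Matrix (Fin p) (Fin q) ℝ) : Matrix (Fin p) (Fin q) ℂ :=
  X.map Complex.ofReal

/-- All eigenvalues lie in the open left half plane. -/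
def IsHurwitz {n : ℕ} (A : Matrix (Fin n) (Fin n) ℝ) : Prop :=
  ∀ s ∈ spectrum ℂ (toComplex A), s.re < 0

/-- Diagonal with positive diagonal entries. -/
def IsPosDiagonal {k : ℕ} (X : Matrix (Fin k) (Fin k) ℝ) : Prop :=
  X.IsDiag ∧ ∀ i, 0 < X i i

/-- The pair `(A, H)` of state matrix and output matrix is observable: the observability matrix
with the blocks `H, H A, …, H A ^ (n - 1)` has trivial kernel. -/
def IsObservable {n m : ℕ} (A : Matrix (Fin n) (Fin n) ℝ) (H : Matrix (Fin m) (Fin n) ℝ) : Prop :=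
  ∀ v : Fin n → ℝ, (∀ k < n, (H * A ^ k) *ᵥ v = 0) → v = 0

/-- The transfer matrix `H (s I - A)⁻¹ B`, at the points `s` that are not eigenvalues of `A`. -/
def transferMatrix {n m : ℕ} (A : Matrix (Fin n) (Fin n) ℝ) (B : Matrix (Fin n) (Fin m) ℝ)
    (H : Matrix (Fin m) (Fin n) ℝ) (s : ℂ) : Matrix (Fin m) (Fin m) ℂ :=
  toComplex H * (s • (1 : Matrix (Fin n) (Fin n) ℂ) - toComplex A)⁻¹ * toComplex B

/-- The value at `s` of the polynomial `ψ(s) = det (s I - A) * det (H (s I - A)⁻¹ B)` of a square system, written as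
the determinant of the system matrix; see `zeroPolyEval_eq`. -/
def zeroPolyEval {n m : ℕ} (A : Matrix (Fin n) (Fin n) ℝ) (B : Matrix (Fin n) (Fin m) ℝ)
    (H : Matrix (Fin m) (Fin n) ℝ) (s : ℂ) : ℂ :=
  (Matrix.fromBlocks (s • (1 : Matrix (Fin n) (Fin n) ℂ) - toComplex A) (toComplex B)
    (-toComplex H) 0).det

theorem zeroPolyEval_eq {n m : ℕ} (A : Matrix (Fin n) (Fin n) ℝ) (B : Matrix (Fin n) (Fin m) ℝ)
    (H : Matrix (Fin m) (Fin n) ℝ) (s : ℂ)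
    (hs : IsUnit (s • (1 : Matrix (Fin n) (Fin n) ℂ) - toComplex A)) :
    zeroPolyEval A B H s
      = (s • (1 : Matrix (Fin n) (Fin n) ℂ) - toComplex A).det * (transferMatrix A B H s).det := by
  have := hs.invertible
  rw [zeroPolyEval, transferMatrix, Matrix.det_fromBlocks₁₁, Matrix.invOf_eq_nonsing_inv]
  simp

/-- All transmission zeros, that is, all zeros of `ψ`, lie in the open left half plane. -/
def IsMinimumPhase {n m : ℕ} (A : Matrix (Fin n) (Fin n) ℝ) (B : Matrix (Fin n) (Fin m) ℝ)
    (H : Matrix (Fin m) (Fin n) ℝ) : Prop :=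
  ∀ s : ℂ, zeroPolyEval A B H s = 0 → s.re < 0

open scoped ComplexOrder in
/-- Positive real matrix functions of a complex variable. -/
structure IsPositiveReal {m : ℕ} (Z : ℂ → Matrix (Fin m) (Fin m) ℂ) : Prop where
  analytic : ∀ i j, AnalyticOnNhd ℂ (fun s => Z s i j) {s | 0 < s.re}
  conj : ∀ s : ℂ, 0 < s.re → (Z s).map (starRingEnd ℂ) = Z (starRingEnd ℂ s)
  posSemidef : ∀ s : ℂ, 0 < s.re → ((Z (starRingEnd ℂ s))ᵀ + Z s).PosSemidef

/-- Strictly positive real (SPR) matrix functions. -/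
def IsSPR {m : ℕ} (Z : ℂ → Matrix (Fin m) (Fin m) ℂ) : Prop :=
  ∃ ε : ℝ, 0 < ε ∧ IsPositiveReal (fun s => Z (s - (ε : ℂ)))

/-- The mixing matrix `M = Cᵀ B`. -/
def mixing {n m : ℕ} (B C : Matrix (Fin n) (Fin m) ℝ) : Matrix (Fin m) (Fin m) ℝ :=
  Cᵀ * B

/-- The observer gain `Ls` makes `Mᵀ Cᵀ (s I - Am - Ls Cᵀ)⁻¹ B` strictly positive real. -/
def IsSPRGain {n m : ℕ} (Am : Matrix (Fin n) (Fin n) ℝ) (B C Ls : Matrix (Fin n) (Fin m) ℝ) :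
    Prop :=
  IsSPR (transferMatrix (Am + Ls * Cᵀ) B ((mixing B C)ᵀ * Cᵀ))

/-- `P` and `Qs` are symmetric positive definite with
`(Am + Ls Cᵀ)ᵀ P + P (Am + Ls Cᵀ) = -Qs` and `P B = C M`. -/
structure IsLyapunovPair {n m : ℕ} (Am : Matrix (Fin n) (Fin n) ℝ)
    (B C Ls : Matrix (Fin n) (Fin m) ℝ) (P Qs : Matrix (Fin n) (Fin n) ℝ) : Prop where
  posDef_P : P.PosDef
  posDef_Qs : Qs.PosDef
  lyapunov : (Am + Ls * Cᵀ)ᵀ * P + P * (Am + Ls * Cᵀ) = -Qs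
  matching : P * B = C * mixing B C

/-- The smallest eigenvalue of a real symmetric matrix. -/
def lambdaMin {n : ℕ} (Q : Matrix (Fin n) (Fin n) ℝ) : ℝ :=
  sInf (spectrum ℝ Q)

/-- The threshold `ρ* = lbar² θbar² / (2 λ_min(Qs))`. -/
def rhoStar {n : ℕ} (lbar θbar : ℝ) (Qs : Matrix (Fin n) (Fin n) ℝ) : ℝ :=
  lbar ^ 2 * θbar ^ 2 / (2 * lambdaMin Qs)

/-- The output error `e_y = y - y_m = Cᵀ x - Cᵀ x_m`. -/
def outputError {n m : ℕ} (C : Matrix (Fin n) (Fin m) ℝ) (x xm : Fin n → ℝ) : Fin m → ℝ :=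
  Cᵀ *ᵥ x - Cᵀ *ᵥ xm

/-- The control input `u = Θᵀ x_m + Kᵀ r`. -/
def controlInput {n m : ℕ} (xm : Fin n → ℝ) (Θ : Matrix (Fin n) (Fin m) ℝ)
    (K : Matrix (Fin m) (Fin m) ℝ) (r : Fin m → ℝ) : Fin m → ℝ :=
  Θᵀ *ᵥ xm + Kᵀ *ᵥ r

/-- `(x, xm, Θ, K)` solves on `[0, ∞)` the closed-loop adaptive system
`x' = A x + B Λ u`, `xm' = Am xm + B r - L e_y`, `Θ' = -Γθ xm e_yᵀ M`, `K' = -Γk r e_yᵀ M` with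
`u = Θᵀ xm + Kᵀ r`, in the sense of Carathéodory: the functions are continuous and satisfy the
integrated equations (so the input `r` need not be continuous). -/
structure IsClosedLoopSolution {n m : ℕ} (A Am : Matrix (Fin n) (Fin n) ℝ)
    (B C : Matrix (Fin n) (Fin m) ℝ) (Λ : Matrix (Fin m) (Fin m) ℝ)
    (L : Matrix (Fin n) (Fin m) ℝ) (Γθ : Matrix (Fin n) (Fin n) ℝ)
    (Γk : Matrix (Fin m) (Fin m) ℝ) (r : ℝ → Fin m → ℝ)
    (x xm : ℝ → Fin n → ℝ) (Θ : ℝ → Matrix (Fin n) (Fin m) ℝ)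
    (K : ℝ → Matrix (Fin m) (Fin m) ℝ) : Prop where
  continuousOn_x : ContinuousOn x (Ici 0)
  continuousOn_xm : ContinuousOn xm (Ici 0)
  continuousOn_Θ : ContinuousOn Θ (Ici 0)
  continuousOn_K : ContinuousOn K (Ici 0)
  plant : ∀ t, 0 ≤ t → ∀ i, x t i = x 0 i +
    ∫ τ in (0 : ℝ)..t, (A *ᵥ x τ + (B * Λ) *ᵥ controlInput (xm τ) (Θ τ) (K τ) (r τ)) i
  reference : ∀ t, 0 ≤ t → ∀ i, xm t i = xm 0 i +
    ∫ τ in (0 : ℝ)..t, (Am *ᵥ xm τ + B *ᵥ r τ - L *ᵥ outputError C (x τ) (xm τ)) i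
  update_Θ : ∀ t, 0 ≤ t → ∀ i j, Θ t i j = Θ 0 i j +
    ∫ τ in (0 : ℝ)..t,
      (-(Γθ * vecMulVec (xm τ) (outputError C (x τ) (xm τ)) * mixing B C)) i j
  update_K : ∀ t, 0 ≤ t → ∀ i j, K t i j = K 0 i j +
    ∫ τ in (0 : ℝ)..t,
      (-(Γk * vecMulVec (r τ) (outputError C (x τ) (xm τ)) * mixing B C)) i j

/-- A vector-valued signal is bounded on `[0, ∞)`. -/
def IsBoundedSignal {k : ℕ} (f : ℝ → Fin k → ℝ) : Prop :=
  ∃ c : ℝ, ∀ t, 0 ≤ t → ∀ i, |f t i| ≤ c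

/-- A matrix-valued signal is bounded on `[0, ∞)`. -/
def IsBoundedMatrixSignal {p q : ℕ} (F : ℝ → Matrix (Fin p) (Fin q) ℝ) : Prop :=
  ∃ c : ℝ, ∀ t, 0 ≤ t → ∀ i j, |F t i j| ≤ c

end

end AdaptiveControl

/-! The argument rests on the zeros of the plant, a duality proof of the Kalman–Yakubovich lemma,
and one Lyapunov function for the closed loop.

Zeros. By the matching condition, `Am` arises from `A` by the state feedback `B * (Λ * Θstarᵀ)`,
which does not move zeros, so `(Am, B, Cᵀ)` has stable zeros. Since `M = Cᵀ B` is invertible, the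
state space is the direct sum of the kernel of `Cᵀ` and the range of `B`. The zeros are eigenvalues
of the compression of `Am` to that kernel, and `zeroDynamics` is Hurwitz.

Existence of a gain (`exists_isSPRGain`). Let `S` be a Lyapunov matrix of the zero dynamics and `N`
the projection onto the kernel. Then `P = C Cᵀ + Nᵀ S N` satisfies `P B = C M`, and the form of `P
Am` is negative on the kernel. By Finsler's lemma a multiple of `C Cᵀ` makes it negative everywhere;
this multiple is an output injection. An energy balance turns these properties of `P` into strict
positive realness.

From SPR to a Lyapunov pair (`exists_lyapunov_of_isSPR`). Put `H = Mᵀ Cᵀ`, so that `H B = Mᵀ M` is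
positive definite, and seek `P = Hᵀ (H B)⁻¹ H + Nᵀ S N`, which meets `P B = Hᵀ` for every `S`. The
remaining inequality is affine in `S`. If it had no solution, Hahn–Banach would give a positive
semidefinite certificate that splits into vectors belonging to single frequencies on a line `Re s =
-δ` or at infinity (`exists_quadForm_neg_of_frequency`); there the SPR inequality rules them out.
Stability of the zeros excludes the degenerate vectors and makes `P` positive definite.

Closed loop. For `e = x - xm`, the function `V`, equal to `eᵀ P e` plus weighted squares of the
parameter errors, loses its cross terms along the update laws because `P B = C M`. Since the
controller feeds back `xm` and not `x`, a term with `B Λ Θstarᵀ e` survives; the injection `-ρ B Mᵀ`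
supplies `-2ρ |Mᵀ e_y|²`, and `ρ > ρ*` lets Young's inequality absorb the term
(`IsLyapunovPair.exists_decay_rate`). Hence `V' ≤ -c |e|²`. So `e` and the gains are bounded, and
`xm` is bounded because `Am` is Hurwitz. These bounds do not depend on the time horizon, which gives
global existence by truncating the vector field (`exists_global_solution`); Barbalat's lemma
(`tendsto_zero_of_dissipation`) gives `e → 0`. -/

namespace AdaptiveControl

/-! ### Real matrices acting on complex vectors. -/

section Complexification

variable {p q l : ℕ}

theorem toComplex_mul (X : Matrix (Fin p) (Fin q) ℝ) (Y : Matrix (Fin q) (Fin l) ℝ) :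
    toComplex (X * Y) = toComplex X * toComplex Y :=
  Matrix.map_mul (f := Complex.ofRealHom)

theorem toComplex_add (X Y : Matrix (Fin p) (Fin q) ℝ) :
    toComplex (X + Y) = toComplex X + toComplex Y := by
  ext; simp [toComplex]

theorem toComplex_sub (X Y : Matrix (Fin p) (Fin q) ℝ) :
    toComplex (X - Y) = toComplex X - toComplex Y := by
  ext; simp [toComplex]

theorem toComplex_smul (c : ℝ) (X : Matrix (Fin p) (Fin q) ℝ) :
    toComplex (c • X) = (c : ℂ) • toComplex X := by
  ext; simp [toComplex]

theorem toComplex_one : toComplex (1 : Matrix (Fin p) (Fin p) ℝ) = 1 :=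
  Matrix.map_one _ Complex.ofReal_zero Complex.ofReal_one

theorem toComplex_zero : toComplex (0 : Matrix (Fin p) (Fin q) ℝ) = 0 := by
  ext; simp [toComplex]

theorem toComplex_pow (X : Matrix (Fin p) (Fin p) ℝ) (k : ℕ) :
    toComplex (X ^ k) = toComplex X ^ k := by
  induction k with
  | zero => simp [toComplex_one]
  | succ k ih => rw [pow_succ, pow_succ, toComplex_mul, ih]

theorem toComplex_transpose (X : Matrix (Fin p) (Fin q) ℝ) :
    toComplex Xᵀ = (toComplex X)ᴴ := by
  ext; simp [toComplex]

theorem map_conj_toComplex (X : Matrix (Fin p) (Fin q) ℝ) :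
    (toComplex X).map (starRingEnd ℂ) = toComplex X := by
  ext; simp [toComplex]

theorem toComplex_mulVec_ofReal (X : Matrix (Fin p) (Fin q) ℝ) (v : Fin q → ℝ) :
    (toComplex X *ᵥ fun i => (v i : ℂ)) = fun i => ((X *ᵥ v) i : ℂ) := by
  ext i; simp [toComplex, mulVec, dotProduct]

/-- The real part of the Hermitian form of a real matrix splits into the quadratic forms of the
real and imaginary parts. -/
theorem re_star_dotProduct_toComplex (X : Matrix (Fin p) (Fin p) ℝ) (v : Fin p → ℂ) :
    (star v ⬝ᵥ (toComplex X *ᵥ v)).re =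
      (fun i => (v i).re) ⬝ᵥ (X *ᵥ fun i => (v i).re) +
        (fun i => (v i).im) ⬝ᵥ (X *ᵥ fun i => (v i).im) := by
  simp only [dotProduct, mulVec, toComplex, Matrix.map_apply, Complex.re_sum, Pi.star_apply,
    Complex.mul_re, RCLike.star_def, Complex.conj_re, Complex.conj_im, Complex.im_sum,
    Complex.mul_im, Complex.ofReal_re, Complex.ofReal_im]
  rw [← Finset.sum_add_distrib]
  refine Finset.sum_congr rfl fun i _ => ?_
  simp

theorem re_star_dotProduct_toComplex_neg {X : Matrix (Fin p) (Fin p) ℝ}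
    (hX : ∀ v, v ≠ 0 → v ⬝ᵥ (X *ᵥ v) < 0) {v : Fin p → ℂ} (hv : v ≠ 0) :
    (star v ⬝ᵥ (toComplex X *ᵥ v)).re < 0 := by
  rw [re_star_dotProduct_toComplex]
  have key : ∀ w : Fin p → ℝ, w ⬝ᵥ (X *ᵥ w) ≤ 0 := fun w => by
    by_cases hw : w = 0
    · simp [hw]
    · exact (hX w hw).le
  by_cases h : (fun i => (v i).re) = 0
  · have h' : (fun i => (v i).im) ≠ 0 := fun h' => hv <| by
      ext i
      exact Complex.ext (congrFun h i) (congrFun h' i)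
    have := hX _ h'
    have := key fun i => (v i).re
    linarith
  · have := hX _ h
    have := key fun i => (v i).im
    linarith

theorem dotProduct_mulVec_transpose (X : Matrix (Fin p) (Fin q) ℝ) (v : Fin q → ℝ)
    (w : Fin p → ℝ) : v ⬝ᵥ (Xᵀ *ᵥ w) = (X *ᵥ v) ⬝ᵥ w := by
  rw [mulVec_transpose, dotProduct_comm, ← dotProduct_mulVec, dotProduct_comm]

theorem dotProduct_mulVec_comm {X : Matrix (Fin p) (Fin p) ℝ} (hX : Xᵀ = X)
    (v w : Fin p → ℝ) : v ⬝ᵥ (X *ᵥ w) = w ⬝ᵥ (X *ᵥ v) := by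
  conv_lhs => rw [← hX]
  rw [dotProduct_mulVec_transpose, dotProduct_comm]

theorem star_dotProduct_conjTranspose_mulVec (X : Matrix (Fin p) (Fin q) ℂ) (v : Fin q → ℂ)
    (w : Fin p → ℂ) : star v ⬝ᵥ (Xᴴ *ᵥ w) = star (X *ᵥ v) ⬝ᵥ w := by
  rw [star_mulVec, dotProduct_mulVec]

theorem mem_spectrum_iff_exists_mulVec (X : Matrix (Fin p) (Fin p) ℂ) (s : ℂ) :
    s ∈ spectrum ℂ X ↔ ∃ v, v ≠ 0 ∧ X *ᵥ v = s • v := by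
  rw [spectrum.mem_iff, Matrix.isUnit_iff_isUnit_det, isUnit_iff_ne_zero, not_not,
    ← Matrix.exists_mulVec_eq_zero_iff]
  refine exists_congr fun v => and_congr_right fun _ => ?_
  rw [sub_mulVec, sub_eq_zero, Matrix.algebraMap_eq_diagonal, eq_comm]
  have : (diagonal (algebraMap ℂ (Fin p → ℂ) s)) *ᵥ v = s • v := by
    ext i; simp [mulVec_diagonal]
  rw [this]

theorem isHurwitz_iff (X : Matrix (Fin p) (Fin p) ℝ) :
    IsHurwitz X ↔ ∀ (s : ℂ) v, v ≠ 0 → toComplex X *ᵥ v = s • v → s.re < 0 := by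
  simp only [IsHurwitz, mem_spectrum_iff_exists_mulVec]
  exact ⟨fun h s v hv hs => h s ⟨v, hv, hs⟩, fun h s ⟨v, hv, hs⟩ => h s v hv hs⟩

theorem isUnit_smul_one_sub_iff (X : Matrix (Fin p) (Fin p) ℂ) (s : ℂ) :
    IsUnit (s • (1 : Matrix (Fin p) (Fin p) ℂ) - X) ↔ ∀ v, X *ᵥ v = s • v → v = 0 := by
  have := mem_spectrum_iff_exists_mulVec X s
  rw [spectrum.mem_iff, Algebra.algebraMap_eq_smul_one] at this
  rw [← not_iff_not, this]
  push Not
  exact exists_congr fun v => and_comm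

end Complexification

/-! ### Lyapunov theory of Hurwitz matrices through the Cayley transform. -/

section Lyapunov

variable {n : ℕ}

section Norm

attribute [local instance] Matrix.linftyOpNormedRing Matrix.linftyOpNormedAlgebra

/-- The powers of a matrix with all eigenvalues in the open unit disc tend to zero. -/
theorem tendsto_pow_zero_of_spectrum (W : Matrix (Fin n) (Fin n) ℂ)
    (hW : ∀ z ∈ spectrum ℂ W, ‖z‖ < 1) : Tendsto (fun k => W ^ k) atTop (𝓝 0) := by
  -- For `n = 0` the spectrum is empty and no point of it attains the spectral radius.
  rcases subsingleton_or_nontrivial (Matrix (Fin n) (Fin n) ℂ) with hs | hs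
  · exact tendsto_const_nhds.congr fun _ => Subsingleton.elim _ _
  have hcomplete : CompleteSpace (Matrix (Fin n) (Fin n) ℂ) := FiniteDimensional.complete ℂ _
  have hr : spectralRadius ℂ W < 1 := by
    obtain ⟨z, hz, hzr⟩ := spectrum.exists_nnnorm_eq_spectralRadius W
    rw [← hzr]
    exact_mod_cast hW z hz
  -- By Gelfand's formula, `‖W ^ k‖ ≤ q ^ k` eventually, for any `q` strictly between the spectral
  -- radius and `1`.
  obtain ⟨q, hq1, hq2⟩ := ENNReal.lt_iff_exists_nnreal_btwn.1 hr
  have hq2' : q < 1 := by exact_mod_cast hq2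
  have hg := (spectrum.pow_nnnorm_pow_one_div_tendsto_nhds_spectralRadius W).eventually
    (gt_mem_nhds hq1)
  refine squeeze_zero_norm' (a := fun k => (q : ℝ) ^ k) ?_
    (tendsto_pow_atTop_nhds_zero_of_lt_one q.2 (by exact_mod_cast hq2'))
  filter_upwards [hg, eventually_gt_atTop 0] with k hk hk0
  have h1 : ((‖W ^ k‖₊ : ENNReal) ^ (1 / k : ℝ)) ^ (k : ℝ) ≤ (q : ENNReal) ^ (k : ℝ) :=
    ENNReal.rpow_le_rpow hk.le (by positivity)
  rw [← ENNReal.rpow_mul, one_div_mul_cancel (by positivity), ENNReal.rpow_one,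
    ENNReal.rpow_natCast] at h1
  exact_mod_cast h1

end Norm

end Lyapunov

section Lyapunov

variable {n : ℕ}

/-- The Cayley transform of a square matrix. -/
noncomputable def cayley (F : Matrix (Fin n) (Fin n) ℝ) : Matrix (Fin n) (Fin n) ℝ :=
  (1 + F) * (1 - F)⁻¹

theorem IsHurwitz.isUnit_one_sub {F : Matrix (Fin n) (Fin n) ℝ} (hF : IsHurwitz F) :
    IsUnit (1 - F).det := by
  rw [isUnit_iff_ne_zero]
  intro h
  obtain ⟨v, hv, h0⟩ := Matrix.exists_mulVec_eq_zero_iff.2 h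
  have h1 : F *ᵥ v = v := by
    rw [sub_mulVec, one_mulVec, sub_eq_zero] at h0
    exact h0.symm
  have := (isHurwitz_iff F).1 hF 1 (fun i => (v i : ℂ))
    (fun h => hv (by ext i; simpa using congrFun h i))
    (by rw [toComplex_mulVec_ofReal, h1, one_smul])
  norm_num at this

/-- Writing every vector as `(1 - F) w` keeps the inverse out of the later computations with
quadratic forms. -/
theorem IsHurwitz.cayley_mulVec {F : Matrix (Fin n) (Fin n) ℝ} (hF : IsHurwitz F)
    (w : Fin n → ℝ) : cayley F *ᵥ ((1 - F) *ᵥ w) = (1 + F) *ᵥ w := by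
  rw [cayley, mulVec_mulVec, Matrix.mul_assoc, Matrix.nonsing_inv_mul _ hF.isUnit_one_sub,
    Matrix.mul_one]

theorem IsHurwitz.exists_one_sub_mulVec {F : Matrix (Fin n) (Fin n) ℝ} (hF : IsHurwitz F)
    (v : Fin n → ℝ) : ∃ w, (1 - F) *ᵥ w = v :=
  ⟨(1 - F)⁻¹ *ᵥ v, by rw [mulVec_mulVec, Matrix.mul_nonsing_inv _ hF.isUnit_one_sub, one_mulVec]⟩

/-- Multiplying the relation by the conjugate of `z + 1` and taking real parts gives `|z|² - 1 = Re
s · |z + 1|²`. -/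
theorem norm_lt_one_of_cayley {s z : ℂ} (hs : s.re < 0) (h : z - 1 = s * (z + 1)) : ‖z‖ < 1 := by
  have h1 : ‖z - 1‖ ^ 2 - ‖z + 1‖ ^ 2 = -4 * z.re := by
    simp only [Complex.sq_norm, Complex.normSq_apply, Complex.sub_re, Complex.add_re,
      Complex.sub_im, Complex.add_im, Complex.one_re, Complex.one_im]
    ring
  have hz1 : z + 1 ≠ 0 := by
    intro h0
    rw [h0, mul_zero, sub_eq_zero] at h
    rw [h] at h0
    norm_num at h0
  have h2 : ((z - 1) * starRingEnd ℂ (z + 1)).re = s.re * ‖z + 1‖ ^ 2 := by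
    rw [h, mul_assoc, Complex.mul_conj, Complex.normSq_eq_norm_sq]
    norm_cast
    rw [Complex.re_mul_ofReal]
  have h3 : ((z - 1) * starRingEnd ℂ (z + 1)).re = ‖z‖ ^ 2 - 1 := by
    simp only [Complex.sq_norm, Complex.normSq_apply, map_add, map_one, Complex.mul_re,
      Complex.sub_re, Complex.add_re, Complex.conj_re, Complex.sub_im, Complex.add_im,
      Complex.conj_im, Complex.one_re, Complex.one_im]
    ring
  have h4 : 0 < ‖z + 1‖ ^ 2 := by positivity
  nlinarith [norm_nonneg z]

theorem IsHurwitz.tendsto_cayley_pow {F : Matrix (Fin n) (Fin n) ℝ} (hF : IsHurwitz F)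
    (v : Fin n → ℝ) : Tendsto (fun k => cayley F ^ k *ᵥ v) atTop (𝓝 0) := by
  have key : Tendsto (fun k => toComplex (cayley F) ^ k) atTop (𝓝 0) := by
    refine tendsto_pow_zero_of_spectrum _ fun z hz => ?_
    obtain ⟨v, hv, hz⟩ := (mem_spectrum_iff_exists_mulVec _ _).1 hz
    set w := toComplex (1 - F)⁻¹ *ᵥ v
    have hw : v = w - toComplex F *ᵥ w := by
      have : toComplex (1 - F) *ᵥ w = v := by
        rw [mulVec_mulVec, ← toComplex_mul, Matrix.mul_nonsing_inv _ hF.isUnit_one_sub,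
          toComplex_one, one_mulVec]
      rw [← this, toComplex_sub, toComplex_one, sub_mulVec, one_mulVec]
    have hw2 : w + toComplex F *ᵥ w = z • v := by
      rw [← hz, cayley, toComplex_mul, ← mulVec_mulVec, toComplex_add, toComplex_one, add_mulVec,
        one_mulVec]
    have hw0 : w ≠ 0 := by
      intro h
      rw [h, mulVec_zero, sub_zero] at hw
      exact hv hw
    -- An eigenvector of the Cayley transform for `z` pulls back to one of `F` for `(z - 1) / (z +
    -- 1)`.
    have h1 : (z + 1) • (toComplex F *ᵥ w) = (z - 1) • w := by
      rw [hw] at hw2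
      ext i
      have := congrFun hw2 i
      simp only [Pi.add_apply, Pi.smul_apply, Pi.sub_apply, smul_eq_mul] at this ⊢
      linear_combination this
    have hz1 : z + 1 ≠ 0 := by
      intro h0
      rw [h0, zero_smul, eq_neg_of_add_eq_zero_left h0] at h1
      have := h1.symm
      rw [smul_eq_zero] at this
      norm_num at this
      exact hw0 this
    refine norm_lt_one_of_cayley (s := (z - 1) / (z + 1)) ?_ (by field_simp)
    refine (isHurwitz_iff F).1 hF _ w hw0 ?_
    rw [div_eq_inv_mul, mul_smul, ← h1, smul_smul, inv_mul_cancel₀ hz1, one_smul]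
  rw [tendsto_pi_nhds]
  intro i
  have h2 : Tendsto (fun k => (toComplex (cayley F ^ k) *ᵥ fun i => (v i : ℂ)) i) atTop
      (𝓝 (((0 : Matrix (Fin n) (Fin n) ℂ) *ᵥ fun i => (v i : ℂ)) i)) := by
    have hc : Continuous fun X : Matrix (Fin n) (Fin n) ℂ => (X *ᵥ fun i => (v i : ℂ)) i :=
      (continuous_apply i).comp (continuous_id.matrix_mulVec continuous_const)
    simp_rw [toComplex_pow]
    exact (hc.tendsto _).comp key
  simp_rw [toComplex_mulVec_ofReal, zero_mulVec] at h2
  have h3 := (Complex.continuous_re.tendsto _).comp h2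
  simpa [Function.comp_def] using h3

/-- Lyapunov's theorem: a solution of a strict Lyapunov inequality for a Hurwitz matrix is
positive definite. -/
theorem IsHurwitz.quadForm_pos {F X : Matrix (Fin n) (Fin n) ℝ} (hF : IsHurwitz F)
    (hX : Xᵀ = X) (h : ∀ v, v ≠ 0 → v ⬝ᵥ ((X * F) *ᵥ v) < 0) :
    ∀ v, v ≠ 0 → 0 < v ⬝ᵥ (X *ᵥ v) := by
  set q : (Fin n → ℝ) → ℝ := fun v => v ⬝ᵥ (X *ᵥ v)
  -- For `v = (1 - F) w`, the form changes under the Cayley transform by `4 w · X F w`, so the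
  -- continuous-time inequality becomes a strict decrease along a discrete orbit that converges to
  -- `0`.
  have hlt : ∀ v, v ≠ 0 → q (cayley F *ᵥ v) < q v := by
    intro v hv
    obtain ⟨w, rfl⟩ := hF.exists_one_sub_mulVec v
    have hw : w ≠ 0 := fun h => hv (by rw [h, mulVec_zero])
    have h1 := h w hw
    rw [hF.cayley_mulVec]
    have h2 : (F *ᵥ w) ⬝ᵥ (X *ᵥ w) = w ⬝ᵥ (X *ᵥ (F *ᵥ w)) :=
      dotProduct_mulVec_comm hX _ _
    simp only [q, sub_mulVec, add_mulVec, one_mulVec, mulVec_add, mulVec_sub, dotProduct_add,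
      dotProduct_sub, add_dotProduct, sub_dotProduct, h2]
    rw [← mulVec_mulVec] at h1
    linarith
  have hle : ∀ v, q (cayley F *ᵥ v) ≤ q v := fun v => by
    by_cases hv : v = 0
    · simp [hv]
    · exact (hlt v hv).le
  have hnonneg : ∀ v, 0 ≤ q v := by
    intro v
    have hanti : Antitone fun k => q (cayley F ^ k *ᵥ v) := antitone_nat_of_succ_le fun k => by
      rw [pow_succ', ← mulVec_mulVec]
      exact hle _
    have hlim : Tendsto (fun k => q (cayley F ^ k *ᵥ v)) atTop (𝓝 (q 0)) := by
      have hq : Continuous q := continuous_id.dotProduct (continuous_const.matrix_mulVec continuous_id)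
      exact (hq.tendsto _).comp (hF.tendsto_cayley_pow v)
    have := hanti.le_of_tendsto hlim 0
    simpa [q] using this
  exact fun v hv => (hnonneg _).trans_lt (hlt v hv)

/-- The homogeneous equation says that the bilinear form of `X` is invariant under the Cayley
transform, whose powers tend to zero; hence the form vanishes. -/
theorem IsHurwitz.lyapunov_injective {F X : Matrix (Fin n) (Fin n) ℝ} (hF : IsHurwitz F)
    (h : Fᵀ * X + X * F = 0) : X = 0 := by
  set b : (Fin n → ℝ) → (Fin n → ℝ) → ℝ := fun v w => v ⬝ᵥ (X *ᵥ w)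
  have hb : ∀ v w, b (cayley F *ᵥ v) (cayley F *ᵥ w) = b v w := by
    intro v w
    obtain ⟨v, rfl⟩ := hF.exists_one_sub_mulVec v
    obtain ⟨w, rfl⟩ := hF.exists_one_sub_mulVec w
    have h1 : v ⬝ᵥ ((Fᵀ * X + X * F) *ᵥ w) = 0 := by rw [h, zero_mulVec, dotProduct_zero]
    rw [add_mulVec, dotProduct_add, ← mulVec_mulVec, ← mulVec_mulVec,
      dotProduct_mulVec_transpose] at h1
    rw [hF.cayley_mulVec, hF.cayley_mulVec]
    simp only [b, sub_mulVec, add_mulVec, one_mulVec, mulVec_add, mulVec_sub, dotProduct_add,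
      dotProduct_sub, add_dotProduct, sub_dotProduct]
    linarith
  have hb0 : ∀ v w, b v w = 0 := by
    intro v w
    have hconst : ∀ k : ℕ, b (cayley F ^ k *ᵥ v) (cayley F ^ k *ᵥ w) = b v w := by
      intro k
      induction k with
      | zero => simp
      | succ k ih => rw [pow_succ', ← mulVec_mulVec, ← mulVec_mulVec, hb, ih]
    have hc : Continuous fun p : (Fin n → ℝ) × (Fin n → ℝ) => b p.1 p.2 :=
      continuous_fst.dotProduct (continuous_const.matrix_mulVec continuous_snd)
    have hlim := (hc.tendsto (0, 0)).comp
      ((hF.tendsto_cayley_pow v).prodMk_nhds (hF.tendsto_cayley_pow w))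
    simp only [Function.comp_def, hconst] at hlim
    have := tendsto_nhds_unique hlim tendsto_const_nhds
    simpa [b] using this.symm
  ext i j
  simpa [b, mulVec_single_one, single_one_dotProduct] using hb0 (Pi.single i 1) (Pi.single j 1)

/-- Lyapunov's theorem: existence of a quadratic Lyapunov function. -/
theorem IsHurwitz.exists_lyapunov {F : Matrix (Fin n) (Fin n) ℝ} (hF : IsHurwitz F) :
    ∃ S : Matrix (Fin n) (Fin n) ℝ, S.PosDef ∧ Fᵀ * S + S * F = -1 := by
  let φ : Matrix (Fin n) (Fin n) ℝ →ₗ[ℝ] Matrix (Fin n) (Fin n) ℝ :=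
    LinearMap.mulLeft ℝ Fᵀ + LinearMap.mulRight ℝ F
  have hφ : Function.Injective φ := (injective_iff_map_eq_zero φ).2 fun X hX =>
    hF.lyapunov_injective hX
  -- The Lyapunov operator is injective on a finite-dimensional space, hence onto; no integral of
  -- matrix exponentials is needed.
  obtain ⟨S, hS⟩ := LinearMap.injective_iff_surjective.1 hφ (-1)
  have hS : Fᵀ * S + S * F = -1 := hS
  -- The transpose solves the same equation, so symmetry follows from uniqueness.
  have hST : Sᵀ = S := by
    apply hφ
    change Fᵀ * Sᵀ + Sᵀ * F = Fᵀ * S + S * F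
    rw [hS, ← transpose_one, ← transpose_neg, ← hS]
    simp [add_comm]
  refine ⟨S, ?_, hS⟩
  refine Matrix.PosDef.of_dotProduct_mulVec_pos (by simpa [IsHermitian] using hST) ?_
  refine fun v hv => hF.quadForm_pos hST (fun v hv => ?_) v hv
  have h1 : v ⬝ᵥ ((Fᵀ * S + S * F) *ᵥ v) = - (v ⬝ᵥ v) := by
    rw [hS, neg_mulVec, one_mulVec, dotProduct_neg]
  have h2 : v ⬝ᵥ ((Fᵀ * S) *ᵥ v) = v ⬝ᵥ ((S * F) *ᵥ v) := by
    rw [← mulVec_mulVec, dotProduct_mulVec_transpose, ← mulVec_mulVec,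
      dotProduct_mulVec_comm hST]
  have h3 : 0 < v ⬝ᵥ v := by
    simpa using (Matrix.dotProduct_star_self_pos_iff (v := v)).2 hv
  rw [add_mulVec, dotProduct_add, h2] at h1
  linarith

end Lyapunov

/-! ### Invariant zeros and zero dynamics. -/

section Zeros

variable {n m : ℕ}

/-- All invariant zeros of the system `(A, B, H)` whose state direction is nonzero lie in the open
left half plane. -/
def HasStableZeros (A : Matrix (Fin n) (Fin n) ℝ) (B : Matrix (Fin n) (Fin m) ℝ)
    (H : Matrix (Fin m) (Fin n) ℝ) : Prop :=
  ∀ (s : ℂ) (x : Fin n → ℂ) (u : Fin m → ℂ), toComplex H *ᵥ x = 0 →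
    toComplex A *ᵥ x - s • x = toComplex B *ᵥ u → x ≠ 0 → s.re < 0

theorem IsMinimumPhase.hasStableZeros {A : Matrix (Fin n) (Fin n) ℝ}
    {B : Matrix (Fin n) (Fin m) ℝ} {H : Matrix (Fin m) (Fin n) ℝ} (h : IsMinimumPhase A B H) :
    HasStableZeros A B H := by
  intro s x u hx hu hx0
  refine h s (Matrix.exists_mulVec_eq_zero_iff.1 ⟨Sum.elim x u, ?_, ?_⟩)
  · exact fun h0 => hx0 (funext fun i => congrFun h0 (Sum.inl i))
  · rw [Matrix.fromBlocks_mulVec]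
    simp only [Sum.elim_comp_inl, Sum.elim_comp_inr]
    rw [sub_mulVec, neg_mulVec, hx, zero_mulVec, neg_zero, add_zero, ← hu, smul_mulVec,
      one_mulVec]
    ext i
    rcases i with i | i <;> simp

/-- The added term acts through `H x`, which is zero along a zero direction. -/
theorem HasStableZeros.add_mul_output {A : Matrix (Fin n) (Fin n) ℝ}
    {B : Matrix (Fin n) (Fin m) ℝ} {H : Matrix (Fin m) (Fin n) ℝ} (h : HasStableZeros A B H)
    (L : Matrix (Fin n) (Fin m) ℝ) : HasStableZeros (A + L * H) B H := by
  intro s x u hx hu hx0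
  refine h s x u hx ?_ hx0
  rwa [toComplex_add, toComplex_mul, add_mulVec, ← mulVec_mulVec, hx, mulVec_zero,
    add_zero] at hu

/-- The feedback term lies in the range of `B` and is absorbed into the input direction. -/
theorem HasStableZeros.add_input_mul {A : Matrix (Fin n) (Fin n) ℝ}
    {B : Matrix (Fin n) (Fin m) ℝ} {H : Matrix (Fin m) (Fin n) ℝ} (h : HasStableZeros A B H)
    (G : Matrix (Fin m) (Fin n) ℝ) : HasStableZeros (A + B * G) B H := by
  intro s x u hx hu hx0
  refine h s x (u - toComplex G *ᵥ x) hx ?_ hx0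
  rw [toComplex_add, toComplex_mul, add_mulVec, ← mulVec_mulVec] at hu
  rw [mulVec_sub, ← hu]
  abel

theorem HasStableZeros.mul_output {A : Matrix (Fin n) (Fin n) ℝ}
    {B : Matrix (Fin n) (Fin m) ℝ} {H : Matrix (Fin m) (Fin n) ℝ} (h : HasStableZeros A B H)
    {N : Matrix (Fin m) (Fin m) ℝ} (hN : IsUnit N.det) : HasStableZeros A B (N * H) := by
  intro s x u hx hu hx0
  refine h s x u ?_ hu hx0
  have := congrArg (fun y => toComplex N⁻¹ *ᵥ y) hx
  simpa only [mulVec_mulVec, ← toComplex_mul, ← Matrix.mul_assoc, Matrix.nonsing_inv_mul _ hN,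
    Matrix.one_mul, mulVec_zero] using this

/-- The projection onto the kernel of `H` along the range of `B`. -/
noncomputable def kerProj (B : Matrix (Fin n) (Fin m) ℝ) (H : Matrix (Fin m) (Fin n) ℝ) :
    Matrix (Fin n) (Fin n) ℝ :=
  1 - B * (H * B)⁻¹ * H

variable {A : Matrix (Fin n) (Fin n) ℝ} {B : Matrix (Fin n) (Fin m) ℝ}
  {H : Matrix (Fin m) (Fin n) ℝ}

theorem mul_kerProj (hHB : IsUnit (H * B).det) : H * kerProj B H = 0 := by
  rw [kerProj, Matrix.mul_sub, Matrix.mul_one, ← Matrix.mul_assoc, ← Matrix.mul_assoc,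
    Matrix.mul_nonsing_inv _ hHB, Matrix.one_mul, sub_self]

theorem kerProj_mul (hHB : IsUnit (H * B).det) : kerProj B H * B = 0 := by
  rw [kerProj, Matrix.sub_mul, Matrix.one_mul, Matrix.mul_assoc, Matrix.mul_assoc,
    Matrix.nonsing_inv_mul _ hHB, Matrix.mul_one, sub_self]

theorem kerProj_mulVec_of_ker {v : Fin n → ℝ} (hv : H *ᵥ v = 0) : kerProj B H *ᵥ v = v := by
  rw [kerProj, sub_mulVec, one_mulVec, ← mulVec_mulVec, hv, mulVec_zero, sub_zero]

theorem toComplex_kerProj_mulVec (v : Fin n → ℂ) :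
    toComplex (kerProj B H) *ᵥ v =
      v - toComplex B *ᵥ (toComplex ((H * B)⁻¹ * H) *ᵥ v) := by
  rw [kerProj, toComplex_sub, toComplex_one, sub_mulVec, one_mulVec, Matrix.mul_assoc,
    toComplex_mul, ← mulVec_mulVec]

theorem toComplex_kerProj_mulVec_of_ker {v : Fin n → ℂ} (hv : toComplex H *ᵥ v = 0) :
    toComplex (kerProj B H) *ᵥ v = v := by
  rw [toComplex_kerProj_mulVec, toComplex_mul, ← mulVec_mulVec, hv, mulVec_zero, mulVec_zero,
    sub_zero]

theorem toComplex_mulVec_kerProj (hHB : IsUnit (H * B).det) (v : Fin n → ℂ) :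
    toComplex H *ᵥ (toComplex (kerProj B H) *ᵥ v) = 0 := by
  rw [mulVec_mulVec, ← toComplex_mul, mul_kerProj hHB, toComplex_zero, zero_mulVec]

theorem toComplex_kerProj_mulVec_input (hHB : IsUnit (H * B).det) (u : Fin m → ℂ) :
    toComplex (kerProj B H) *ᵥ (toComplex B *ᵥ u) = 0 := by
  rw [mulVec_mulVec, ← toComplex_mul, kerProj_mul hHB, toComplex_zero, zero_mulVec]

/-- The zero dynamics of `(A, B, H)` on the kernel of `H`, extended by `-1` on the range
of `B`. -/
noncomputable def zeroDynamics (A : Matrix (Fin n) (Fin n) ℝ) (B : Matrix (Fin n) (Fin m) ℝ)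
    (H : Matrix (Fin m) (Fin n) ℝ) : Matrix (Fin n) (Fin n) ℝ :=
  kerProj B H * A * kerProj B H - (1 - kerProj B H)

/-- Project an eigenvector `v` to `w = N v`. If `w = 0`, the eigenvalue is `-1`. Otherwise `N A w =
s w`, so `A w - s w` lies in the range of `B` and `s` is a zero with state direction `w`. -/
theorem HasStableZeros.isHurwitz_zeroDynamics (hHB : IsUnit (H * B).det)
    (h : HasStableZeros A B H) : IsHurwitz (zeroDynamics A B H) := by
  rw [isHurwitz_iff]
  intro s v hv hs
  set w := toComplex (kerProj B H) *ᵥ v with hw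
  have hHw : toComplex H *ᵥ w = 0 := toComplex_mulVec_kerProj hHB v
  have hPw : toComplex (kerProj B H) *ᵥ w = w := toComplex_kerProj_mulVec_of_ker hHw
  have hs1 : toComplex (kerProj B H) *ᵥ (toComplex A *ᵥ w) - (v - w) = s • v := by
    rw [← hs, zeroDynamics, toComplex_sub, toComplex_sub, toComplex_one, toComplex_mul,
      toComplex_mul, sub_mulVec, sub_mulVec, one_mulVec, ← mulVec_mulVec, ← mulVec_mulVec]
  have hs2 : toComplex (kerProj B H) *ᵥ (toComplex A *ᵥ w) = s • w := by
    have := congrArg (fun y => toComplex (kerProj B H) *ᵥ y) hs1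
    simp only [mulVec_sub, mulVec_smul, ← hw, hPw, sub_self, sub_zero] at this
    rwa [toComplex_kerProj_mulVec_of_ker (toComplex_mulVec_kerProj hHB _)] at this
  by_cases hw0 : w = 0
  · rw [hw0, mulVec_zero, mulVec_zero, sub_zero, zero_sub] at hs1
    have : s = -1 := by
      obtain ⟨i, hi⟩ := Function.ne_iff.1 hv
      have := congrFun hs1 i
      simp only [Pi.neg_apply, Pi.smul_apply, smul_eq_mul] at this
      have h2 : (s + 1) * v i = 0 := by linear_combination -this
      exact eq_neg_of_add_eq_zero_left ((mul_eq_zero.1 h2).resolve_right hi)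
    rw [this]
    norm_num
  · refine h s w (toComplex ((H * B)⁻¹ * H) *ᵥ (toComplex A *ᵥ w)) hHw ?_ hw0
    rw [← hs2, toComplex_kerProj_mulVec]
    abel

/-- This confines the zeros to the spectrum of one matrix, hence to a finite set. -/
theorem mem_spectrum_zeroDynamics (hHB : IsUnit (H * B).det) {s : ℂ} {x : Fin n → ℂ}
    {u : Fin m → ℂ} (hx : toComplex H *ᵥ x = 0)
    (hu : toComplex A *ᵥ x - s • x = toComplex B *ᵥ u) (hx0 : x ≠ 0) :
    s ∈ spectrum ℂ (toComplex (zeroDynamics A B H)) := by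
  refine (mem_spectrum_iff_exists_mulVec _ _).2 ⟨x, hx0, ?_⟩
  have hPx : toComplex (kerProj B H) *ᵥ x = x := toComplex_kerProj_mulVec_of_ker hx
  rw [zeroDynamics, toComplex_sub, toComplex_sub, toComplex_one, toComplex_mul,
    toComplex_mul, sub_mulVec, sub_mulVec, one_mulVec, ← mulVec_mulVec, ← mulVec_mulVec, hPx,
    sub_self, sub_zero, sub_eq_iff_eq_add.1 hu, mulVec_add, mulVec_smul, hPx,
    toComplex_kerProj_mulVec_input hHB, zero_add]

theorem exists_re_lt_neg_of_finite {T : Set ℂ} (hT : T.Finite) {ε : ℝ} (hε : 0 < ε) :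
    ∃ δ, 0 < δ ∧ δ < ε ∧ ∀ z ∈ T, z.re < 0 → z.re < -δ := by
  have h : ∀ᶠ δ in 𝓝[>] (0 : ℝ), ∀ z ∈ T, z.re < 0 → z.re < -δ := by
    refine (eventually_all_finite hT).2 fun z _ => ?_
    by_cases hz : z.re < 0
    · filter_upwards [Ioo_mem_nhdsGT (neg_pos.2 hz)] with δ hδ _
      linarith [hδ.2]
    · exact Eventually.of_forall fun _ h => absurd h hz
  obtain ⟨δ, hδ, h1, h2⟩ := (h.and (Ioo_mem_nhdsGT hε)).exists
  exact ⟨δ, h1, h2, hδ⟩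

/-- Zeros and eigenvalues in the open left half plane are finite in number, so a thin strip to the
left of the imaginary axis misses them. Frequency conditions can then be imposed on `Re s = -δ`,
where the resolvent exists and no zero lies. -/
theorem HasStableZeros.exists_shift (hHB : IsUnit (H * B).det) (h : HasStableZeros A B H)
    {ε : ℝ} (hε : 0 < ε) :
    ∃ δ, 0 < δ ∧ δ < ε ∧ HasStableZeros (A + δ • 1) B H ∧
      ∀ s : ℂ, s.re = -δ → IsUnit (s • (1 : Matrix (Fin n) (Fin n) ℂ) - toComplex A) := by
  obtain ⟨δ, hδ0, hδε, hδ⟩ := exists_re_lt_neg_of_finite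
    ((Matrix.finite_spectrum (toComplex (zeroDynamics A B H))).union
      (Matrix.finite_spectrum (toComplex A))) hε
  refine ⟨δ, hδ0, hδε, ?_, ?_⟩
  · intro s x u hx hu hx0
    have hu' : toComplex A *ᵥ x - (s - δ) • x = toComplex B *ᵥ u := by
      rw [← hu, toComplex_add, toComplex_smul, toComplex_one, add_mulVec, smul_mulVec, one_mulVec,
        sub_smul]
      abel
    have := hδ _ (Or.inl (mem_spectrum_zeroDynamics hHB hx hu' hx0)) (h _ x u hx hu' hx0)
    rw [Complex.sub_re, Complex.ofReal_re] at this
    linarith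
  · intro s hs
    by_contra hns
    have hmem : s ∈ spectrum ℂ (toComplex A) := by
      rw [spectrum.mem_iff, Algebra.algebraMap_eq_smul_one]
      exact hns
    have := hδ s (Or.inr hmem) (by linarith)
    linarith

end Zeros

/-! ### Strict negativity of quadratic forms. -/

section QuadraticForms

variable {n m : ℕ}

theorem forall_quadForm_neg_iff_sphere (X : Matrix (Fin n) (Fin n) ℝ) :
    (∀ v, v ≠ 0 → v ⬝ᵥ (X *ᵥ v) < 0) ↔
      ∀ v ∈ Metric.sphere (0 : Fin n → ℝ) 1, v ⬝ᵥ (X *ᵥ v) < 0 := by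
  refine ⟨fun h v hv => h v ?_, fun h v hv => ?_⟩
  · exact fun h0 => by simp [h0] at hv
  · have h1 := h (‖v‖⁻¹ • v) (by simp [norm_smul, hv])
    rw [mulVec_smul, smul_dotProduct, dotProduct_smul, smul_smul, smul_eq_mul] at h1
    have : 0 < ‖v‖⁻¹ * ‖v‖⁻¹ := by positivity
    exact neg_of_mul_neg_right h1 this.le

/-- Negativity is a condition on the compact unit sphere. Openness provides both the small
perturbations below and the open convex set of the separation argument. -/
theorem isOpen_setOf_quadForm_neg :
    IsOpen {X : Matrix (Fin n) (Fin n) ℝ | ∀ v, v ≠ 0 → v ⬝ᵥ (X *ᵥ v) < 0} := by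
  simp only [forall_quadForm_neg_iff_sphere]
  rw [isOpen_iff_eventually]
  intro X hX
  refine (isCompact_sphere _ _).eventually_forall_of_forall_eventually fun v hv => ?_
  have hc : Continuous fun p : Matrix (Fin n) (Fin n) ℝ × (Fin n → ℝ) => p.2 ⬝ᵥ (p.1 *ᵥ p.2) :=
    continuous_snd.dotProduct (continuous_fst.matrix_mulVec continuous_snd)
  exact hc.continuousAt.eventually_lt_const (hX v hv)

theorem exists_quadForm_add_smul_neg {X : Matrix (Fin n) (Fin n) ℝ}
    (hX : ∀ v, v ≠ 0 → v ⬝ᵥ (X *ᵥ v) < 0) (Y : Matrix (Fin n) (Fin n) ℝ) :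
    ∃ ε : ℝ, 0 < ε ∧ ∀ v, v ≠ 0 → v ⬝ᵥ ((X + ε • Y) *ᵥ v) < 0 := by
  have hc : Continuous fun ε : ℝ => X + ε • Y := by fun_prop
  have hmem : X + (0 : ℝ) • Y ∈
      {X : Matrix (Fin n) (Fin n) ℝ | ∀ v, v ≠ 0 → v ⬝ᵥ (X *ᵥ v) < 0} := by
    rw [zero_smul, add_zero]
    exact hX
  have h : ∀ᶠ ε : ℝ in 𝓝[>] 0, ∀ v, v ≠ 0 → v ⬝ᵥ ((X + ε • Y) *ᵥ v) < 0 :=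
    nhdsWithin_le_nhds ((hc.tendsto 0).eventually (isOpen_setOf_quadForm_neg.mem_nhds hmem))
  obtain ⟨ε, hε, hε0⟩ := (h.and self_mem_nhdsWithin).exists
  exact ⟨ε, hε0, hε⟩

/-- Finsler's lemma. -/
theorem exists_quadForm_sub_neg {X : Matrix (Fin n) (Fin n) ℝ} {H : Matrix (Fin m) (Fin n) ℝ}
    (h : ∀ v, v ≠ 0 → H *ᵥ v = 0 → v ⬝ᵥ (X *ᵥ v) < 0) :
    ∃ γ : ℝ, ∀ v, v ≠ 0 → v ⬝ᵥ ((X - γ • (Hᵀ * H)) *ᵥ v) < 0 := by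
  have hform : ∀ (γ : ℝ) v, v ⬝ᵥ ((X - γ • (Hᵀ * H)) *ᵥ v) =
      v ⬝ᵥ (X *ᵥ v) - γ * ((H *ᵥ v) ⬝ᵥ (H *ᵥ v)) := by
    intro γ v
    rw [sub_mulVec, dotProduct_sub, smul_mulVec, dotProduct_smul, ← mulVec_mulVec,
      dotProduct_mulVec_transpose, smul_eq_mul]
  have hnn : ∀ v, 0 ≤ (H *ᵥ v) ⬝ᵥ (H *ᵥ v) := fun v => by
    simpa using dotProduct_star_self_nonneg (H *ᵥ v)
  have hc : Continuous fun v => (H *ᵥ v) ⬝ᵥ (H *ᵥ v) :=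
    (continuous_const.matrix_mulVec continuous_id).dotProduct
      (continuous_const.matrix_mulVec continuous_id)
  have hcX : Continuous fun v => v ⬝ᵥ (X *ᵥ v) :=
    continuous_id.dotProduct (continuous_const.matrix_mulVec continuous_id)
  -- The sets where penalty `k` already suffices are open and increase with `k`. They cover the
  -- sphere: off the kernel of `H` a large `k` wins, and on it `k = 0` does.
  obtain ⟨k, hk⟩ := (isCompact_sphere (0 : Fin n → ℝ) 1).elim_directed_cover
    (fun k : ℕ => {v | v ⬝ᵥ (X *ᵥ v) - k * ((H *ᵥ v) ⬝ᵥ (H *ᵥ v)) < 0})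
    (fun k => isOpen_lt (hcX.sub (continuous_const.mul hc)) continuous_const)
    (fun v hv => by
      have hv0 : v ≠ 0 := fun h0 => by simp [h0] at hv
      rw [mem_iUnion]
      by_cases hHv : H *ᵥ v = 0
      · exact ⟨0, by simpa using h v hv0 hHv⟩
      · have hpos : 0 < (H *ᵥ v) ⬝ᵥ (H *ᵥ v) := by
          simpa using (dotProduct_star_self_pos_iff (v := H *ᵥ v)).2 hHv
        obtain ⟨k, hk⟩ := exists_nat_gt (v ⬝ᵥ (X *ᵥ v) / ((H *ᵥ v) ⬝ᵥ (H *ᵥ v)))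
        refine ⟨k, ?_⟩
        rw [div_lt_iff₀ hpos] at hk
        simpa using hk)
    (directed_of_isDirected_le fun k l hkl v hv => by
      have : (k : ℝ) ≤ l := by exact_mod_cast hkl
      have := mul_le_mul_of_nonneg_right this (hnn v)
      change _ < (0 : ℝ) at hv
      change _ < (0 : ℝ)
      linarith)
  refine ⟨k, (forall_quadForm_neg_iff_sphere _).2 fun v hv => ?_⟩
  rw [hform]
  exact hk hv

end QuadraticForms

/-! ### From a Lyapunov matrix to strict positive realness. -/

section PositiveReal

variable {n m : ℕ} {A : Matrix (Fin n) (Fin n) ℝ} {B : Matrix (Fin n) (Fin m) ℝ}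
  {H : Matrix (Fin m) (Fin n) ℝ}

/-- Energy balance at frequency `s`: `x* P x` is real since `P` is symmetric, and `P B = Hᵀ` turns
the input term into the conjugate of the supply `u* H x`. -/
theorem re_form_of_resolvent {P : Matrix (Fin n) (Fin n) ℝ} (hP : Pᵀ = P) (hPB : P * B = Hᵀ)
    {s : ℂ} {x : Fin n → ℂ} {u : Fin m → ℂ}
    (hx : toComplex A *ᵥ x = s • x - toComplex B *ᵥ u) :
    (star x ⬝ᵥ (toComplex (P * A) *ᵥ x)).re =
      s.re * (star x ⬝ᵥ (toComplex P *ᵥ x)).re - (star u ⬝ᵥ (toComplex H *ᵥ x)).re := by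
  have hreal : (star x ⬝ᵥ (toComplex P *ᵥ x)).im = 0 := by
    have h1 : star (star x ⬝ᵥ (toComplex P *ᵥ x)) = star x ⬝ᵥ (toComplex P *ᵥ x) := by
      conv_rhs => rw [← hP, toComplex_transpose, star_dotProduct_conjTranspose_mulVec]
      rw [star_dotProduct, star_star]
    exact Complex.conj_eq_iff_im.1 h1
  have hB : star x ⬝ᵥ (toComplex P *ᵥ (toComplex B *ᵥ u)) =
      starRingEnd ℂ (star u ⬝ᵥ (toComplex H *ᵥ x)) := by
    rw [mulVec_mulVec, ← toComplex_mul, hPB, toComplex_transpose,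
      star_dotProduct_conjTranspose_mulVec, starRingEnd_apply, star_dotProduct]
  rw [toComplex_mul, ← mulVec_mulVec, hx, mulVec_sub, mulVec_smul, dotProduct_sub,
    dotProduct_smul, hB, smul_eq_mul, Complex.sub_re, Complex.mul_re, hreal, Complex.conj_re,
    mul_zero, sub_zero]

theorem resolvent_mulVec {s : ℂ}
    (hs : IsUnit (s • (1 : Matrix (Fin n) (Fin n) ℂ) - toComplex A)) (y : Fin n → ℂ) :
    toComplex A *ᵥ ((s • (1 : Matrix (Fin n) (Fin n) ℂ) - toComplex A)⁻¹ *ᵥ y) =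
      s • ((s • (1 : Matrix (Fin n) (Fin n) ℂ) - toComplex A)⁻¹ *ᵥ y) - y := by
  have h := congrArg (fun X => X *ᵥ y)
    (Matrix.mul_nonsing_inv _ ((Matrix.isUnit_iff_isUnit_det _).1 hs))
  simp only [← mulVec_mulVec, one_mulVec, sub_mulVec, smul_mulVec] at h
  rw [eq_sub_iff_add_eq, add_comm, ← sub_eq_iff_eq_add.1 h]

theorem transferMatrix_mulVec (s : ℂ) (u : Fin m → ℂ) :
    transferMatrix A B H s *ᵥ u = toComplex H *ᵥ
      ((s • (1 : Matrix (Fin n) (Fin n) ℂ) - toComplex A)⁻¹ *ᵥ (toComplex B *ᵥ u)) := by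
  rw [transferMatrix, mulVec_mulVec, mulVec_mulVec, Matrix.mul_assoc]

theorem map_conj_transferMatrix (s : ℂ) :
    (transferMatrix A B H s).map (starRingEnd ℂ) = transferMatrix A B H (starRingEnd ℂ s) := by
  have hX : (s • (1 : Matrix (Fin n) (Fin n) ℂ) - toComplex A).map (starRingEnd ℂ) =
      starRingEnd ℂ s • 1 - toComplex A := by
    conv_rhs => rw [← map_conj_toComplex A]
    ext i j
    simp [Matrix.one_apply, apply_ite (starRingEnd ℂ)]
  rw [transferMatrix, transferMatrix, Matrix.map_mul, Matrix.map_mul, map_conj_toComplex,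
    map_conj_toComplex, ← hX]
  congr 2
  -- Entrywise conjugation is rewritten as conjugate transpose followed by transpose, both of which
  -- commute with inversion.
  change ((s • (1 : Matrix (Fin n) (Fin n) ℂ) - toComplex A)⁻¹)ᴴᵀ =
    ((s • (1 : Matrix (Fin n) (Fin n) ℂ) - toComplex A)ᴴᵀ)⁻¹
  rw [conjTranspose_nonsing_inv, transpose_nonsing_inv]

section Norm

attribute [local instance] Matrix.linftyOpNormedRing Matrix.linftyOpNormedAlgebra

theorem differentiableAt_transferMatrix {s : ℂ}
    (hs : IsUnit (s • (1 : Matrix (Fin n) (Fin n) ℂ) - toComplex A)) (i j : Fin m) :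
    DifferentiableAt ℂ (fun z => transferMatrix A B H z i j) s := by
  have hcomplete : CompleteSpace (Matrix (Fin n) (Fin n) ℂ) := FiniteDimensional.complete ℂ _
  have h1 : DifferentiableAt ℂ
      (fun z : ℂ => (z • (1 : Matrix (Fin n) (Fin n) ℂ) - toComplex A)⁻¹) s := by
    simp only [Matrix.nonsing_inv_eq_ringInverse]
    obtain ⟨U, hU⟩ := hs
    refine DifferentiableAt.comp s (g := Ring.inverse) ?_ (by fun_prop)
    rw [← hU]
    exact differentiableAt_inverse U.isUnit
  let φ : Matrix (Fin n) (Fin n) ℂ →ₗ[ℂ] ℂ :=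
    { toFun := fun X => (toComplex H * X * toComplex B) i j
      map_add' := fun X Y => by simp [Matrix.mul_add, Matrix.add_mul]
      map_smul' := fun c X => by simp }
  exact (LinearMap.toContinuousLinearMap φ).differentiableAt.comp s h1

end Norm

open scoped ComplexOrder in
theorem posSemidef_conjTranspose_add_iff (Z : Matrix (Fin m) (Fin m) ℂ) :
    (Zᴴ + Z).PosSemidef ↔ ∀ u, 0 ≤ (star u ⬝ᵥ (Z *ᵥ u)).re := by
  have hform : ∀ u, star u ⬝ᵥ ((Zᴴ + Z) *ᵥ u) = ((2 * (star u ⬝ᵥ (Z *ᵥ u)).re : ℝ) : ℂ) := by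
    intro u
    have : star (Z *ᵥ u) ⬝ᵥ u = starRingEnd ℂ (star u ⬝ᵥ (Z *ᵥ u)) := by
      rw [starRingEnd_apply, star_dotProduct]
    rw [add_mulVec, dotProduct_add, star_dotProduct_conjTranspose_mulVec, this, add_comm,
      Complex.add_conj]
  refine ⟨fun h u => ?_, fun h => Matrix.PosSemidef.of_dotProduct_mulVec_nonneg ?_ fun u => ?_⟩
  · have := h.dotProduct_mulVec_nonneg u
    rw [hform, Complex.zero_le_real] at this
    linarith
  · rw [IsHermitian, conjTranspose_add, conjTranspose_conjTranspose, add_comm]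
  · rw [hform, Complex.zero_le_real]
    linarith [h u]

theorem transpose_eq_conjTranspose_of_map_conj {Z W : Matrix (Fin m) (Fin m) ℂ}
    (h : Z.map (starRingEnd ℂ) = W) : Wᵀ = Zᴴ := by
  rw [← h]
  rfl

/-- Negativity of the form of `P A` survives the addition of a small `ε P`. At the shifted point `s
- ε` the energy balance then makes `Re (u* H x)` at least `Re s · x* P x`. The same balance with `u
= 0` rules out eigenvalues there. -/
theorem isSPR_of_lyapunov {P : Matrix (Fin n) (Fin n) ℝ} (hP : P.PosDef)
    (hneg : ∀ v, v ≠ 0 → v ⬝ᵥ ((P * A) *ᵥ v) < 0) (hPB : P * B = Hᵀ) :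
    IsSPR (transferMatrix A B H) := by
  have hPT : Pᵀ = P := by simpa [IsHermitian] using hP.1
  have hPpos : ∀ x : Fin n → ℂ, x ≠ 0 → 0 < (star x ⬝ᵥ (toComplex P *ᵥ x)).re := by
    intro x hx
    have := re_star_dotProduct_toComplex_neg (X := -P) (fun v hv => by
      rw [neg_mulVec, dotProduct_neg]
      simpa using hP.dotProduct_mulVec_pos hv) hx
    rw [← neg_one_smul ℝ P, toComplex_smul, smul_mulVec, dotProduct_smul] at this
    simpa using this
  obtain ⟨ε, hε0, hε⟩ := exists_quadForm_add_smul_neg hneg P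
  have hform : ∀ x : Fin n → ℂ, x ≠ 0 → (star x ⬝ᵥ (toComplex (P * A) *ᵥ x)).re +
      ε * (star x ⬝ᵥ (toComplex P *ᵥ x)).re < 0 := by
    intro x hx
    have := re_star_dotProduct_toComplex_neg hε hx
    rw [toComplex_add, toComplex_smul, add_mulVec, smul_mulVec, dotProduct_add,
      dotProduct_smul] at this
    simpa using this
  have hunit : ∀ s : ℂ, 0 < s.re →
      IsUnit ((s - ε) • (1 : Matrix (Fin n) (Fin n) ℂ) - toComplex A) := by
    intro s hs
    rw [isUnit_smul_one_sub_iff]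
    intro x hx
    by_contra hx0
    have h1 := re_form_of_resolvent (A := A) (u := 0) hPT hPB (by simpa using hx)
    have h2 := hform x hx0
    have h3 := hPpos x hx0
    simp only [star_zero, zero_dotProduct, Complex.zero_re, sub_zero, Complex.sub_re,
      Complex.ofReal_re] at h1
    nlinarith
  refine ⟨ε, hε0, ?_, ?_, ?_⟩
  · intro i j
    refine DifferentiableOn.analyticOnNhd (fun s hs => ?_)
      (isOpen_lt continuous_const Complex.continuous_re)
    refine DifferentiableAt.differentiableWithinAt ?_
    exact (differentiableAt_transferMatrix (hunit s hs) i j).comp s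
      (f := fun z : ℂ => z - ε) (by fun_prop)
  · intro s _
    rw [map_conj_transferMatrix]
    simp
  · intro s hs
    rw [transpose_eq_conjTranspose_of_map_conj (Z := transferMatrix A B H (s - ε))
      (by rw [map_conj_transferMatrix]; simp), posSemidef_conjTranspose_add_iff]
    intro u
    rw [transferMatrix_mulVec]
    set x := ((s - ε) • (1 : Matrix (Fin n) (Fin n) ℂ) - toComplex A)⁻¹ *ᵥ (toComplex B *ᵥ u)
      with hxdef
    by_cases hx0 : x = 0
    · simp [hx0]
    have h1 := re_form_of_resolvent hPT hPB (resolvent_mulVec (hunit s hs) (toComplex B *ᵥ u))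
    rw [← hxdef] at h1
    have h2 := hform x hx0
    have h3 := hPpos x hx0
    simp only [Complex.sub_re, Complex.ofReal_re] at h1
    nlinarith

end PositiveReal

/-! ### Construction of an SPR output injection. -/

section Synthesis

variable {n m : ℕ} {A : Matrix (Fin n) (Fin n) ℝ} {B C : Matrix (Fin n) (Fin m) ℝ}

/-- A system with invertible high-frequency gain and stable zeros is made strictly positive real
by output injection. -/
theorem exists_isSPRGain (hM : IsUnit (mixing B C).det) (hz : HasStableZeros A B Cᵀ) :
    ∃ L, IsSPRGain A B C L := by
  obtain ⟨S, hS, hSF⟩ := (hz.isHurwitz_zeroDynamics hM).exists_lyapunov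
  have hST : Sᵀ = S := by simpa [IsHermitian] using hS.1
  set N := kerProj B Cᵀ with hN
  -- The second summand kills `B`, so the first alone fixes `P B = C M`; the second carries the
  -- Lyapunov form of the zero dynamics on the kernel of `Cᵀ`.
  set P := C * Cᵀ + Nᵀ * S * N with hPdef
  have hPT : Pᵀ = P := by
    simp [hPdef, hST, Matrix.mul_assoc]
  have hPform : ∀ v, v ⬝ᵥ (P *ᵥ v) = (Cᵀ *ᵥ v) ⬝ᵥ (Cᵀ *ᵥ v) + (N *ᵥ v) ⬝ᵥ (S *ᵥ (N *ᵥ v)) := by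
    intro v
    rw [hPdef, add_mulVec, dotProduct_add, ← mulVec_mulVec, ← mulVec_mulVec, ← mulVec_mulVec,
      dotProduct_mulVec_transpose]
    congr 1
    have := dotProduct_mulVec_transpose Cᵀ v (Cᵀ *ᵥ v)
    rwa [transpose_transpose] at this
  have hP : P.PosDef := by
    refine Matrix.PosDef.of_dotProduct_mulVec_pos (by simpa [IsHermitian] using hPT) fun v hv => ?_
    rw [star_trivial, hPform]
    by_cases hCv : Cᵀ *ᵥ v = 0
    · have hNv : N *ᵥ v = v := kerProj_mulVec_of_ker hCv
      rw [hCv, hNv, zero_dotProduct, zero_add]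
      simpa using hS.dotProduct_mulVec_pos hv
    · have h1 : 0 < (Cᵀ *ᵥ v) ⬝ᵥ (Cᵀ *ᵥ v) := by
        simpa using (dotProduct_star_self_pos_iff (v := Cᵀ *ᵥ v)).2 hCv
      have h2 : 0 ≤ (N *ᵥ v) ⬝ᵥ (S *ᵥ (N *ᵥ v)) := by
        simpa using hS.posSemidef.dotProduct_mulVec_nonneg (N *ᵥ v)
      linarith
  have hPB : P * B = ((mixing B C)ᵀ * Cᵀ)ᵀ := by
    rw [hPdef, Matrix.add_mul, Matrix.mul_assoc _ N, hN, kerProj_mul hM, Matrix.mul_zero, add_zero,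
      transpose_mul, transpose_transpose, transpose_transpose, Matrix.mul_assoc, mixing]
  -- On the kernel `P` acts as `Nᵀ S`, so the form of `P A` is that of `S` times the zero dynamics,
  -- namely `-|v|² / 2`.
  have hker : ∀ v, v ≠ 0 → Cᵀ *ᵥ v = 0 → v ⬝ᵥ ((P * A) *ᵥ v) < 0 := by
    intro v hv hCv
    have hNv : N *ᵥ v = v := kerProj_mulVec_of_ker hCv
    have hPv : P *ᵥ v = Nᵀ *ᵥ (S *ᵥ v) := by
      rw [hPdef, add_mulVec, ← mulVec_mulVec, hCv, mulVec_zero, zero_add, ← mulVec_mulVec, hNv,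
        ← mulVec_mulVec]
    have hFv : zeroDynamics A B Cᵀ *ᵥ v = N *ᵥ (A *ᵥ v) := by
      rw [zeroDynamics, ← hN, sub_mulVec, sub_mulVec, one_mulVec, ← mulVec_mulVec, ← mulVec_mulVec,
        hNv, sub_self, sub_zero]
    have h1 : v ⬝ᵥ ((P * A) *ᵥ v) = v ⬝ᵥ (S *ᵥ (zeroDynamics A B Cᵀ *ᵥ v)) := by
      rw [← mulVec_mulVec, dotProduct_mulVec_comm hPT, hPv, hFv, dotProduct_mulVec_transpose,
        dotProduct_mulVec_comm hST]
    have h2 : v ⬝ᵥ (((zeroDynamics A B Cᵀ)ᵀ * S + S * zeroDynamics A B Cᵀ) *ᵥ v) = -(v ⬝ᵥ v) := by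
      rw [hSF, neg_mulVec, one_mulVec, dotProduct_neg]
    rw [add_mulVec, dotProduct_add, ← mulVec_mulVec, ← mulVec_mulVec, dotProduct_mulVec_transpose,
      dotProduct_mulVec_comm hST, ← h1] at h2
    have h3 : 0 < v ⬝ᵥ v := by
      simpa using (dotProduct_star_self_pos_iff (v := v)).2 hv
    linarith
  obtain ⟨γ, hγ⟩ := exists_quadForm_sub_neg hker
  -- The factor `P⁻¹` makes the injection contribute exactly Finsler's penalty `-γ C Cᵀ` to `P A`.
  refine ⟨-(γ • (P⁻¹ * C)), isSPR_of_lyapunov hP ?_ hPB⟩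
  have : P * (A + -(γ • (P⁻¹ * C)) * Cᵀ) = P * A - γ • (Cᵀᵀ * Cᵀ) := by
    rw [Matrix.mul_add, Matrix.neg_mul, Matrix.mul_neg, Matrix.smul_mul, Matrix.mul_smul,
      Matrix.mul_assoc, ← Matrix.mul_assoc P,
      Matrix.mul_nonsing_inv _ ((Matrix.isUnit_iff_isUnit_det _).1 hP.isUnit), Matrix.one_mul,
      transpose_transpose, sub_eq_add_neg]
  rw [this]
  exact hγ

end Synthesis

/-! ### Factorizations with equal Gram matrices and spectral decomposition of normal operators. -/

section Unitary

open Module.End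

variable {E : Type*} [NormedAddCommGroup E] [InnerProductSpace ℂ E] [FiniteDimensional ℂ E]

/-- Linear maps with equal norms differ by a linear isometry. -/
theorem exists_linearIsometry_comp_eq {V : Type*} [AddCommGroup V] [Module ℂ V] (f g : V →ₗ[ℂ] E)
    (h : ∀ v, ‖f v‖ = ‖g v‖) : ∃ U : E →ₗᵢ[ℂ] E, ∀ v, U (g v) = f v := by
  obtain ⟨k, hk⟩ := g.rangeRestrict.exists_rightInverse_of_surjective g.range_rangeRestrict
  have hgk : ∀ y : g.range, g (k y) = y := fun y =>
    congrArg Subtype.val (LinearMap.congr_fun hk y)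
  let L : g.range →ₗᵢ[ℂ] E := ⟨f ∘ₗ k, fun y => by
    rw [LinearMap.comp_apply, h, hgk, Submodule.coe_norm]⟩
  refine ⟨L.extend, fun v => ?_⟩
  have h1 := L.extend_apply ⟨g v, LinearMap.mem_range_self g v⟩
  rw [h1]
  change f (k _) = f v
  -- `k (g v)` and `v` differ by an element of the kernel of `g`, on which `f` vanishes since the
  -- norms agree.
  rw [← sub_eq_zero, ← map_sub, ← norm_eq_zero, h, map_sub, hgk, sub_self, norm_zero]

/-- A normal operator on a finite-dimensional complex inner product space has an orthonormal basis
of eigenvectors. -/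
theorem exists_orthonormalBasis_of_normal {d : ℕ} (hd : Module.finrank ℂ E = d) (T : E →ₗ[ℂ] E)
    (hT : Commute T T.adjoint) :
    ∃ b : OrthonormalBasis (Fin d) ℂ E, ∀ i, ∃ c : ℂ, T (b i) = c • b i := by
  -- The self-adjoint parts of a normal operator commute and are diagonalized jointly; `T` is
  -- recovered as `(R - i J) / 2`.
  set R := T + T.adjoint
  set J := Complex.I • (T - T.adjoint)
  have hR : R.IsSymmetric := by
    intro x y
    simp only [R, LinearMap.add_apply, inner_add_left, inner_add_right,
      LinearMap.adjoint_inner_left, LinearMap.adjoint_inner_right]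
    rw [add_comm]
  have hJ : J.IsSymmetric := by
    intro x y
    simp only [J, LinearMap.smul_apply, LinearMap.sub_apply, inner_smul_left, inner_smul_right,
      inner_sub_left, inner_sub_right, LinearMap.adjoint_inner_left,
      LinearMap.adjoint_inner_right, Complex.conj_I]
    ring
  have hRJ : Commute R J := by
    refine Commute.smul_right ?_ _
    exact ((Commute.refl T).add_left hT.symm).sub_right (hT.add_left (Commute.refl _))
  have hVfull := LinearMap.IsSymmetric.directSum_isInternal_of_commute hR hJ hRJ
  have hV := DirectSum.isInternal_ne_bot_iff.2 hVfull
  have hV' := (LinearMap.IsSymmetric.orthogonalFamily_eigenspace_inf_eigenspace hR hJ).comp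
    (Subtype.val_injective (p := fun i : ℂ × ℂ => eigenspace R i.2 ⊓ eigenspace J i.1 ≠ ⊥))
  have := iSupIndep.fintypeNeBotOfFiniteDimensional hVfull.submodule_iSupIndep
  refine ⟨hV.subordinateOrthonormalBasis hd hV', fun i => ?_⟩
  obtain ⟨h1, h2⟩ := hV.subordinateOrthonormalBasis_subordinate hd i hV'
  set x := hV.subordinateOrthonormalBasis hd hV' i
  have h1 := mem_eigenspace_iff.1 h1
  have h2 := mem_eigenspace_iff.1 h2
  generalize (hV.subordinateOrthonormalBasisIndex hd i hV') = p at h1 h2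
  refine ⟨(1 / 2 : ℂ) * (p.1.2 - Complex.I * p.1.1), ?_⟩
  have h3 : T x = (1 / 2 : ℂ) • (R x - Complex.I • J x) := by
    simp only [R, J, LinearMap.add_apply, LinearMap.smul_apply, LinearMap.sub_apply, smul_smul,
      Complex.I_mul_I]
    module
  rw [h3, h1, h2]
  module

variable {n : ℕ}

/-- Square matrices with the same Gram matrix of rows agree, up to unimodular factors, on an
orthonormal basis. -/
theorem exists_orthonormalBasis_mulVec_eq (X Y : Matrix (Fin n) (Fin n) ℂ)
    (h : X * Xᴴ = Y * Yᴴ) :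
    ∃ b : OrthonormalBasis (Fin n) ℂ (EuclideanSpace ℂ (Fin n)), ∀ i, ∃ c : ℂ, ‖c‖ = 1 ∧
      X *ᵥ (b i).ofLp = c • (Y *ᵥ (b i).ofLp) := by
  set f := Matrix.toEuclideanLin X with hf
  set g := Matrix.toEuclideanLin Y with hg
  have hfg : f ∘ₗ f.adjoint = g ∘ₗ g.adjoint := by
    rw [hf, hg, ← Matrix.toEuclideanLin_conjTranspose_eq_adjoint,
      ← Matrix.toEuclideanLin_conjTranspose_eq_adjoint]
    ext v i
    simp only [LinearMap.comp_apply, Matrix.toLpLin_apply, mulVec_mulVec, h]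
  obtain ⟨U, hU⟩ := exists_linearIsometry_comp_eq f.adjoint g.adjoint fun v => by
    have : (inner ℂ (f.adjoint v) (f.adjoint v) : ℂ) = inner ℂ (g.adjoint v) (g.adjoint v) := by
      rw [LinearMap.adjoint_inner_left, LinearMap.adjoint_inner_left]
      exact congrArg (inner ℂ v) (LinearMap.congr_fun hfg v)
    rw [inner_self_eq_norm_sq_to_K, inner_self_eq_norm_sq_to_K] at this
    have h2 : ‖f.adjoint v‖ ^ 2 = ‖g.adjoint v‖ ^ 2 := by exact_mod_cast this
    exact (sq_eq_sq₀ (norm_nonneg _) (norm_nonneg _)).1 h2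
  set T := U.toLinearMap.adjoint with hTdef
  have hTU : T ∘ₗ U.toLinearMap = LinearMap.id := by
    refine LinearMap.ext fun x => ext_inner_right ℂ fun y => ?_
    rw [LinearMap.comp_apply, LinearMap.adjoint_inner_left]
    exact U.inner_map_map x y
  have hUT : U.toLinearMap ∘ₗ T = LinearMap.id := (LinearMap.comp_eq_id_comm _ _).1 hTU
  -- `T` is unitary, hence normal, and `f = g T`. On an eigenvector of `T` the two maps therefore
  -- differ by a unimodular factor.
  obtain ⟨b, hb⟩ := exists_orthonormalBasis_of_normal (d := n) (by simp) T (by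
    rw [hTdef, LinearMap.adjoint_adjoint]
    exact hTU.trans hUT.symm)
  have hfgT : f = g ∘ₗ T := by
    have : f.adjoint = U.toLinearMap ∘ₗ g.adjoint := LinearMap.ext fun v => (hU v).symm
    rw [← LinearMap.adjoint_adjoint f, this, LinearMap.adjoint_comp, LinearMap.adjoint_adjoint]
  refine ⟨b, fun i => ?_⟩
  obtain ⟨c, hc⟩ := hb i
  refine ⟨c, ?_, ?_⟩
  · have h1 : U (T (b i)) = b i := LinearMap.congr_fun hUT (b i)
    have h2 := U.norm_map (T (b i))
    rw [h1, hc, norm_smul, b.norm_eq_one, mul_one] at h2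
    exact h2.symm
  · have h1 := LinearMap.congr_fun hfgT (b i)
    rw [LinearMap.comp_apply, hc, map_smul] at h1
    exact congrArg WithLp.ofLp h1

theorem trace_eq_sum_star_dotProduct (K : Matrix (Fin n) (Fin n) ℝ)
    (b : OrthonormalBasis (Fin n) ℂ (EuclideanSpace ℂ (Fin n))) :
    K.trace = ∑ i, (star (b i).ofLp ⬝ᵥ (toComplex K *ᵥ (b i).ofLp)).re := by
  have h1 := LinearMap.trace_eq_sum_inner (Matrix.toEuclideanLin (toComplex K)) b
  have h2 := LinearMap.trace_eq_sum_inner (Matrix.toEuclideanLin (toComplex K))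
    (EuclideanSpace.basisFun (Fin n) ℂ)
  rw [h1] at h2
  have h3 := congrArg Complex.re h2
  simp only [Complex.re_sum] at h3
  calc K.trace = _ := ?_
    _ = _ := h3.symm
    _ = _ := ?_
  · refine Finset.sum_congr rfl fun i _ => ?_
    simp [EuclideanSpace.inner_eq_star_dotProduct, toComplex, Matrix.toLpLin_apply]
  · refine Finset.sum_congr rfl fun i _ => ?_
    rw [EuclideanSpace.inner_eq_star_dotProduct, dotProduct_comm, Matrix.toLpLin_apply]

theorem exists_eq_mul_transpose_of_posSemidef {W : Matrix (Fin n) (Fin n) ℝ}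
    (hW : W.PosSemidef) : ∃ N : Matrix (Fin n) (Fin n) ℝ, W = N * Nᵀ := by
  open scoped MatrixOrder in
  obtain ⟨N, hN⟩ := CStarAlgebra.nonneg_iff_eq_star_mul_self.mp hW.nonneg
  exact ⟨Nᵀ, by rw [transpose_transpose, hN, star_eq_conjTranspose, conjTranspose_eq_transpose_of_trivial]⟩

end Unitary

/-! ### Convex duality for frequency-domain inequalities. -/

section Duality

variable {n : ℕ}

/-- This Möbius map carries the unit circle without `1` into the imaginary axis. -/
theorem exists_eq_mul_I_of_norm_eq_one {c : ℂ} (hc : ‖c‖ = 1) (hc1 : c ≠ 1) :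
    ∃ ω : ℝ, -(1 + c) / (1 - c) = ω * Complex.I := by
  have h1 : (1 - c) ≠ 0 := sub_ne_zero.2 (Ne.symm hc1)
  have h2 : (-(1 + c) / (1 - c)).re = 0 := by
    rw [Complex.div_re]
    have h3 : c.re ^ 2 + c.im ^ 2 = 1 := by
      have := Complex.sq_norm c
      rw [hc, Complex.normSq_apply] at this
      linarith
    simp only [Complex.neg_re, Complex.add_re, Complex.one_re, Complex.sub_re, Complex.neg_im,
      Complex.add_im, Complex.one_im, Complex.sub_im]
    rw [← add_div, div_eq_zero_iff]
    left
    linarith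
  refine ⟨(-(1 + c) / (1 - c)).im, Complex.ext ?_ ?_⟩
  · rw [h2, Complex.re_ofReal_mul, Complex.I_re, mul_zero]
  · rw [Complex.im_ofReal_mul, Complex.I_im, mul_one]

/-- A matrix dual certificate is a sum of rank-one certificates supported on the frequency
constraint. -/
theorem eq_zero_of_dual_certificate {T F G N : Matrix (Fin n) (Fin n) ℝ}
    (h : ∀ x : Fin n → ℂ, x ≠ 0 →
      ((∃ ω : ℝ, toComplex F *ᵥ x = (ω * Complex.I) • (toComplex G *ᵥ x)) ∨
        toComplex G *ᵥ x = 0) → (star x ⬝ᵥ (toComplex T *ᵥ x)).re < 0)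
    (hFG : F * (N * Nᵀ) * Gᵀ + G * (N * Nᵀ) * Fᵀ = 0)
    (hT : 0 ≤ (Nᵀ * T * N).trace) : N = 0 := by
  set X := toComplex ((F + G) * N) with hX
  set Y := toComplex ((F - G) * N) with hY
  -- Polarization: the difference of the two Gram matrices is twice the expression that vanishes by
  -- `hFG`.
  have hXY : X * Xᴴ = Y * Yᴴ := by
    rw [hX, hY, ← toComplex_transpose, ← toComplex_transpose, ← toComplex_mul, ← toComplex_mul]
    congr 1
    have : (F + G) * N * ((F + G) * N)ᵀ - (F - G) * N * ((F - G) * N)ᵀ =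
        (2 : ℝ) • (F * (N * Nᵀ) * Gᵀ + G * (N * Nᵀ) * Fᵀ) := by
      simp only [transpose_mul, transpose_add, transpose_sub, Matrix.mul_assoc, Matrix.add_mul,
        Matrix.sub_mul, Matrix.mul_add, Matrix.mul_sub]
      module
    rw [hFG, smul_zero] at this
    exact sub_eq_zero.1 this
  obtain ⟨b, hb⟩ := exists_orthonormalBasis_mulVec_eq X Y hXY
  set x : Fin n → Fin n → ℂ := fun i => toComplex N *ᵥ (b i).ofLp with hx
  have hx' : ∀ i, x i = toComplex N *ᵥ (b i).ofLp := fun i => rfl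
  have hfreq : ∀ i, (∃ ω : ℝ, toComplex F *ᵥ x i = (ω * Complex.I) • (toComplex G *ᵥ x i)) ∨
        toComplex G *ᵥ x i = 0 := by
    intro i
    obtain ⟨c, hc, hci⟩ := hb i
    rw [hX, hY, toComplex_mul, toComplex_mul, ← mulVec_mulVec, ← mulVec_mulVec, ← hx',
      toComplex_add, toComplex_sub, add_mulVec, sub_mulVec] at hci
    -- The relation reads `(F + G) x = c (F - G) x`. The value `c = 1` is the frequency at infinity,
    -- `G x = 0`; any other gives a finite real `ω`.
    by_cases hc1 : c = 1
    · right
      rw [hc1, one_smul] at hci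
      ext j
      have := congrFun hci j
      simp only [Pi.add_apply, Pi.sub_apply, Pi.zero_apply] at this ⊢
      linear_combination this / 2
    · left
      obtain ⟨ω, hω⟩ := exists_eq_mul_I_of_norm_eq_one hc hc1
      refine ⟨ω, ?_⟩
      rw [← hω]
      have h1 : (1 - c) ≠ 0 := sub_ne_zero.2 (Ne.symm hc1)
      ext j
      have := congrFun hci j
      simp only [Pi.add_apply, Pi.sub_apply, Pi.smul_apply, smul_eq_mul] at this ⊢
      field_simp
      linear_combination this
  have hsum : (Nᵀ * T * N).trace = ∑ i, (star (x i) ⬝ᵥ (toComplex T *ᵥ x i)).re := by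
    rw [trace_eq_sum_star_dotProduct _ b]
    refine Finset.sum_congr rfl fun i _ => ?_
    rw [Matrix.mul_assoc, toComplex_mul, toComplex_transpose, ← mulVec_mulVec,
      star_dotProduct_conjTranspose_mulVec, toComplex_mul, ← mulVec_mulVec]
  have hle : ∀ i, (star (x i) ⬝ᵥ (toComplex T *ᵥ x i)).re ≤ 0 := fun i => by
    by_cases h0 : x i = 0
    · simp [h0]
    · exact (h _ h0 (hfreq i)).le
  have hx0 : ∀ i, x i = 0 := by
    intro i
    by_contra h0
    have := Finset.sum_lt_sum (fun i _ => hle i) ⟨i, Finset.mem_univ i, h _ h0 (hfreq i)⟩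
    rw [← hsum, Finset.sum_const_zero] at this
    linarith
  have hN : Matrix.toEuclideanLin (toComplex N) = 0 := by
    refine b.toBasis.ext fun i => ?_
    rw [b.coe_toBasis, LinearMap.zero_apply, Matrix.toLpLin_apply, ← hx', hx0]
    rfl
  rw [LinearEquiv.map_eq_zero_iff] at hN
  ext i j
  simpa [toComplex] using congrFun (congrFun hN i) j

/-- Strict frequency-domain inequalities yield strict linear matrix inequalities. -/
theorem exists_quadForm_neg_of_frequency {T F G : Matrix (Fin n) (Fin n) ℝ}
    (h : ∀ x : Fin n → ℂ, x ≠ 0 →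
      ((∃ ω : ℝ, toComplex F *ᵥ x = (ω * Complex.I) • (toComplex G *ᵥ x)) ∨
        toComplex G *ᵥ x = 0) → (star x ⬝ᵥ (toComplex T *ᵥ x)).re < 0) :
    ∃ S : Matrix (Fin n) (Fin n) ℝ, Sᵀ = S ∧
      ∀ v, v ≠ 0 → v ⬝ᵥ ((T + Gᵀ * S * F) *ᵥ v) < 0 := by
  by_contra hcon
  push Not at hcon
  set s := {X : Matrix (Fin n) (Fin n) ℝ | ∀ v, v ≠ 0 → v ⬝ᵥ (X *ᵥ v) < 0} with hs
  -- Using `S + Sᵀ` parametrizes the symmetric matrices by all matrices, so the multiplier is free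
  -- in a linear space.
  set t := Set.range fun S : Matrix (Fin n) (Fin n) ℝ => T + Gᵀ * (S + Sᵀ) * F with ht
  have hsconv : Convex ℝ s := by
    intro X hX Y hY a b ha hb hab v hv
    rw [add_mulVec, smul_mulVec, smul_mulVec, dotProduct_add, dotProduct_smul, dotProduct_smul,
      smul_eq_mul, smul_eq_mul]
    have h1 := hX v hv
    have h2 := hY v hv
    rcases ha.eq_or_lt with rfl | ha
    · have : b = 1 := by linarith
      subst this
      linarith
    · nlinarith
  have htconv : Convex ℝ t := by
    rintro _ ⟨S, rfl⟩ _ ⟨R, rfl⟩ a b ha hb hab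
    refine ⟨a • S + b • R, ?_⟩
    have : T = a • T + b • T := by rw [← add_smul, hab, one_smul]
    conv_lhs => simp only []
    conv_lhs => rw [this]
    simp only [transpose_add, transpose_smul, Matrix.mul_add, Matrix.add_mul, Matrix.mul_smul,
      Matrix.smul_mul]
    module
  have hdisj : Disjoint s t := by
    rw [Set.disjoint_left]
    rintro _ hX ⟨S, rfl⟩
    obtain ⟨v, hv, hv'⟩ := hcon (S + Sᵀ) (by simp [add_comm])
    exact absurd (hX v hv) (not_lt.2 hv')
  obtain ⟨f, u, hfs, hft⟩ := geometric_hahn_banach_open hsconv isOpen_setOf_quadForm_neg htconv hdisj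
  have hnegone : ∀ {X : Matrix (Fin n) (Fin n) ℝ}, (∀ v, 0 ≤ v ⬝ᵥ (X *ᵥ v)) → ∀ {ε : ℝ}, 0 < ε →
      -(ε • (1 : Matrix (Fin n) (Fin n) ℝ)) - X ∈ s := by
    intro X hX ε hε v hv
    have h1 : 0 < v ⬝ᵥ v := by
      simpa using (dotProduct_star_self_pos_iff (v := v)).2 hv
    have h2 := hX v
    rw [sub_mulVec, neg_mulVec, smul_mulVec, one_mulVec, dotProduct_sub, dotProduct_neg,
      dotProduct_smul, smul_eq_mul]
    nlinarith
  have hval : ∀ {X : Matrix (Fin n) (Fin n) ℝ}, (∀ v, 0 ≤ v ⬝ᵥ (X *ᵥ v)) → ∀ {ε : ℝ}, 0 < ε →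
      -(ε * f 1) - f X < u := by
    intro X hX ε hε
    have := hfs _ (hnegone hX hε)
    simpa using this
  -- The zero matrix is a limit of negative definite ones, on which `f < u`.
  have hu : 0 ≤ u := by
    by_contra hu
    push Not at hu
    have h1 : ∀ ε : ℝ, 0 < ε → -(ε * f 1) < u := fun ε hε => by
      simpa using hval (X := 0) (by simp) hε
    have h2 : Tendsto (fun ε : ℝ => -(ε * f 1)) (𝓝[>] 0) (𝓝 (-(0 * f 1))) := by
      refine Tendsto.mono_left ?_ nhdsWithin_le_nhds
      exact (by fun_prop : Continuous fun ε : ℝ => -(ε * f 1)).tendsto 0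
    have := le_of_tendsto h2 (eventually_mem_nhdsWithin.mono fun ε hε => (h1 ε hε).le)
    simp only [zero_mul, neg_zero] at this
    linarith
  -- Scaling: a negative value `f X` would make `-f (k X)` exceed every bound.
  have hpos : ∀ {X : Matrix (Fin n) (Fin n) ℝ}, (∀ v, 0 ≤ v ⬝ᵥ (X *ᵥ v)) → 0 ≤ f X := by
    intro X hX
    by_contra hneg
    push Not at hneg
    obtain ⟨k, hk⟩ := exists_nat_gt ((u + f 1) / (-f X))
    rw [div_lt_iff₀ (by linarith)] at hk
    have h1 := hval (X := (k : ℝ) • X) (fun v => by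
      rw [smul_mulVec, dotProduct_smul, smul_eq_mul]
      exact mul_nonneg (Nat.cast_nonneg k) (hX v)) one_pos
    rw [map_smul, smul_eq_mul] at h1
    linarith
  have hanti : ∀ {X : Matrix (Fin n) (Fin n) ℝ}, Xᵀ = -X → f X = 0 := by
    intro X hX
    have h0 : ∀ v, v ⬝ᵥ (X *ᵥ v) = 0 := fun v => by
      have h1 := dotProduct_mulVec_transpose X v v
      rw [hX, neg_mulVec, dotProduct_neg, dotProduct_comm (X *ᵥ v)] at h1
      linarith
    have h1 := hpos fun v => (h0 v).ge
    have h2 := hpos (X := -X) fun v => by rw [neg_mulVec, dotProduct_neg, h0, neg_zero]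
    rw [map_neg] at h2
    linarith
  have hTS : ∀ S : Matrix (Fin n) (Fin n) ℝ, 0 ≤ f T + f (Gᵀ * (S + Sᵀ) * F) := fun S => by
    have := hft _ ⟨S, rfl⟩
    simp only [map_add] at this ⊢
    linarith
  have hT0 : 0 ≤ f T := by simpa using hTS 0
  -- An affine function of `S` that is bounded below has no linear part.
  have hS0 : ∀ S : Matrix (Fin n) (Fin n) ℝ, f (Gᵀ * (S + Sᵀ) * F) = 0 := by
    intro S
    have hsc : ∀ c : ℝ, 0 ≤ f T + c * f (Gᵀ * (S + Sᵀ) * F) := fun c => by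
      have := hTS (c • S)
      rwa [transpose_smul, ← smul_add, Matrix.mul_smul, Matrix.smul_mul, map_smul,
        smul_eq_mul] at this
    by_contra hne
    have := hsc (-(f T + 1) / f (Gᵀ * (S + Sᵀ) * F))
    rw [div_mul_cancel₀ _ hne] at this
    linarith
  set W : Matrix (Fin n) (Fin n) ℝ := Matrix.of fun i j => f (Matrix.single i j 1) with hW
  have hfW : ∀ X, f X = (W * Xᵀ).trace := by
    intro X
    conv_lhs => rw [matrix_eq_sum_single X]
    simp only [map_sum, Matrix.trace, diag_apply, Matrix.mul_apply, transpose_apply]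
    refine Finset.sum_congr rfl fun i _ => Finset.sum_congr rfl fun j _ => ?_
    have : Matrix.single i j (X i j) = X i j • Matrix.single i j (1 : ℝ) := by
      rw [smul_single, smul_eq_mul, mul_one]
    rw [this, map_smul, smul_eq_mul, mul_comm]
    rfl
  -- Skew matrices have zero quadratic form, so `f` ignores them and the representing matrix is
  -- symmetric.
  have hWT : Wᵀ = W := by
    ext i j
    have := hanti (X := Matrix.single j i (1 : ℝ) - Matrix.single i j 1) (by simp)
    rw [map_sub, sub_eq_zero] at this
    exact this
  have hWpsd : W.PosSemidef := by
    refine Matrix.PosSemidef.of_dotProduct_mulVec_nonneg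
      (by simpa [IsHermitian] using hWT) fun v => ?_
    have h1 := hpos (X := vecMulVec v v) fun w => by
      rw [vecMulVec_mulVec, op_smul_eq_smul, dotProduct_smul, smul_eq_mul, dotProduct_comm v w]
      exact mul_self_nonneg _
    rw [hfW, transpose_vecMulVec, mul_vecMulVec, trace_vecMulVec, dotProduct_comm] at h1
    simpa using h1
  obtain ⟨N, hN⟩ := exists_eq_mul_transpose_of_posSemidef hWpsd
  have hFG : F * W * Gᵀ + G * W * Fᵀ = 0 := by
    refine Matrix.ext_iff_trace_mul_right.2 fun S => ?_
    have h1 := hS0 S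
    rw [hfW] at h1
    rw [Matrix.zero_mul, trace_zero, ← h1]
    simp only [transpose_mul, transpose_add, transpose_transpose, Matrix.add_mul, Matrix.mul_add,
      trace_add]
    congr 1
    · rw [← trace_transpose]
      simp only [transpose_mul, transpose_transpose, hWT]
      rw [Matrix.trace_mul_comm Sᵀ]
      simp only [Matrix.mul_assoc]
      rw [Matrix.trace_mul_comm G]
      simp only [Matrix.mul_assoc]
    · rw [Matrix.mul_assoc, Matrix.mul_assoc, Matrix.trace_mul_comm G]
      simp only [Matrix.mul_assoc]
  have hN0 : N = 0 := eq_zero_of_dual_certificate h (by rw [← hN]; exact hFG) (by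
    rw [hfW, hN, ← trace_transpose, transpose_mul, transpose_mul, transpose_transpose,
      transpose_transpose, ← Matrix.mul_assoc, Matrix.trace_mul_comm, ← Matrix.mul_assoc] at hT0
    exact hT0)
  -- A zero functional cannot separate strictly: it would force both `0 < u` and `u ≤ 0`.
  have hf0 : ∀ X, f X = 0 := fun X => by
    rw [hfW, hN, hN0]
    simp
  have h1 := hval (X := 0) (by simp) one_pos
  have h2 := hft _ ⟨0, rfl⟩
  rw [hf0] at h1 h2
  rw [hf0] at h1
  linarith

end Duality

/-! ### The Kalman–Yakubovich lemma. -/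

section KalmanYakubovich

variable {n m : ℕ} {A : Matrix (Fin n) (Fin n) ℝ} {B : Matrix (Fin n) (Fin m) ℝ}
  {H : Matrix (Fin m) (Fin n) ℝ}

/-- Positive realness of the shifted function at `s + ε` is a supply inequality at `s`, and the
state `x` is the resolvent applied to `B u`. -/
theorem IsPositiveReal.re_nonneg {ε : ℝ}
    (h : IsPositiveReal fun s => transferMatrix A B H (s - (ε : ℂ))) {s : ℂ} (hs : -ε < s.re)
    (hsA : IsUnit (s • (1 : Matrix (Fin n) (Fin n) ℂ) - toComplex A)) {x : Fin n → ℂ}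
    {u : Fin m → ℂ} (hx : toComplex A *ᵥ x = s • x - toComplex B *ᵥ u) :
    0 ≤ (star u ⬝ᵥ (toComplex H *ᵥ x)).re := by
  have h1 := h.posSemidef (s + ε) (by simpa using by linarith)
  rw [transpose_eq_conjTranspose_of_map_conj (h.conj (s + ε) (by simpa using by linarith)),
    posSemidef_conjTranspose_add_iff] at h1
  have h2 := h1 u
  rw [add_sub_cancel_right, transferMatrix_mulVec] at h2
  have h3 : (s • (1 : Matrix (Fin n) (Fin n) ℂ) - toComplex A)⁻¹ *ᵥ (toComplex B *ᵥ u) = x := by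
    have : toComplex B *ᵥ u = (s • (1 : Matrix (Fin n) (Fin n) ℂ) - toComplex A) *ᵥ x := by
      rw [sub_mulVec, hx, smul_mulVec, one_mulVec]
      abel
    rw [this, mulVec_mulVec,
      Matrix.nonsing_inv_mul _ ((Matrix.isUnit_iff_isUnit_det _).1 hsA), one_mulVec]
  rwa [h3] at h2

/-- The quadratic form pinned down by the matching condition `P B = Hᵀ` on the range of `B`. -/
noncomputable def outputForm (B : Matrix (Fin n) (Fin m) ℝ) (H : Matrix (Fin m) (Fin n) ℝ) :
    Matrix (Fin n) (Fin n) ℝ :=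
  Hᵀ * (H * B)⁻¹ * H

theorem outputForm_mul (hHB : IsUnit (H * B).det) : outputForm B H * B = Hᵀ := by
  rw [outputForm, Matrix.mul_assoc, Matrix.mul_assoc, Matrix.nonsing_inv_mul _ hHB, Matrix.mul_one]

theorem outputForm_mulVec_of_ker {v : Fin n → ℝ} (hv : H *ᵥ v = 0) :
    outputForm B H *ᵥ v = 0 := by
  rw [outputForm, ← mulVec_mulVec, hv, mulVec_zero]

theorem outputForm_transpose (hHB : (H * B).PosDef) : (outputForm B H)ᵀ = outputForm B H := by
  have h1 : (H * B)ᵀ = H * B := by simpa [IsHermitian] using hHB.1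
  rw [outputForm, transpose_mul, transpose_mul, transpose_transpose, transpose_nonsing_inv, h1,
    Matrix.mul_assoc]

theorem outputForm_pos (hHB : (H * B).PosDef) {v : Fin n → ℝ} (hv : H *ᵥ v ≠ 0) :
    0 < v ⬝ᵥ (outputForm B H *ᵥ v) := by
  rw [outputForm, Matrix.mul_assoc, ← mulVec_mulVec, dotProduct_mulVec_transpose, ← mulVec_mulVec]
  simpa using hHB.inv.dotProduct_mulVec_pos hv

theorem outputForm_nonneg (hHB : (H * B).PosDef) (v : Fin n → ℝ) :
    0 ≤ v ⬝ᵥ (outputForm B H *ᵥ v) := by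
  by_cases hv : H *ᵥ v = 0
  · rw [outputForm_mulVec_of_ker hv, dotProduct_zero]
  · exact (outputForm_pos hHB hv).le

theorem re_outputForm_pos (hHB : (H * B).PosDef) {x : Fin n → ℂ} (hx : toComplex H *ᵥ x ≠ 0) :
    0 < (star x ⬝ᵥ (toComplex (outputForm B H) *ᵥ x)).re := by
  rw [outputForm, Matrix.mul_assoc, toComplex_mul, toComplex_transpose, ← mulVec_mulVec,
    star_dotProduct_conjTranspose_mulVec, toComplex_mul, ← mulVec_mulVec]
  have := re_star_dotProduct_toComplex_neg (X := -(H * B)⁻¹) (fun v hv => by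
    rw [neg_mulVec, dotProduct_neg]
    simpa using hHB.inv.dotProduct_mulVec_pos hv) hx
  rw [← neg_one_smul ℝ, toComplex_smul, smul_mulVec, dotProduct_smul] at this
  simpa using this

theorem eq_input_of_kerProj_eq_zero {x : Fin n → ℂ}
    (hx : toComplex (kerProj B H) *ᵥ x = 0) :
    x = toComplex B *ᵥ (toComplex ((H * B)⁻¹ * H) *ᵥ x) := by
  rw [toComplex_kerProj_mulVec, sub_eq_zero] at hx
  exact hx

/-- The high-frequency limit of a dissipation inequality on a vertical line. -/
theorem re_form_le_of_vertical_line {Q R : Matrix (Fin n) (Fin n) ℂ} {δ : ℝ}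
    (h : ∀ (s : ℂ) (x : Fin n → ℂ) (u : Fin m → ℂ), s.re = -δ →
      toComplex A *ᵥ x = s • x - toComplex B *ᵥ u →
        (star x ⬝ᵥ (Q *ᵥ x)).re ≤ (star x ⬝ᵥ (R *ᵥ x)).re) (w : Fin m → ℂ) :
    (star (toComplex B *ᵥ w) ⬝ᵥ (Q *ᵥ (toComplex B *ᵥ w))).re ≤
      (star (toComplex B *ᵥ w) ⬝ᵥ (R *ᵥ (toComplex B *ᵥ w))).re := by
  set y := toComplex B *ᵥ w with hy
  let s : ℕ → ℂ := fun k => -δ + (k + 1 : ℝ) * Complex.I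
  have hsre : ∀ k, (s k).re = -δ := fun k => by simp [s]
  have hsim : ∀ k, (s k).im = k + 1 := fun k => by simp [s]
  have hs0 : ∀ k, s k ≠ 0 := fun k h0 => by
    have := hsim k
    rw [h0, Complex.zero_im] at this
    have : (0 : ℝ) ≤ k := Nat.cast_nonneg k
    linarith
  have hsinv : Tendsto (fun k => (s k)⁻¹) atTop (𝓝 0) := by
    refine tendsto_inv₀_cobounded.comp (tendsto_norm_atTop_iff_cobounded.1 ?_)
    refine tendsto_atTop_mono (fun k => ?_) tendsto_natCast_atTop_atTop
    have := Complex.abs_im_le_norm (s k)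
    rw [hsim] at this
    exact (le_trans (by linarith) (le_abs_self _)).trans this
  let X : ℕ → Matrix (Fin n) (Fin n) ℂ := fun k => 1 - (s k)⁻¹ • toComplex A
  have hX : Tendsto X atTop (𝓝 1) := by
    have : Tendsto X atTop (𝓝 (1 - (0 : ℂ) • toComplex A)) :=
      tendsto_const_nhds.sub (hsinv.smul_const _)
    simpa using this
  have hdet : Tendsto (fun k => (X k).det) atTop (𝓝 1) := by
    have := ((continuous_id.matrix_det).tendsto (1 : Matrix (Fin n) (Fin n) ℂ)).comp hX
    simpa [Function.comp_def] using this
  have hXinv : Tendsto (fun k => (X k)⁻¹ *ᵥ y) atTop (𝓝 y) := by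
    have h1 : Tendsto (fun k => (X k)⁻¹) atTop (𝓝 (1 : Matrix (Fin n) (Fin n) ℂ)⁻¹) := by
      refine Tendsto.comp (continuousAt_matrix_inv 1 ?_) hX
      rw [Ring.inverse_eq_inv', det_one]
      exact continuousAt_inv₀ one_ne_zero
    have h2 : Continuous fun Y : Matrix (Fin n) (Fin n) ℂ => Y *ᵥ y :=
      continuous_id.matrix_mulVec continuous_const
    have := (h2.tendsto _).comp h1
    simpa [Function.comp_def] using this
  have hle : ∀ᶠ k in atTop, (star ((X k)⁻¹ *ᵥ y) ⬝ᵥ (Q *ᵥ ((X k)⁻¹ *ᵥ y))).re ≤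
      (star ((X k)⁻¹ *ᵥ y) ⬝ᵥ (R *ᵥ ((X k)⁻¹ *ᵥ y))).re := by
    filter_upwards [hdet.eventually_ne one_ne_zero] with k hk
    -- The input grows like `s k`, so the state is `(1 - A / s k)⁻¹ B w`, which tends to `B w`.
    refine h (s k) _ (s k • w) (hsre k) ?_
    have h1 := congrArg (fun Y => s k • (Y *ᵥ y))
      (Matrix.mul_nonsing_inv (X k) (isUnit_iff_ne_zero.2 hk))
    simp only [X, ← mulVec_mulVec, one_mulVec, sub_mulVec, smul_mulVec, smul_sub, smul_smul,
      mul_inv_cancel₀ (hs0 k), one_smul] at h1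
    rw [mulVec_smul, ← hy, ← h1]
    abel
  have hlim : ∀ Y : Matrix (Fin n) (Fin n) ℂ,
      Tendsto (fun k => (star ((X k)⁻¹ *ᵥ y) ⬝ᵥ (Y *ᵥ ((X k)⁻¹ *ᵥ y))).re) atTop
        (𝓝 (star y ⬝ᵥ (Y *ᵥ y)).re) := by
    intro Y
    have hc : Continuous fun x : Fin n → ℂ => (star x ⬝ᵥ (Y *ᵥ x)).re :=
      Complex.continuous_re.comp
        (continuous_star.dotProduct (continuous_const.matrix_mulVec continuous_id))
    exact (hc.tendsto y).comp hXinv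
  exact le_of_tendsto_of_tendsto (hlim Q) (hlim R) hle

/-- The Kalman–Yakubovich lemma for systems with positive definite high-frequency gain and stable
zeros; neither controllability nor observability is needed. -/
theorem exists_lyapunov_of_isSPR (hHB : (H * B).PosDef) (hz : HasStableZeros A B H)
    (h : IsSPR (transferMatrix A B H)) :
    ∃ P : Matrix (Fin n) (Fin n) ℝ, P.PosDef ∧ (∀ v, v ≠ 0 → v ⬝ᵥ ((P * A) *ᵥ v) < 0) ∧
      P * B = Hᵀ := by
  have hdet : IsUnit (H * B).det := (Matrix.isUnit_iff_isUnit_det _).1 hHB.isUnit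
  obtain ⟨ε, hε, hpr⟩ := h
  obtain ⟨δ, hδ, hδε, hzδ, hδA⟩ := hz.exists_shift hdet hε
  set P₀ := outputForm B H with hP₀
  set N := kerProj B H with hN
  have hP₀T : P₀ᵀ = P₀ := outputForm_transpose hHB
  have hP₀B : P₀ * B = Hᵀ := outputForm_mul hdet
  -- Since `δ < ε`, the SPR inequality holds on this line; the energy balance for `P₀` in place of a
  -- Lyapunov matrix turns it into dissipation.
  have hdiss : ∀ (s : ℂ) (x : Fin n → ℂ) (u : Fin m → ℂ), s.re = -δ →
      toComplex A *ᵥ x = s • x - toComplex B *ᵥ u →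
        (star x ⬝ᵥ (toComplex (P₀ * A) *ᵥ x)).re ≤
          (star x ⬝ᵥ (toComplex (-δ • P₀) *ᵥ x)).re := by
    intro s x u hs hx
    have h1 := re_form_of_resolvent hP₀T hP₀B hx
    have h2 := hpr.re_nonneg (by rw [hs]; linarith) (hδA s hs) hx
    rw [hs] at h1
    rw [toComplex_smul, smul_mulVec, dotProduct_smul, smul_eq_mul, Complex.re_ofReal_mul]
    linarith
  have hδre : ∀ x : Fin n → ℂ, (star x ⬝ᵥ (toComplex (-δ • P₀) *ᵥ x)).re =
      -δ * (star x ⬝ᵥ (toComplex P₀ *ᵥ x)).re := fun x => by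
    rw [toComplex_smul, smul_mulVec, dotProduct_smul, smul_eq_mul, Complex.re_ofReal_mul]
  -- The unknown `P = P₀ + Nᵀ S N` meets the matching condition for any `S`. Using `A + δ` in `F`
  -- places the frequencies on `Re s = -δ`.
  obtain ⟨S, hST, hS⟩ := exists_quadForm_neg_of_frequency (T := P₀ * A) (F := N * (A + δ • 1))
    (G := N) (by
      rintro x hx0 (⟨ω, hω⟩ | hx)
      -- Finite frequency: `A x - s x` lies in the range of `B`, so dissipation applies. It is
      -- strict because `H x = 0` would be a zero of `A + δ` on the imaginary axis.
      · set s : ℂ := -δ + ω * Complex.I with hs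
        have hy : toComplex N *ᵥ (toComplex A *ᵥ x - s • x) = 0 := by
          rw [toComplex_mul, ← mulVec_mulVec, ← mulVec_smul, ← sub_eq_zero, ← mulVec_sub,
            toComplex_add, toComplex_smul, toComplex_one, add_mulVec, smul_mulVec,
            one_mulVec] at hω
          rw [← hω, hs]
          congr 1
          module
        have hu := eq_input_of_kerProj_eq_zero hy
        set w := toComplex ((H * B)⁻¹ * H) *ᵥ (toComplex A *ᵥ x - s • x)
        have h1 := hdiss s x (-w) (by simp [hs]) (by
          rw [mulVec_neg, ← hu]
          abel)
        rw [hδre] at h1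
        have h2 : toComplex H *ᵥ x ≠ 0 := by
          intro hHx
          have := hzδ (ω * Complex.I) x w hHx (by
            rw [← hu, toComplex_add, toComplex_smul, toComplex_one, add_mulVec, smul_mulVec,
              one_mulVec, hs]
            module) hx0
          simp at this
        have h3 := re_outputForm_pos hHB h2
        nlinarith
      -- Infinite frequency: `x` lies in the range of `B`, and the limit along the line applies.
      · have hw := eq_input_of_kerProj_eq_zero hx
        have h1 := re_form_le_of_vertical_line hdiss (toComplex ((H * B)⁻¹ * H) *ᵥ x)
        rw [← hw, hδre] at h1
        have h2 : toComplex H *ᵥ x ≠ 0 := by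
          intro hHx
          rw [toComplex_kerProj_mulVec_of_ker hHx] at hx
          exact hx0 hx
        have h3 := re_outputForm_pos hHB h2
        nlinarith)
  have hNH : ∀ v, H *ᵥ (N *ᵥ v) = 0 := fun v => by
    rw [mulVec_mulVec, mul_kerProj hdet, zero_mulVec]
  have hNN : ∀ v, N *ᵥ (N *ᵥ v) = N *ᵥ v := fun v => kerProj_mulVec_of_ker (hNH v)
  have hform : ∀ v w, v ⬝ᵥ ((Nᵀ * S * N) *ᵥ w) = (N *ᵥ v) ⬝ᵥ (S *ᵥ (N *ᵥ w)) := fun v w => by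
    rw [← mulVec_mulVec, ← mulVec_mulVec, dotProduct_mulVec_transpose]
  have hne : ∀ v, v ≠ 0 → N *ᵥ v = 0 → H *ᵥ v ≠ 0 := fun v hv hNv hHv =>
    hv (by rw [← hNv]; exact (kerProj_mulVec_of_ker hHv).symm)
  have hsq : ∀ v, H *ᵥ v ≠ 0 → 0 < (H *ᵥ v) ⬝ᵥ (H *ᵥ v) := fun v hv => by
    simpa using (dotProduct_star_self_pos_iff (v := H *ᵥ v)).2 hv
  -- On the kernel of `H` the `P₀` part drops out and `hS` becomes a Lyapunov inequality for the
  -- zero dynamics of `A + δ`. The summand `Hᵀ H` covers the range of `B`, where these dynamics are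
  -- `-1`.
  have hSpos : ∀ v, N *ᵥ v ≠ 0 → 0 < (N *ᵥ v) ⬝ᵥ (S *ᵥ (N *ᵥ v)) := by
    intro v hz0
    have hX := (hzδ.isHurwitz_zeroDynamics hdet).quadForm_pos (X := Nᵀ * S * N + Hᵀ * H)
      (by simp [hST, Matrix.mul_assoc]) (fun v hv => by
        set z := N *ᵥ v with hzdef
        have h1 : N *ᵥ (zeroDynamics (A + δ • 1) B H *ᵥ v) = N *ᵥ ((A + δ • 1) *ᵥ z) := by
          rw [zeroDynamics, ← hN, sub_mulVec, sub_mulVec, one_mulVec, ← mulVec_mulVec,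
            ← mulVec_mulVec, ← hzdef, mulVec_sub, mulVec_sub, hNN, ← hzdef, hzdef, hNN, sub_self,
            sub_zero]
        have h2 : H *ᵥ (zeroDynamics (A + δ • 1) B H *ᵥ v) = -(H *ᵥ v) := by
          rw [zeroDynamics, ← hN, sub_mulVec, sub_mulVec, one_mulVec, ← mulVec_mulVec,
            ← mulVec_mulVec, mulVec_sub, mulVec_sub, hNH, hNH]
          abel
        rw [← mulVec_mulVec, add_mulVec, dotProduct_add, hform, h1, ← mulVec_mulVec, h2,
          dotProduct_mulVec_transpose, dotProduct_neg, ← hzdef]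
        by_cases hz0 : z = 0
        · have := hsq v (hne v hv hz0)
          rw [hz0, zero_dotProduct]
          linarith
        · have h3 := hS z hz0
          have h4 : H *ᵥ z = 0 := hNH v
          rw [add_mulVec, dotProduct_add, ← mulVec_mulVec, dotProduct_mulVec_comm hP₀T,
            outputForm_mulVec_of_ker h4, dotProduct_zero, zero_add, ← Matrix.mul_assoc,
            ← mulVec_mulVec, hform, hzdef, hNN, ← hzdef] at h3
          have h5 : 0 ≤ (H *ᵥ v) ⬝ᵥ (H *ᵥ v) := by
            simpa using dotProduct_star_self_nonneg (H *ᵥ v)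
          linarith)
    have := hX _ hz0
    rwa [add_mulVec, dotProduct_add, hform, hNN, ← mulVec_mulVec, hNH, mulVec_zero,
      dotProduct_zero, add_zero] at this
  have hSker : ∀ v, 0 ≤ (N *ᵥ v) ⬝ᵥ (S *ᵥ (N *ᵥ v)) := fun v => by
    by_cases hz0 : N *ᵥ v = 0
    · rw [hz0, zero_dotProduct]
    · exact (hSpos v hz0).le
  refine ⟨P₀ + Nᵀ * S * N, Matrix.PosDef.of_dotProduct_mulVec_pos ?_ fun v hv => ?_,
    fun v hv => ?_, ?_⟩
  · simp [IsHermitian, hP₀T, hST, Matrix.mul_assoc]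
  · rw [star_trivial, add_mulVec, dotProduct_add, hform]
    by_cases hHv : H *ᵥ v = 0
    · have hNv : N *ᵥ v = v := kerProj_mulVec_of_ker hHv
      have := hSpos v (by rwa [hNv])
      have := outputForm_nonneg hHB v
      linarith
    · have := outputForm_pos hHB hHv
      have := hSker v
      linarith
  -- The form of `P A` is the one in `hS` minus `δ` times the form of `Nᵀ S N`, which is
  -- nonnegative.
  · have h1 := hS v hv
    have h2 := hSker v
    rw [Matrix.add_mul, add_mulVec, dotProduct_add, ← mulVec_mulVec _ (Nᵀ * S * N), hform]
    rw [add_mulVec, dotProduct_add, ← Matrix.mul_assoc, ← mulVec_mulVec _ (Nᵀ * S * N), hform,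
      add_mulVec, smul_mulVec, one_mulVec, mulVec_add, mulVec_add, dotProduct_add, mulVec_smul,
      mulVec_smul, dotProduct_smul, smul_eq_mul] at h1
    nlinarith
  · rw [Matrix.add_mul, hP₀B, Matrix.mul_assoc, kerProj_mul hdet, Matrix.mul_zero, add_zero]

end KalmanYakubovich

/-! ### Lyapunov pairs for SPR gains. -/

section SPRGain

variable {n m : ℕ} {A : Matrix (Fin n) (Fin n) ℝ} {B C : Matrix (Fin n) (Fin m) ℝ}

theorem isUnit_det_of_rank_eq {M : Matrix (Fin m) (Fin m) ℝ} (h : M.rank = m) : IsUnit M.det := by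
  rw [← Matrix.isUnit_iff_isUnit_det, ← Matrix.mulVec_surjective_iff_isUnit]
  have hrange : LinearMap.range M.mulVecLin = ⊤ :=
    Submodule.eq_top_of_finrank_eq (by rw [Module.finrank_fin_fun]; exact h)
  exact LinearMap.range_eq_top.1 hrange

/-- A strictly positive real error system admits a Lyapunov pair. -/
theorem exists_isLyapunovPair (hM : IsUnit (mixing B C).det) (hz : HasStableZeros A B Cᵀ)
    {L : Matrix (Fin n) (Fin m) ℝ} (hL : IsSPRGain A B C L) :
    ∃ P Q, IsLyapunovPair A B C L P Q := by
  -- Premultiplying the output by `Mᵀ` makes the high-frequency gain `Mᵀ M`, positive definite even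
  -- when `M` is not symmetric.
  have hgain : ((mixing B C)ᵀ * Cᵀ * B).PosDef := by
    have h1 : (mixing B C)ᵀ * Cᵀ * B = (mixing B C)ᴴ * mixing B C := by
      rw [conjTranspose_eq_transpose_of_trivial, Matrix.mul_assoc]
      rfl
    rw [h1]
    exact Matrix.PosDef.conjTranspose_mul_self _
      (Matrix.mulVec_injective_of_isUnit ((Matrix.isUnit_iff_isUnit_det _).2 hM))
  obtain ⟨P, hP, hneg, hPB⟩ := exists_lyapunov_of_isSPR hgain
    ((hz.add_mul_output L).mul_output (by rwa [det_transpose])) hL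
  have hPT : Pᵀ = P := by simpa [IsHermitian] using hP.1
  refine ⟨P, -((A + L * Cᵀ)ᵀ * P + P * (A + L * Cᵀ)), hP, ?_, (neg_neg _).symm, ?_⟩
  · refine Matrix.PosDef.of_dotProduct_mulVec_pos ?_ fun v hv => ?_
    · rw [IsHermitian, conjTranspose_eq_transpose_of_trivial, transpose_neg, transpose_add,
        transpose_mul, transpose_mul, transpose_transpose, hPT, add_comm]
    · have h1 := hneg v hv
      rw [star_trivial, neg_mulVec, dotProduct_neg, add_mulVec ((A + L * Cᵀ)ᵀ * P), dotProduct_add,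
        ← mulVec_mulVec v _ P, dotProduct_mulVec_transpose,
        dotProduct_mulVec_comm hPT ((A + L * Cᵀ) *ᵥ v), mulVec_mulVec]
      linarith
  · rw [hPB, transpose_mul, transpose_transpose, transpose_transpose]

end SPRGain

/-! ### Calculus of primitives of integrable functions, and Barbalat's lemma. -/

section Primitives

open MeasureTheory

/-- `f` is on `[0, T]` a primitive of the integrable function `f'`. -/
structure IsPrimitiveOn (T : ℝ) (f f' : ℝ → ℝ) : Prop where
  intervalIntegrable : IntervalIntegrable f' volume 0 T
  eq_integral : ∀ t ∈ Icc 0 T, f t = f 0 + ∫ τ in (0 : ℝ)..t, f' τ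

namespace IsPrimitiveOn

variable {T : ℝ} {f f' g g' : ℝ → ℝ}

theorem mono_integrable (h : IsPrimitiveOn T f f') {s t : ℝ} (hs : s ∈ Icc 0 T)
    (ht : t ∈ Icc 0 T) : IntervalIntegrable f' volume s t :=
  h.intervalIntegrable.mono_set (by
    rw [uIcc_of_le (hs.1.trans hs.2)]
    exact uIcc_subset_Icc hs ht)

theorem sub_eq (h : IsPrimitiveOn T f f') {s t : ℝ} (hs : s ∈ Icc 0 T) (ht : t ∈ Icc 0 T) :
    f t - f s = ∫ τ in s..t, f' τ := by
  have h0 : (0 : ℝ) ∈ Icc 0 T := ⟨le_rfl, hs.1.trans hs.2⟩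
  rw [h.eq_integral t ht, h.eq_integral s hs, add_sub_add_left_eq_sub,
    intervalIntegral.integral_interval_sub_left (h.mono_integrable h0 ht)
      (h.mono_integrable h0 hs)]

theorem congr_deriv (h : IsPrimitiveOn T f f') (hT : 0 ≤ T) (hfg : ∀ t ∈ Icc 0 T, f' t = g' t) :
    IsPrimitiveOn T f g' := by
  refine ⟨(intervalIntegrable_congr fun t ht => ?_).1 h.intervalIntegrable, fun t ht => ?_⟩
  · rw [uIoc_of_le hT] at ht
    exact hfg t ⟨ht.1.le, ht.2⟩
  · rw [h.eq_integral t ht]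
    congr 1
    refine intervalIntegral.integral_congr fun τ hτ => ?_
    rw [uIcc_of_le ht.1] at hτ
    exact hfg τ ⟨hτ.1, hτ.2.trans ht.2⟩

theorem const (T c : ℝ) : IsPrimitiveOn T (fun _ => c) fun _ => 0 :=
  ⟨intervalIntegrable_const, fun t _ => by simp⟩

theorem add (hf : IsPrimitiveOn T f f') (hg : IsPrimitiveOn T g g') :
    IsPrimitiveOn T (fun t => f t + g t) fun t => f' t + g' t := by
  refine ⟨hf.intervalIntegrable.add hg.intervalIntegrable, fun t ht => ?_⟩
  have h0 : (0 : ℝ) ∈ Icc 0 T := ⟨le_rfl, ht.1.trans ht.2⟩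
  rw [intervalIntegral.integral_add (hf.mono_integrable h0 ht) (hg.mono_integrable h0 ht),
    hf.eq_integral t ht, hg.eq_integral t ht]
  ring

theorem const_mul (c : ℝ) (hf : IsPrimitiveOn T f f') :
    IsPrimitiveOn T (fun t => c * f t) fun t => c * f' t := by
  refine ⟨hf.intervalIntegrable.const_mul c, fun t ht => ?_⟩
  rw [intervalIntegral.integral_const_mul, hf.eq_integral t ht]
  ring

theorem sub (hf : IsPrimitiveOn T f f') (hg : IsPrimitiveOn T g g') :
    IsPrimitiveOn T (fun t => f t - g t) fun t => f' t - g' t := by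
  simpa [sub_eq_add_neg] using hf.add (hg.const_mul (-1))

theorem sum {ι : Type*} (s : Finset ι) {F F' : ι → ℝ → ℝ}
    (h : ∀ i ∈ s, IsPrimitiveOn T (F i) (F' i)) :
    IsPrimitiveOn T (fun t => ∑ i ∈ s, F i t) fun t => ∑ i ∈ s, F' i t := by
  classical
  induction s using Finset.induction_on with
  | empty => simpa using const T 0
  | insert i s hi ih =>
    simp only [Finset.sum_insert hi]
    exact (h i (Finset.mem_insert_self i s)).add
      (ih fun j hj => h j (Finset.mem_insert_of_mem hj))

theorem continuousOn (hf : IsPrimitiveOn T f f') : ContinuousOn f (Icc 0 T) := by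
  rcases lt_or_ge T 0 with hT | hT
  · simp [Icc_eq_empty_of_lt hT]
  have h := intervalIntegral.continuousOn_primitive_interval' hf.intervalIntegrable
    (left_mem_uIcc)
  rw [uIcc_of_le hT] at h
  exact (continuousOn_const.add h).congr hf.eq_integral

/-- Derivatives exist only almost everywhere, so the product rule comes from integration by parts
for absolutely continuous functions. It is applied to `f 0 + ∫ f'`, since nothing is known about `f`
outside `[0, T]`. -/
theorem mul (hT : 0 ≤ T) (hf : IsPrimitiveOn T f f') (hg : IsPrimitiveOn T g g') :
    IsPrimitiveOn T (fun t => f t * g t) fun t => f' t * g t + f t * g' t := by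
  refine ⟨(hf.intervalIntegrable.mul_continuousOn ?_).add
    (hg.intervalIntegrable.continuousOn_mul ?_), fun t ht => ?_⟩
  · rw [uIcc_of_le hT]; exact hg.continuousOn
  · rw [uIcc_of_le hT]; exact hf.continuousOn
  have h0 : (0 : ℝ) ∈ Icc 0 T := ⟨le_rfl, hT⟩
  have hac : ∀ {f f' : ℝ → ℝ}, IsPrimitiveOn T f f' →
      AbsolutelyContinuousOnInterval (fun t => f 0 + ∫ τ in (0 : ℝ)..t, f' τ) 0 t := by
    intro f f' hf
    have h1 := (hf.mono_integrable h0 ht).absolutelyContinuousOnInterval_intervalIntegral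
      (c := 0) left_mem_uIcc
    have h2 : AbsolutelyContinuousOnInterval (fun _ : ℝ => f 0) 0 t :=
      (LipschitzWith.const (f 0)).lipschitzOnWith.absolutelyContinuousOnInterval
    exact h2.add h1
  have hd : ∀ {f f' : ℝ → ℝ}, IsPrimitiveOn T f f' → ∀ᵐ τ, τ ∈ uIcc 0 t →
      deriv (fun t => f 0 + ∫ τ in (0 : ℝ)..t, f' τ) τ = f' τ := by
    intro f f' hf
    filter_upwards [(hf.mono_integrable h0 ht).ae_hasDerivAt_integral] with τ h1 h2
    exact ((h1 h2 0 left_mem_uIcc).const_add (f 0)).deriv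
  have hprod := (hac hf).integral_deriv_mul_eq_sub (hac hg)
  rw [← hf.eq_integral t ht, ← hg.eq_integral t ht] at hprod
  simp only [intervalIntegral.integral_same, add_zero] at hprod
  rw [← sub_eq_iff_eq_add', ← hprod]
  refine intervalIntegral.integral_congr_ae ?_
  filter_upwards [hd hf, hd hg] with τ h1 h2 hτ
  have hτ' := uIoc_subset_uIcc hτ
  rw [h1 hτ', h2 hτ']
  rw [uIcc_of_le ht.1] at hτ'
  have hτT : τ ∈ Icc 0 T := ⟨hτ'.1, hτ'.2.trans ht.2⟩
  rw [← hf.eq_integral τ hτT, ← hg.eq_integral τ hτT]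

theorem le_of_deriv_nonpos (hf : IsPrimitiveOn T f f') {s t : ℝ} (hs : 0 ≤ s) (hst : s ≤ t)
    (ht : t ≤ T) (h : ∀ τ ∈ Ioo s t, f' τ ≤ 0) : f t ≤ f s := by
  have h1 := hf.sub_eq ⟨hs, hst.trans ht⟩ ⟨hs.trans hst, ht⟩
  have h2 : ∫ τ in s..t, f' τ ≤ ∫ τ in s..t, (0 : ℝ) := by
    refine intervalIntegral.integral_mono_on_of_le_Ioo hst
      (hf.mono_integrable ⟨hs, hst.trans ht⟩ ⟨hs.trans hst, ht⟩) intervalIntegrable_const h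
  rw [intervalIntegral.integral_zero] at h2
  linarith

/-- A function that decreases whenever it is above a level stays below that level. -/
theorem le_max_of_deriv_nonpos (hf : IsPrimitiveOn T f f') {κ : ℝ}
    (h : ∀ τ ∈ Icc 0 T, κ < f τ → f' τ ≤ 0) {t : ℝ} (ht : t ∈ Icc 0 T) : f t ≤ max (f 0) κ := by
  by_contra hlt
  push Not at hlt
  obtain ⟨h1, h2⟩ := max_lt_iff.1 hlt
  by_cases hall : ∀ τ ∈ Icc 0 t, κ < f τ
  · have := hf.le_of_deriv_nonpos le_rfl ht.1 ht.2 fun τ hτ =>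
      h τ ⟨hτ.1.le, hτ.2.le.trans ht.2⟩ (hall τ ⟨hτ.1.le, hτ.2.le⟩)
    linarith
  · push Not at hall
    obtain ⟨τ₀, hτ₀, hτ₀f⟩ := hall
    set S := Icc 0 t ∩ {τ | f τ ≤ κ} with hS
    have hcont : ContinuousOn f (Icc 0 t) := hf.continuousOn.mono (Icc_subset_Icc_right ht.2)
    have hScomp : IsCompact S :=
      isCompact_Icc.of_isClosed_subset (hcont.preimage_isClosed_of_isClosed isClosed_Icc
        isClosed_Iic) inter_subset_left
    -- After the last time `s` at which `f` is at most `κ`, the function cannot increase.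
    obtain ⟨s, hsS, hsmax⟩ := hScomp.exists_isGreatest ⟨τ₀, hτ₀, hτ₀f⟩
    have hsκ : f s ≤ κ := hsS.2
    have := hf.le_of_deriv_nonpos hsS.1.1 hsS.1.2 ht.2 fun τ hτ =>
      h τ ⟨hsS.1.1.trans hτ.1.le, hτ.2.le.trans ht.2⟩ (by
        by_contra hτκ
        push Not at hτκ
        exact absurd (hsmax ⟨⟨hsS.1.1.trans hτ.1.le, hτ.2.le⟩, hτκ⟩) (not_le.2 hτ.1))
    linarith

theorem abs_sub_le (hf : IsPrimitiveOn T f f') {D s t : ℝ} (hD : ∀ τ ∈ Icc 0 T, |f' τ| ≤ D)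
    (hs : s ∈ Icc 0 T) (ht : t ∈ Icc 0 T) : |f t - f s| ≤ D * |t - s| := by
  rw [hf.sub_eq hs ht, ← Real.norm_eq_abs]
  refine intervalIntegral.norm_integral_le_of_norm_le_const fun τ hτ => hD τ ?_
  exact uIcc_subset_Icc hs ht (uIoc_subset_uIcc hτ)

end IsPrimitiveOn

/-- Barbalat's lemma: a nonnegative function that is dominated by the decay rate of a nonnegative
function and has a bounded derivative tends to zero. -/
theorem tendsto_zero_of_dissipation {V V' φ φ' : ℝ → ℝ} {D c : ℝ} (hc : 0 < c)
    (hV : ∀ T, 0 ≤ T → IsPrimitiveOn T V V') (hφ : ∀ T, 0 ≤ T → IsPrimitiveOn T φ φ')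
    (hV0 : ∀ t, 0 ≤ t → 0 ≤ V t) (hφ0 : ∀ t, 0 ≤ t → 0 ≤ φ t)
    (hD : ∀ t, 0 ≤ t → |φ' t| ≤ D) (hdiss : ∀ t, 0 ≤ t → V' t ≤ -c * φ t) :
    Tendsto φ atTop (𝓝 0) := by
  have hD0 : 0 ≤ D := (abs_nonneg _).trans (hD 0 le_rfl)
  have hanti : AntitoneOn V (Ici 0) := fun s hs t ht hst =>
    (hV t ht).le_of_deriv_nonpos hs hst le_rfl fun τ hτ => by
      have hτ0 : 0 ≤ τ := le_trans hs hτ.1.le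
      have := hdiss τ hτ0
      have := mul_nonneg hc.le (hφ0 τ hτ0)
      linarith
  have hlim : ∃ l, Tendsto V atTop (𝓝 l) := by
    have h1 : Antitone fun t => V (max t 0) := fun s t hst =>
      hanti (mem_Ici.2 (le_max_right _ _)) (mem_Ici.2 (le_max_right _ _)) (max_le_max_right 0 hst)
    have h2 := tendsto_atTop_ciInf h1 ⟨0, by
      rintro _ ⟨t, rfl⟩
      exact hV0 _ (le_max_right _ _)⟩
    refine ⟨_, h2.congr' ?_⟩
    filter_upwards [eventually_ge_atTop 0] with t ht
    rw [max_eq_left ht]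
  obtain ⟨l, hl⟩ := hlim
  rw [Metric.tendsto_atTop]
  intro η hη
  -- In time `d` the function `φ` changes by at most `η / 2`. A value `φ t ≥ η` therefore costs `V`
  -- at least `c * (η / 2) * d`, impossible for late `t` since `V` converges. The `+ 1` covers `D =
  -- 0`.
  set d := η / (2 * (D + 1)) with hd
  have hd0 : 0 < d := by positivity
  have hdiff : Tendsto (fun t => V t - V (t + d)) atTop (𝓝 0) := by
    simpa using hl.sub (hl.comp (tendsto_atTop_add_const_right _ d tendsto_id))
  have hev := hdiff.eventually (gt_mem_nhds (show 0 < c * (η / 2) * d by positivity))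
  obtain ⟨t₀, ht₀⟩ := eventually_atTop.1 (hev.and (eventually_ge_atTop 0))
  refine ⟨t₀, fun t ht => ?_⟩
  obtain ⟨h1, h2⟩ := ht₀ t ht
  rw [Real.dist_eq, sub_zero, abs_of_nonneg (hφ0 t h2)]
  by_contra hlt
  push Not at hlt
  have hT : 0 ≤ t + d := by linarith
  have hlow : ∀ τ ∈ Icc t (t + d), η / 2 ≤ φ τ := by
    intro τ hτ
    have h3 := (hφ _ hT).abs_sub_le (fun τ hτ => hD τ hτ.1) (s := t) (t := τ)
      ⟨h2, by linarith⟩ ⟨h2.trans hτ.1, hτ.2⟩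
    rw [abs_of_nonneg (by linarith [hτ.1] : 0 ≤ τ - t)] at h3
    have h4 : D * (τ - t) ≤ η / 2 := by
      calc D * (τ - t) ≤ (D + 1) * d := by
            refine mul_le_mul (by linarith) (by linarith [hτ.2]) (by linarith [hτ.1]) (by linarith)
        _ = η / 2 := by rw [hd]; field_simp
    have := neg_abs_le (φ τ - φ t)
    linarith
  have h5 := (hV _ hT).sub_eq (s := t) (t := t + d) ⟨h2, by linarith⟩ ⟨hT, le_rfl⟩
  have h6 : ∫ τ in t..(t + d), V' τ ≤ ∫ τ in t..(t + d), -c * (η / 2) := by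
    refine intervalIntegral.integral_mono_on (by linarith)
      ((hV _ hT).mono_integrable ⟨h2, by linarith⟩ ⟨hT, le_rfl⟩) intervalIntegrable_const
      fun τ hτ => ?_
    have h7 := hdiss τ (h2.trans hτ.1)
    have h8 := mul_le_mul_of_nonneg_left (hlow τ hτ) hc.le
    linarith
  rw [intervalIntegral.integral_const, add_sub_cancel_left, smul_eq_mul] at h6
  linarith

end Primitives

/-! ### Picard iteration with a right-hand side measurable in time. -/

section Caratheodory

open MeasureTheory

variable {E : Type*} [NormedAddCommGroup E] [NormedSpace ℝ E] [CompleteSpace E]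

/-- The Picard iteration, constant for negative times. -/
noncomputable def picardSeq (h : ℝ → E → E) (z₀ : E) : ℕ → ℝ → E
  | 0, _ => z₀
  | k + 1, t => z₀ + ∫ τ in (0 : ℝ)..(max t 0), h τ (picardSeq h z₀ k τ)

/-- Global existence for bounded, globally Lipschitz right-hand sides that are merely measurable
in time. -/
theorem exists_solution_of_lipschitz {h : ℝ → E → E} {M K : ℝ}
    (hm : ∀ z : ℝ → E, Continuous z → AEStronglyMeasurable (fun τ => h τ (z τ)) volume)
    (hM : ∀ τ z, ‖h τ z‖ ≤ M) (hK : ∀ τ z w, ‖h τ z - h τ w‖ ≤ K * ‖z - w‖) (z₀ : E) :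
    ∃ z : ℝ → E, Continuous z ∧
      ∀ t, 0 ≤ t → z t = z₀ + ∫ τ in (0 : ℝ)..t, h τ (z τ) := by
  have hM0 : 0 ≤ M := (norm_nonneg _).trans (hM 0 0)
  have hint : ∀ z : ℝ → E, Continuous z → ∀ a b,
      IntervalIntegrable (fun τ => h τ (z τ)) volume a b := fun z hz a b =>
    (intervalIntegrable_const (c := M)).mono_fun' (hm z hz).restrict
      (Eventually.of_forall fun τ => hM τ _)
  set Z := picardSeq h z₀ with hZ
  have hZsucc : ∀ k t, Z (k + 1) t = z₀ + ∫ τ in (0 : ℝ)..(max t 0), h τ (Z k τ) :=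
    fun k t => rfl
  have hcont : ∀ k, Continuous (Z k) := by
    intro k
    induction k with
    | zero => exact continuous_const
    | succ k ih =>
      exact continuous_const.add ((intervalIntegral.continuous_primitive (hint _ ih) 0).comp
        (continuous_id.max continuous_const))
  -- These are the terms of an exponential series; `|K|` appears because `K` is not assumed
  -- nonnegative.
  have hstep : ∀ k t, ‖Z (k + 1) t - Z k t‖ ≤
      M * |K| ^ k * (max t 0) ^ (k + 1) / (k + 1).factorial := by
    intro k
    induction k with
    | zero =>
      intro t
      have h1 : Z (0 + 1) t - Z 0 t = ∫ τ in (0 : ℝ)..(max t 0), h τ (Z 0 τ) :=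
        add_sub_cancel_left _ _
      rw [h1]
      have := intervalIntegral.norm_integral_le_of_norm_le_const (a := 0) (b := max t 0)
        (f := fun τ => h τ (Z 0 τ)) (C := M) fun τ _ => hM τ _
      rw [sub_zero, abs_of_nonneg (le_max_right t 0)] at this
      simpa using this
    | succ k ih =>
      intro t
      have h1 : Z (k + 1 + 1) t - Z (k + 1) t =
          ∫ τ in (0 : ℝ)..(max t 0), h τ (Z (k + 1) τ) - h τ (Z k τ) := by
        rw [intervalIntegral.integral_sub (hint _ (hcont _) _ _) (hint _ (hcont _) _ _),
          hZsucc (k + 1), hZsucc k, add_sub_add_left_eq_sub]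
      rw [h1]
      have h2 := intervalIntegral.norm_integral_le_of_norm_le (a := 0) (b := max t 0)
        (f := fun τ => h τ (Z (k + 1) τ) - h τ (Z k τ)) (μ := volume)
        (g := fun τ => |K| * (M * |K| ^ k / (k + 1).factorial) * τ ^ (k + 1)) (le_max_right _ _)
        (Eventually.of_forall fun τ hτ => by
          refine (hK τ _ _).trans ?_
          refine (mul_le_mul_of_nonneg_right (le_abs_self K) (norm_nonneg _)).trans ?_
          rw [mul_assoc]
          refine mul_le_mul_of_nonneg_left ?_ (abs_nonneg K)
          refine (ih τ).trans (le_of_eq ?_)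
          rw [max_eq_left hτ.1.le]
          ring)
        (Continuous.intervalIntegrable (by fun_prop) _ _)
      refine h2.trans (le_of_eq ?_)
      rw [intervalIntegral.integral_const_mul, integral_pow, Nat.factorial_succ (k + 1)]
      push_cast
      have : ((k + 1).factorial : ℝ) ≠ 0 := by positivity
      have : (k : ℝ) + 1 + 1 ≠ 0 := by positivity
      field_simp
      ring
  have hcauchy : ∀ t, CauchySeq fun k => Z k t := by
    intro t
    refine cauchySeq_of_dist_le_of_summable (fun k : ℕ =>
      M * |K| ^ k * (max t 0) ^ (k + 1) / (k + 1).factorial) (fun k => ?_) ?_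
    · rw [dist_comm, dist_eq_norm]
      exact hstep k t
    · have h1 : Summable fun k : ℕ => M * max t 0 * ((|K| * max t 0) ^ k / k.factorial) :=
        (Real.summable_pow_div_factorial _).mul_left _
      refine Summable.of_nonneg_of_le (fun k => by positivity) (fun k => ?_) h1
      have h2 : (k.factorial : ℝ) ≤ (k + 1).factorial := by
        exact_mod_cast Nat.factorial_le (Nat.le_succ k)
      calc M * |K| ^ k * (max t 0) ^ (k + 1) / (k + 1).factorial
          ≤ M * |K| ^ k * (max t 0) ^ (k + 1) / k.factorial := by gcongr
        _ = M * max t 0 * ((|K| * max t 0) ^ k / k.factorial) := by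
          rw [mul_pow, pow_succ]; ring
  choose z hz using fun t => cauchySeq_tendsto_of_complete (hcauchy t)
  -- The iterates share the Lipschitz constant `M`, so a pointwise limit is already continuous.
  have hlip : ∀ s t, dist (z s) (z t) ≤ M * dist s t := by
    intro s t
    have hk : ∀ k, dist (Z k s) (Z k t) ≤ M * dist s t := by
      intro k
      rcases k with _ | k
      · change dist z₀ z₀ ≤ _
        rw [dist_self]
        positivity
      · rw [hZsucc, hZsucc, dist_add_left, dist_eq_norm,
          intervalIntegral.integral_interval_sub_left (hint _ (hcont _) _ _)
            (hint _ (hcont _) _ _)]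
        refine (intervalIntegral.norm_integral_le_of_norm_le_const fun τ _ => hM τ _).trans ?_
        refine mul_le_mul_of_nonneg_left ?_ hM0
        rw [Real.dist_eq]
        exact abs_max_sub_max_le_abs s t 0
    exact le_of_tendsto ((hz s).dist (hz t)) (Eventually.of_forall hk)
  have hzcont : Continuous z := by
    have : LipschitzWith ⟨M, hM0⟩ z := LipschitzWith.of_dist_le_mul hlip
    exact this.continuous
  refine ⟨z, hzcont, fun t ht => ?_⟩
  have h1 : Tendsto (fun k => Z (k + 1) t) atTop (𝓝 (z t)) := (hz t).comp (tendsto_add_atTop_nat 1)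
  have h2 : Tendsto (fun k => Z (k + 1) t) atTop
      (𝓝 (z₀ + ∫ τ in (0 : ℝ)..t, h τ (z τ))) := by
    simp only [hZsucc, max_eq_left ht]
    refine tendsto_const_nhds.add ?_
    refine intervalIntegral.tendsto_integral_filter_of_dominated_convergence (fun _ => M)
      (Eventually.of_forall fun k => (hm _ (hcont k)).restrict)
      (Eventually.of_forall fun k => Eventually.of_forall fun τ _ => hM τ _)
      intervalIntegrable_const (Eventually.of_forall fun τ _ => ?_)
    rw [tendsto_iff_norm_sub_tendsto_zero]
    have h3 := (tendsto_iff_norm_sub_tendsto_zero.1 (hz τ)).const_mul K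
    rw [mul_zero] at h3
    exact squeeze_zero (fun k => norm_nonneg _) (fun k => hK τ _ _) h3
  exact tendsto_nhds_unique h1 h2

end Caratheodory

/-! ### Global existence from a priori bounds. -/

section GlobalSolutions

open MeasureTheory

variable {ι κ : Type*}

/-- `z` solves `z' = g (r, z)` on `[0, T]` in the sense of Carathéodory. -/
def IsSolutionOn (g : (κ → ℝ) → (ι → ℝ) → ι → ℝ) (r : ℝ → κ → ℝ) (T : ℝ) (z : ℝ → ι → ℝ) :
    Prop :=
  ∀ i, IsPrimitiveOn T (fun t => z t i) fun t => g (r t) (z t) i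

variable {g : (κ → ℝ) → (ι → ℝ) → ι → ℝ} {r : ℝ → κ → ℝ} {c : ℝ}

theorem IsSolutionOn.congr {T : ℝ} (hT : 0 ≤ T) {z : ℝ → ι → ℝ}
    {g' : (κ → ℝ) → (ι → ℝ) → ι → ℝ} (h : IsSolutionOn g r T z)
    (hgg : ∀ t ∈ Icc 0 T, g (r t) (z t) = g' (r t) (z t)) : IsSolutionOn g' r T z := fun i =>
  (h i).congr_deriv hT fun t ht => by rw [hgg t ht]

/-- The coordinatewise retraction onto the cube of half-width `R`. -/
def clampCube (R : ℝ) (z : ι → ℝ) : ι → ℝ :=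
  fun i => max (-R) (min R (z i))

theorem continuous_clampCube (R : ℝ) : Continuous (clampCube R : (ι → ℝ) → ι → ℝ) := by
  unfold clampCube
  fun_prop

variable [Fintype ι] [Fintype κ]

theorem intervalIntegrable_of_continuous {Ψ : (κ → ℝ) × (ι → ℝ) → ℝ} (hΨ : Continuous Ψ)
    (hr : Measurable r) (hrb : ∀ t, 0 ≤ t → ‖r t‖ ≤ c) {T : ℝ} (hT : 0 ≤ T) {z : ℝ → ι → ℝ}
    (hz : ContinuousOn z (Icc 0 T)) :
    IntervalIntegrable (fun t => Ψ (r t, z t)) volume 0 T := by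
  obtain ⟨R, hR⟩ := isCompact_Icc.exists_bound_of_continuousOn hz
  obtain ⟨D, hD⟩ := ((isCompact_closedBall (0 : κ → ℝ) c).prod
    (isCompact_closedBall (0 : ι → ℝ) R)).exists_bound_of_continuousOn hΨ.continuousOn
  rw [intervalIntegrable_iff_integrableOn_Icc_of_le hT]
  refine IntegrableOn.of_bound (by simp) ?_ D ?_
  · exact hΨ.comp_aestronglyMeasurable (hr.aestronglyMeasurable.prodMk
      (hz.aestronglyMeasurable measurableSet_Icc))
  · refine (ae_restrict_iff' measurableSet_Icc).2 (Eventually.of_forall fun t ht => ?_)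
    exact hD _ ⟨by simpa using hrb t ht.1, by simpa using hR t ht⟩

theorem isSolutionOn_of_continuousOn (hg : Continuous (Function.uncurry g)) (hr : Measurable r)
    (hrb : ∀ t, 0 ≤ t → ‖r t‖ ≤ c) {T : ℝ} (hT : 0 ≤ T) {z : ℝ → ι → ℝ}
    (hz : ContinuousOn z (Icc 0 T))
    (h : ∀ t ∈ Icc 0 T, ∀ i, z t i = z 0 i + ∫ τ in (0 : ℝ)..t, g (r τ) (z τ) i) :
    IsSolutionOn g r T z := fun i =>
  ⟨intervalIntegrable_of_continuous (Ψ := fun p => g p.1 p.2 i)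
    ((continuous_apply i).comp hg) hr hrb hT hz, fun t ht => h t ht i⟩

theorem clampCube_of_norm_le {R : ℝ} {z : ι → ℝ} (hz : ‖z‖ ≤ R) : clampCube R z = z := by
  ext i
  have h1 := abs_le.1 ((norm_le_pi_norm z i).trans hz)
  rw [clampCube, min_eq_right h1.2, max_eq_right h1.1]

theorem norm_clampCube_le {R : ℝ} (hR : 0 ≤ R) (z : ι → ℝ) : ‖clampCube R z‖ ≤ R := by
  refine (pi_norm_le_iff_of_nonneg hR).2 fun i => abs_le.2 ⟨le_max_left _ _, ?_⟩
  exact max_le (by linarith) (min_le_left _ _)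

theorem norm_clampCube_sub_le (R : ℝ) (z w : ι → ℝ) :
    ‖clampCube R z - clampCube R w‖ ≤ ‖z - w‖ := by
  refine (pi_norm_le_iff_of_nonneg (norm_nonneg _)).2 fun i => ?_
  rw [Pi.sub_apply, clampCube, clampCube, Real.norm_eq_abs]
  have h1 := abs_max_sub_max_le_max (-R) (min R (z i)) (-R) (min R (w i))
  have h2 := abs_min_sub_min_le_max R (z i) R (w i)
  rw [sub_self, abs_zero, max_eq_right (abs_nonneg (min R (z i) - min R (w i)))] at h1
  rw [sub_self, abs_zero, max_eq_right (abs_nonneg (z i - w i))] at h2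
  exact (h1.trans h2).trans (norm_le_pi_norm (z - w) i)

/-- A priori bounds imply global existence. -/
theorem exists_global_solution (hg : ContDiff ℝ 1 (Function.uncurry g)) (hr : Measurable r)
    (hrb : ∀ t, 0 ≤ t → ‖r t‖ ≤ c) (z₀ : ι → ℝ) {R₀ : ℝ}
    (hap : ∀ T, 0 ≤ T → ∀ z, z 0 = z₀ → IsSolutionOn g r T z → ∀ t ∈ Icc 0 T, ‖z t‖ ≤ R₀) :
    ∃ z, z 0 = z₀ ∧ Continuous z ∧ ∀ T, 0 ≤ T → IsSolutionOn g r T z := by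
  classical
  -- A cube strictly larger than the a priori bound: a solution of the truncated equation that stays
  -- inside it solves the original one.
  set R := |R₀| + 1 with hR
  have hR0 : 0 ≤ R := by positivity
  have hR₀R : R₀ < R := by
    have := le_abs_self R₀
    linarith
  -- The input is bounded only for `t ≥ 0`, whereas the Picard theorem asks for bounds at all times.
  set r' : ℝ → κ → ℝ := fun t => if 0 ≤ t then r t else 0 with hr'
  have hr'm : Measurable r' := Measurable.ite measurableSet_Ici hr measurable_const
  have hc0 : 0 ≤ c := (norm_nonneg _).trans (hrb 0 le_rfl)
  have hr'b : ∀ t, ‖r' t‖ ≤ c := fun t => by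
    by_cases ht : 0 ≤ t
    · simpa [hr', ht] using hrb t ht
    · simpa [hr', ht] using hc0
  set Kset := Metric.closedBall (0 : κ → ℝ) c ×ˢ Metric.closedBall (0 : ι → ℝ) R
  have hKcomp : IsCompact Kset := (isCompact_closedBall _ _).prod (isCompact_closedBall _ _)
  have hKconv : Convex ℝ Kset := (convex_closedBall _ _).prod (convex_closedBall _ _)
  have hmem : ∀ t z, (r' t, clampCube R z) ∈ Kset := fun t z =>
    ⟨by simpa using hr'b t, by simpa using norm_clampCube_le hR0 z⟩
  obtain ⟨M, hM⟩ := hKcomp.exists_bound_of_continuousOn hg.continuous.continuousOn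
  obtain ⟨K, hK⟩ := hKcomp.exists_bound_of_continuousOn
    (hg.continuous_fderiv one_ne_zero).continuousOn
  have hLip : ∀ p ∈ Kset, ∀ q ∈ Kset,
      ‖Function.uncurry g q - Function.uncurry g p‖ ≤ K * ‖q - p‖ := fun p hp q hq =>
    hKconv.norm_image_sub_le_of_norm_fderiv_le (𝕜 := ℝ)
      (fun x _ => (hg.differentiable one_ne_zero).differentiableAt) hK hp hq
  have hKnn : 0 ≤ K := (norm_nonneg _).trans (hK _ (hmem 0 0))
  obtain ⟨z, hzc, hz⟩ := exists_solution_of_lipschitz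
    (h := fun t z => g (r' t) (clampCube R z)) (M := M) (K := K)
    (fun z hz => hg.continuous.comp_aestronglyMeasurable (hr'm.aestronglyMeasurable.prodMk
      ((continuous_clampCube R).comp hz).aestronglyMeasurable))
    (fun t z => hM _ (hmem t z))
    (fun t z w => by
      refine (hLip _ (hmem t w) _ (hmem t z)).trans (mul_le_mul_of_nonneg_left ?_ hKnn)
      rw [Prod.mk_sub_mk, sub_self, Prod.norm_def, norm_zero, max_eq_right (norm_nonneg _)]
      exact norm_clampCube_sub_le R z w) z₀
  have hz0 : z 0 = z₀ := by simpa using hz 0 le_rfl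
  have hsol : ∀ T, 0 ≤ T → IsSolutionOn (fun ρ z => g ρ (clampCube R z)) r T z := by
    intro T hT
    refine isSolutionOn_of_continuousOn (c := c) ?_ hr hrb hT hzc.continuousOn fun t ht i => ?_
    · exact hg.continuous.comp (continuous_fst.prodMk
        ((continuous_clampCube R).comp continuous_snd))
    · have hint : IntervalIntegrable (fun τ => g (r' τ) (clampCube R (z τ))) volume 0 t := by
        refine (intervalIntegrable_const (c := M)).mono_fun' ?_
          (Eventually.of_forall fun τ => hM _ (hmem τ (z τ)))
        exact (hg.continuous.comp_aestronglyMeasurable (hr'm.aestronglyMeasurable.prodMk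
          ((continuous_clampCube R).comp hzc).aestronglyMeasurable)).restrict
      have h1 := (ContinuousLinearMap.proj (R := ℝ) (φ := fun _ : ι => ℝ) i).intervalIntegral_comp_comm
        hint
      rw [hz t ht.1, hz0, Pi.add_apply]
      congr 1
      refine h1.symm.trans (intervalIntegral.integral_congr fun τ hτ => ?_)
      rw [uIcc_of_le ht.1] at hτ
      simp [hr', hτ.1]
  have htrue : ∀ T, 0 ≤ T → (∀ t ∈ Icc 0 T, ‖z t‖ ≤ R) → IsSolutionOn g r T z :=
    fun T hT hbd => (hsol T hT).congr hT fun t ht => by rw [clampCube_of_norm_le (hbd t ht)]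
  -- At a first time `T` with `‖z T‖ ≥ R`, the solution was genuine before `T`, hence bounded by `R₀
  -- < R`; continuity contradicts this.
  have hbd : ∀ t, 0 ≤ t → ‖z t‖ < R := by
    by_contra hcon
    push Not at hcon
    obtain ⟨t₁, ht₁, ht₁R⟩ := hcon
    have hScomp : IsCompact (Icc 0 t₁ ∩ {t | R ≤ ‖z t‖}) :=
      isCompact_Icc.inter_right (isClosed_le continuous_const hzc.norm)
    obtain ⟨T, hTS, hTmin⟩ := hScomp.exists_isLeast ⟨t₁, ⟨ht₁, le_rfl⟩, ht₁R⟩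
    have hlt : ∀ t ∈ Ico 0 T, ‖z t‖ < R := fun t ht => by
      by_contra hge
      push Not at hge
      exact absurd (hTmin ⟨⟨ht.1, ht.2.le.trans hTS.1.2⟩, hge⟩) (not_le.2 ht.2)
    have hle : ∀ t ∈ Ico 0 T, ‖z t‖ ≤ R₀ := fun t ht =>
      hap t ht.1 z hz0 (htrue t ht.1 fun τ hτ => (hlt τ ⟨hτ.1, hτ.2.trans_lt ht.2⟩).le) t
        ⟨ht.1, le_rfl⟩
    have hTR : R ≤ ‖z T‖ := hTS.2
    rcases hTS.1.1.eq_or_lt with h0 | hTpos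
    · have h2 := hap 0 le_rfl z hz0 (fun i => ⟨by simp, fun t ht => by
        rw [le_antisymm ht.2 ht.1]
        simp⟩) 0 ⟨le_rfl, le_rfl⟩
      rw [h0] at h2
      linarith
    · have h3 : Tendsto (fun t => ‖z t‖) (𝓝[<] T) (𝓝 ‖z T‖) :=
        (hzc.norm.tendsto T).mono_left nhdsWithin_le_nhds
      have := le_of_tendsto h3 (by
        filter_upwards [Ioo_mem_nhdsLT hTpos] with t ht
        exact hle t ⟨ht.1.le, ht.2⟩)
      linarith
  exact ⟨z, hz0, hzc, fun T hT => htrue T hT fun t ht => (hbd t ht.1).le⟩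

end GlobalSolutions

/-! ### Bounds for quadratic forms and induced norms. -/

section Bounds

variable {n m : ℕ}

theorem dotProduct_self_nonneg' (v : Fin n → ℝ) : 0 ≤ v ⬝ᵥ v := by
  simpa using dotProduct_star_self_nonneg v

theorem sq_le_dotProduct_self (v : Fin n → ℝ) (i : Fin n) : v i ^ 2 ≤ v ⬝ᵥ v := by
  rw [sq]
  exact Finset.single_le_sum (f := fun i => v i * v i) (fun j _ => mul_self_nonneg (v j))
    (Finset.mem_univ i)

theorem exists_pos_mul_le_quadForm {P : Matrix (Fin n) (Fin n) ℝ} (hP : P.PosDef) :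
    ∃ p : ℝ, 0 < p ∧ ∀ v, p * (v ⬝ᵥ v) ≤ v ⬝ᵥ (P *ᵥ v) := by
  obtain ⟨p, hp, h⟩ := exists_quadForm_add_smul_neg (X := -P) (fun v hv => by
    rw [neg_mulVec, dotProduct_neg]
    simpa using hP.dotProduct_mulVec_pos hv) 1
  refine ⟨p, hp, fun v => ?_⟩
  by_cases hv : v = 0
  · simp [hv]
  · have := h v hv
    rw [add_mulVec, neg_mulVec, smul_mulVec, one_mulVec, dotProduct_add, dotProduct_neg,
      dotProduct_smul, smul_eq_mul] at this
    linarith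

theorem exists_quadForm_le_mul (S : Matrix (Fin n) (Fin n) ℝ) :
    ∃ s : ℝ, 0 < s ∧ ∀ v, v ⬝ᵥ (S *ᵥ v) ≤ s * (v ⬝ᵥ v) := by
  obtain ⟨ε, hε, h⟩ := exists_quadForm_add_smul_neg (X := -(1 : Matrix (Fin n) (Fin n) ℝ))
    (fun v hv => by
      rw [neg_mulVec, one_mulVec, dotProduct_neg, neg_lt_zero]
      simpa using (dotProduct_star_self_pos_iff (v := v)).2 hv) S
  refine ⟨ε⁻¹, inv_pos.2 hε, fun v => ?_⟩
  by_cases hv : v = 0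
  · simp [hv]
  · have := h v hv
    rw [add_mulVec, neg_mulVec, smul_mulVec, one_mulVec, dotProduct_add, dotProduct_neg,
      dotProduct_smul, smul_eq_mul] at this
    rw [inv_mul_eq_div, le_div_iff₀ hε]
    linarith

/-- For `n = 0` the spectrum is empty and its `sInf` is the default value `0`, so positivity needs a
nonempty index type. -/
theorem lambdaMin_pos_and_le {Q : Matrix (Fin n) (Fin n) ℝ} [Nonempty (Fin n)] (hQ : Q.PosDef) :
    0 < lambdaMin Q ∧ ∀ v, lambdaMin Q * (v ⬝ᵥ v) ≤ v ⬝ᵥ (Q *ᵥ v) := by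
  have hspec := hQ.1.spectrum_real_eq_range_eigenvalues
  have hfin : (spectrum ℝ Q).Finite := by rw [hspec]; exact finite_range _
  have hne : (spectrum ℝ Q).Nonempty := by rw [hspec]; exact range_nonempty _
  constructor
  · have hmem := hne.csInf_mem hfin
    rw [hspec] at hmem
    obtain ⟨i, hi⟩ := hmem
    rw [lambdaMin, hspec, ← hi]
    exact hQ.eigenvalues_pos i
  · have hpsd : (Q - lambdaMin Q • (1 : Matrix (Fin n) (Fin n) ℝ)).PosSemidef := by
      refine Matrix.posSemidef_iff_isHermitian_and_spectrum_nonneg.2 ⟨?_, fun a ha => ?_⟩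
      · refine hQ.1.sub ?_
        simp [IsHermitian]
      · rw [← Algebra.algebraMap_eq_smul_one, ← spectrum.sub_singleton_eq] at ha
        obtain ⟨b, hb, c, hc, rfl⟩ := ha
        rw [mem_singleton_iff.1 hc]
        exact sub_nonneg.2 (csInf_le hfin.bddBelow hb)
    intro v
    have := hpsd.dotProduct_mulVec_nonneg v
    rw [star_trivial, sub_mulVec, smul_mulVec, one_mulVec, dotProduct_sub, dotProduct_smul,
      smul_eq_mul] at this
    linarith

theorem inducedNorm_nonneg (X : Matrix (Fin n) (Fin m) ℝ) : 0 ≤ inducedNorm X :=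
  norm_nonneg _

theorem mulVec_dotProduct_self_le (X : Matrix (Fin n) (Fin m) ℝ) (v : Fin m → ℝ) :
    (X *ᵥ v) ⬝ᵥ (X *ᵥ v) ≤ inducedNorm X ^ 2 * (v ⬝ᵥ v) := by
  have hsq : ∀ {k : ℕ} (w : Fin k → ℝ), ‖WithLp.toLp 2 w‖ ^ 2 = w ⬝ᵥ w := fun w => by
    rw [EuclideanSpace.real_norm_sq_eq]
    exact Finset.sum_congr rfl fun i _ => sq _
  have h := (LinearMap.toContinuousLinearMap (Matrix.toEuclideanLin X)).le_opNorm (WithLp.toLp 2 v)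
  rw [LinearMap.coe_toContinuousLinearMap', Matrix.toLpLin_apply] at h
  rw [← hsq, ← hsq, ← mul_pow]
  exact pow_le_pow_left₀ (norm_nonneg _) h 2

end Bounds

/-! ### Decay of the error form under the additional injection. -/

section ErrorDynamics

variable {n m : ℕ} {A Am : Matrix (Fin n) (Fin n) ℝ} {B C : Matrix (Fin n) (Fin m) ℝ}
  {Λ : Matrix (Fin m) (Fin m) ℝ} {Θs : Matrix (Fin n) (Fin m) ℝ} {Ks : Matrix (Fin m) (Fin m) ℝ}
  {L Ls : Matrix (Fin n) (Fin m) ℝ} {P Qs : Matrix (Fin n) (Fin n) ℝ} {ρ θbar lbar : ℝ}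

/-- The condition `P B = C M` makes the effect of inputs on `eᵀ P e` depend on the measured `Cᵀ e`
alone, which lets an output-driven update law cancel it. -/
theorem IsLyapunovPair.dotProduct_mulVec_input (h : IsLyapunovPair Am B C Ls P Qs)
    (e : Fin n → ℝ) (y : Fin m → ℝ) :
    e ⬝ᵥ (P *ᵥ (B *ᵥ y)) = ((mixing B C)ᵀ *ᵥ (Cᵀ *ᵥ e)) ⬝ᵥ y := by
  rw [mulVec_mulVec, h.matching, ← mulVec_mulVec]
  have h1 := dotProduct_mulVec_transpose Cᵀ e (mixing B C *ᵥ y)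
  have h2 := dotProduct_mulVec_transpose (mixing B C)ᵀ (Cᵀ *ᵥ e) y
  rw [transpose_transpose] at h1 h2
  rw [h1, h2]

/-- Young's inequality `-2 y · e ≤ |y|² / ν + ν |e|²` works if `a² / (2ρ) ≤ ν < l`. The threshold on
`ρ` makes this interval nonempty; `ν` is its midpoint and `c = l - ν`. -/
theorem exists_cross_term_rate {a l ρ : ℝ} (hl : 0 < l) (hρ : a ^ 2 / (2 * l) < ρ) :
    ∃ c : ℝ, 0 < c ∧ ∀ (e y : Fin n → ℝ) (W : ℝ), 0 ≤ W → y ⬝ᵥ y ≤ a ^ 2 * W →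
      -l * (e ⬝ᵥ e) - 2 * ρ * W - 2 * (y ⬝ᵥ e) ≤ -c * (e ⬝ᵥ e) := by
  have hρ0 : 0 < ρ := lt_of_le_of_lt (by positivity) hρ
  rw [div_lt_iff₀ (by positivity)] at hρ
  set ν := (a ^ 2 / (2 * ρ) + l) / 2 with hν
  have h1 : a ^ 2 / (2 * ρ) < l := by
    rw [div_lt_iff₀ (by positivity)]
    linarith
  have h0 : 0 ≤ a ^ 2 / (2 * ρ) := by positivity
  have hν0 : 0 < ν := by rw [hν]; linarith
  have hνa : a ^ 2 ≤ 2 * ρ * ν := by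
    have : a ^ 2 / (2 * ρ) ≤ ν := by rw [hν]; linarith
    rw [div_le_iff₀ (by positivity)] at this
    linarith
  refine ⟨l - ν, by rw [hν]; linarith, fun e y W hW hy => ?_⟩
  have h2 := dotProduct_self_nonneg' (y + ν • e)
  simp only [add_dotProduct, dotProduct_add, smul_dotProduct, dotProduct_smul, smul_eq_mul] at h2
  rw [dotProduct_comm e y] at h2
  have h3 : y ⬝ᵥ y ≤ ν * (2 * ρ * W) := by
    have := mul_le_mul_of_nonneg_right hνa hW
    linarith
  have h4 : 0 ≤ ν * (2 * ρ * W + 2 * (y ⬝ᵥ e) + ν * (e ⬝ᵥ e)) := by linarith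
  have h5 := nonneg_of_mul_nonneg_right h4 hν0
  linarith

/-- The decay rate of the error part of the Lyapunov function. -/
theorem IsLyapunovPair.exists_decay_rate (h : IsLyapunovPair Am B C Ls P Qs)
    (hΛ : IsPosDiagonal Λ) (hθ : inducedNorm Θs ≤ θbar) (hl : inducedNorm Λ ≤ lbar)
    (hρ : rhoStar lbar θbar Qs < ρ) :
    ∃ c : ℝ, 0 < c ∧ ∀ e, 2 * (e ⬝ᵥ (P *ᵥ ((Am + (Ls - ρ • (B * (mixing B C)ᵀ)) * Cᵀ) *ᵥ e -
      (B * Λ) *ᵥ (Θsᵀ *ᵥ e)))) ≤ -c * (e ⬝ᵥ e) := by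
  rcases isEmpty_or_nonempty (Fin n) with hn | hn
  · exact ⟨1, one_pos, fun e => by simp [dotProduct, Subsingleton.elim e 0]⟩
  obtain ⟨hl0, hle⟩ := lambdaMin_pos_and_le h.posDef_Qs
  obtain ⟨c, hc, hdecay⟩ := exists_cross_term_rate (n := n) (a := lbar * θbar) hl0 (ρ := ρ) (by
    rw [mul_pow]
    exact hρ)
  refine ⟨c, hc, fun e => ?_⟩
  have hPT : Pᵀ = P := by simpa [IsHermitian] using h.posDef_P.1
  -- The extra injection contributes `-2ρ |w|²`, and the unmatched feedback contributes `-2 (Θs Λ w)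
  -- · e`, with `|Θs Λ w|` at most `lbar * θbar * |w|`.
  set w := (mixing B C)ᵀ *ᵥ (Cᵀ *ᵥ e) with hw
  have hΛT : Λᵀ = Λ := hΛ.1.isSymm
  have h1 : 2 * (e ⬝ᵥ (P *ᵥ ((Am + Ls * Cᵀ) *ᵥ e))) = -(e ⬝ᵥ (Qs *ᵥ e)) := by
    have := congrArg (fun X => e ⬝ᵥ (X *ᵥ e)) h.lyapunov
    simp only [neg_mulVec, dotProduct_neg] at this
    rw [← this, add_mulVec ((Am + Ls * Cᵀ)ᵀ * P), dotProduct_add, ← mulVec_mulVec, ← mulVec_mulVec,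
      dotProduct_mulVec_transpose, dotProduct_mulVec_comm hPT ((Am + Ls * Cᵀ) *ᵥ e)]
    ring
  have h2 : (Am + (Ls - ρ • (B * (mixing B C)ᵀ)) * Cᵀ) *ᵥ e - (B * Λ) *ᵥ (Θsᵀ *ᵥ e) =
      (Am + Ls * Cᵀ) *ᵥ e - B *ᵥ (ρ • w + Λ *ᵥ (Θsᵀ *ᵥ e)) := by
    rw [Matrix.sub_mul, Matrix.smul_mul, ← add_sub_assoc, sub_mulVec, smul_mulVec, mulVec_add,
      mulVec_smul, hw]
    simp only [mulVec_mulVec, Matrix.mul_assoc]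
    abel
  have h3 : w ⬝ᵥ (Λ *ᵥ (Θsᵀ *ᵥ e)) = (Θs *ᵥ (Λ *ᵥ w)) ⬝ᵥ e := by
    rw [dotProduct_mulVec_comm hΛT, dotProduct_comm, dotProduct_mulVec_transpose]
  have h4 : (Θs *ᵥ (Λ *ᵥ w)) ⬝ᵥ (Θs *ᵥ (Λ *ᵥ w)) ≤ (lbar * θbar) ^ 2 * (w ⬝ᵥ w) := by
    have hw0 := dotProduct_self_nonneg' w
    have hθ0 := inducedNorm_nonneg Θs
    have hl0 := inducedNorm_nonneg Λ
    calc (Θs *ᵥ (Λ *ᵥ w)) ⬝ᵥ (Θs *ᵥ (Λ *ᵥ w))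
        ≤ inducedNorm Θs ^ 2 * ((Λ *ᵥ w) ⬝ᵥ (Λ *ᵥ w)) := mulVec_dotProduct_self_le _ _
      _ ≤ inducedNorm Θs ^ 2 * (inducedNorm Λ ^ 2 * (w ⬝ᵥ w)) := by
          gcongr; exact mulVec_dotProduct_self_le _ _
      _ ≤ θbar ^ 2 * (lbar ^ 2 * (w ⬝ᵥ w)) := by gcongr
      _ = (lbar * θbar) ^ 2 * (w ⬝ᵥ w) := by ring
  have h5 := hdecay e _ (w ⬝ᵥ w) (dotProduct_self_nonneg' w) h4
  have h6 := hle e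
  rw [h2, mulVec_sub, dotProduct_sub, h.dotProduct_mulVec_input, ← hw, dotProduct_add,
    dotProduct_smul, smul_eq_mul, h3]
  linarith

end ErrorDynamics

/-! ### The closed loop as one differential equation, and its Lyapunov function. -/

section ClosedLoop

open MeasureTheory

variable {n m : ℕ}

/-- The index set of the state `(x, x_m, Θ, K)` of the closed loop. -/
abbrev StateIndex (n m : ℕ) : Type :=
  Fin n ⊕ Fin n ⊕ (Fin n × Fin m) ⊕ (Fin m × Fin m)

/-- The plant state. -/
def plantState (z : StateIndex n m → ℝ) : Fin n → ℝ :=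
  fun i => z (Sum.inl i)

/-- The reference model state. -/
def modelState (z : StateIndex n m → ℝ) : Fin n → ℝ :=
  fun i => z (Sum.inr (Sum.inl i))

/-- The feedback gain. -/
def feedbackGain (z : StateIndex n m → ℝ) : Matrix (Fin n) (Fin m) ℝ :=
  Matrix.of fun i j => z (Sum.inr (Sum.inr (Sum.inl (i, j))))

/-- The feedforward gain. -/
def feedforwardGain (z : StateIndex n m → ℝ) : Matrix (Fin m) (Fin m) ℝ :=
  Matrix.of fun i j => z (Sum.inr (Sum.inr (Sum.inr (i, j))))

/-- The joint state of the closed loop. -/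
def packState (x xm : Fin n → ℝ) (Θ : Matrix (Fin n) (Fin m) ℝ) (K : Matrix (Fin m) (Fin m) ℝ) :
    StateIndex n m → ℝ :=
  Sum.elim x (Sum.elim xm (Sum.elim (fun p => Θ p.1 p.2) fun p => K p.1 p.2))

/-- The vector field of the closed loop. -/
def closedLoopField (A Am : Matrix (Fin n) (Fin n) ℝ) (B C : Matrix (Fin n) (Fin m) ℝ)
    (Λ : Matrix (Fin m) (Fin m) ℝ) (L : Matrix (Fin n) (Fin m) ℝ) (Γθ : Matrix (Fin n) (Fin n) ℝ)
    (Γk : Matrix (Fin m) (Fin m) ℝ) (r : Fin m → ℝ) (z : StateIndex n m → ℝ) :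
    StateIndex n m → ℝ :=
  packState
    (A *ᵥ plantState z + (B * Λ) *ᵥ
      controlInput (modelState z) (feedbackGain z) (feedforwardGain z) r)
    (Am *ᵥ modelState z + B *ᵥ r - L *ᵥ outputError C (plantState z) (modelState z))
    (-(Γθ * vecMulVec (modelState z) (outputError C (plantState z) (modelState z)) * mixing B C))
    (-(Γk * vecMulVec r (outputError C (plantState z) (modelState z)) * mixing B C))

variable {A Am : Matrix (Fin n) (Fin n) ℝ} {B C : Matrix (Fin n) (Fin m) ℝ}
  {Λ : Matrix (Fin m) (Fin m) ℝ} {L : Matrix (Fin n) (Fin m) ℝ} {Γθ : Matrix (Fin n) (Fin n) ℝ}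
  {Γk : Matrix (Fin m) (Fin m) ℝ}

theorem contDiff_closedLoopField :
    ContDiff ℝ 1 (Function.uncurry (closedLoopField A Am B C Λ L Γθ Γk)) := by
  refine contDiff_pi.2 ?_
  rintro (i | i | ⟨i, j⟩ | ⟨i, j⟩) <;>
  simp only [Function.uncurry_def, closedLoopField, packState, Sum.elim_inl, Sum.elim_inr,
    plantState, modelState, feedbackGain, feedforwardGain, controlInput, outputError, mulVec,
    dotProduct, Pi.add_apply, Pi.sub_apply, Matrix.neg_apply, Matrix.mul_apply, vecMulVec_apply,
    transpose_apply, Matrix.of_apply] <;>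
  fun_prop

theorem norm_le_of_isBoundedSignal {r : ℝ → Fin m → ℝ} (hr : IsBoundedSignal r) :
    ∃ c, ∀ t, 0 ≤ t → ‖r t‖ ≤ c := by
  obtain ⟨c, hc⟩ := hr
  refine ⟨|c|, fun t ht => (pi_norm_le_iff_of_nonneg (abs_nonneg c)).2 fun i => ?_⟩
  exact (hc t ht i).trans (le_abs_self c)

theorem IsClosedLoopSolution.isSolutionOn {r : ℝ → Fin m → ℝ} (hr : Measurable r) {c : ℝ}
    (hrb : ∀ t, 0 ≤ t → ‖r t‖ ≤ c) {x xm : ℝ → Fin n → ℝ} {Θ : ℝ → Matrix (Fin n) (Fin m) ℝ}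
    {K : ℝ → Matrix (Fin m) (Fin m) ℝ}
    (h : IsClosedLoopSolution A Am B C Λ L Γθ Γk r x xm Θ K) {T : ℝ} (hT : 0 ≤ T) :
    IsSolutionOn (closedLoopField A Am B C Λ L Γθ Γk) r T
      fun t => packState (x t) (xm t) (Θ t) (K t) := by
  refine isSolutionOn_of_continuousOn contDiff_closedLoopField.continuous hr hrb hT ?_ ?_
  · refine ContinuousOn.mono ?_ (Icc_subset_Ici_self : Icc 0 T ⊆ Ici 0)
    refine continuousOn_pi.2 ?_
    rintro (i | i | ⟨i, j⟩ | ⟨i, j⟩)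
    · exact continuousOn_pi.1 h.continuousOn_x i
    · exact continuousOn_pi.1 h.continuousOn_xm i
    · exact continuousOn_pi.1 (continuousOn_pi.1 h.continuousOn_Θ i) j
    · exact continuousOn_pi.1 (continuousOn_pi.1 h.continuousOn_K i) j
  · rintro t ht (i | i | ⟨i, j⟩ | ⟨i, j⟩)
    · exact h.plant t ht.1 i
    · exact h.reference t ht.1 i
    · exact h.update_Θ t ht.1 i j
    · exact h.update_K t ht.1 i j

theorem isClosedLoopSolution_of_isSolutionOn {r : ℝ → Fin m → ℝ} {z : ℝ → StateIndex n m → ℝ}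
    (hz : Continuous z)
    (h : ∀ T, 0 ≤ T → IsSolutionOn (closedLoopField A Am B C Λ L Γθ Γk) r T z) :
    IsClosedLoopSolution A Am B C Λ L Γθ Γk r (fun t => plantState (z t))
      (fun t => modelState (z t)) (fun t => feedbackGain (z t))
      (fun t => feedforwardGain (z t)) where
  continuousOn_x := (continuous_pi fun _ => (continuous_apply _).comp hz).continuousOn
  continuousOn_xm := (continuous_pi fun _ => (continuous_apply _).comp hz).continuousOn
  continuousOn_Θ :=
    Continuous.continuousOn (f := fun t => feedbackGain (z t)) <|
      continuous_matrix fun i j => (continuous_apply (Sum.inr (Sum.inr (Sum.inl (i, j))))).comp hz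
  continuousOn_K :=
    Continuous.continuousOn (f := fun t => feedforwardGain (z t)) <|
      continuous_matrix fun i j => (continuous_apply (Sum.inr (Sum.inr (Sum.inr (i, j))))).comp hz
  plant t ht i := (h t ht (Sum.inl i)).eq_integral t ⟨ht, le_rfl⟩
  reference t ht i := (h t ht (Sum.inr (Sum.inl i))).eq_integral t ⟨ht, le_rfl⟩
  update_Θ t ht i j := (h t ht (Sum.inr (Sum.inr (Sum.inl (i, j))))).eq_integral t ⟨ht, le_rfl⟩
  update_K t ht i j := (h t ht (Sum.inr (Sum.inr (Sum.inr (i, j))))).eq_integral t ⟨ht, le_rfl⟩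

/-- The tracking error `x - x_m`. -/
def trackingError (z : StateIndex n m → ℝ) : Fin n → ℝ :=
  plantState z - modelState z

theorem outputError_eq (z : StateIndex n m → ℝ) :
    outputError C (plantState z) (modelState z) = Cᵀ *ᵥ trackingError z := by
  rw [outputError, trackingError, mulVec_sub]

/-- The error dynamics in terms of the parameter errors. -/
theorem trackingError_closedLoopField {Θs : Matrix (Fin n) (Fin m) ℝ}
    {Ks : Matrix (Fin m) (Fin m) ℝ} (h4 : A + B * Λ * Θsᵀ = Am) (h4' : Λ * Ksᵀ = 1)
    (r : Fin m → ℝ) (z : StateIndex n m → ℝ) :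
    trackingError (closedLoopField A Am B C Λ L Γθ Γk r z) =
      (Am + L * Cᵀ) *ᵥ trackingError z - (B * Λ) *ᵥ (Θsᵀ *ᵥ trackingError z) +
        B *ᵥ (Λ *ᵥ ((feedbackGain z - Θs)ᵀ *ᵥ modelState z +
          (feedforwardGain z - Ks)ᵀ *ᵥ r)) := by
  have hp : plantState z = trackingError z + modelState z := by
    rw [trackingError, sub_add_cancel]
  -- The feedforward matching condition expresses the reference input through the plant's input
  -- matrix.
  have hB : B *ᵥ r = (B * Λ) *ᵥ (Ksᵀ *ᵥ r) := by
    rw [mulVec_mulVec, Matrix.mul_assoc, h4', Matrix.mul_one]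
  have hfield : trackingError (closedLoopField A Am B C Λ L Γθ Γk r z) =
      A *ᵥ plantState z + (B * Λ) *ᵥ
        controlInput (modelState z) (feedbackGain z) (feedforwardGain z) r -
      (Am *ᵥ modelState z + B *ᵥ r - L *ᵥ outputError C (plantState z) (modelState z)) := rfl
  rw [hfield, outputError_eq, hp, hB, ← h4, controlInput]
  simp only [mulVec_add, add_mulVec, mulVec_sub, sub_mulVec, transpose_sub, mulVec_mulVec,
    Matrix.mul_assoc]
  abel

theorem isPrimitiveOn_trackingError {r : ℝ → Fin m → ℝ} {T : ℝ} {z : ℝ → StateIndex n m → ℝ}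
    (h : IsSolutionOn (closedLoopField A Am B C Λ L Γθ Γk) r T z) (i : Fin n) :
    IsPrimitiveOn T (fun t => trackingError (z t) i)
      fun t => trackingError (closedLoopField A Am B C Λ L Γθ Γk (r t) (z t)) i :=
  (h (Sum.inl i)).sub (h (Sum.inr (Sum.inl i)))

theorem IsPrimitiveOn.quadForm {T : ℝ} (hT : 0 ≤ T) {P : Matrix (Fin n) (Fin n) ℝ}
    (hP : Pᵀ = P) {v v' : ℝ → Fin n → ℝ}
    (h : ∀ i, IsPrimitiveOn T (fun t => v t i) fun t => v' t i) :
    IsPrimitiveOn T (fun t => v t ⬝ᵥ (P *ᵥ v t)) fun t => 2 * (v t ⬝ᵥ (P *ᵥ v' t)) := by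
  have h1 : IsPrimitiveOn T (fun t => ∑ i, v t i * ∑ j, P i j * v t j)
      fun t => ∑ i, (v' t i * (∑ j, P i j * v t j) + v t i * ∑ j, P i j * v' t j) :=
    IsPrimitiveOn.sum _ fun i _ =>
      (h i).mul hT (IsPrimitiveOn.sum _ fun j _ => (h j).const_mul (P i j))
  refine h1.congr_deriv hT fun t _ => ?_
  rw [Finset.sum_add_distrib, two_mul]
  congr 1
  exact dotProduct_mulVec_comm hP (v' t) (v t)

/-- The weighted sum of the squares of the entries of a matrix. -/
def weightedSq {p q : ℕ} (c X : Matrix (Fin p) (Fin q) ℝ) : ℝ :=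
  ∑ i, ∑ j, c i j * (X i j * X i j)

theorem weightedSq_nonneg {p q : ℕ} {c : Matrix (Fin p) (Fin q) ℝ} (hc : ∀ i j, 0 < c i j)
    (X : Matrix (Fin p) (Fin q) ℝ) : 0 ≤ weightedSq c X :=
  Finset.sum_nonneg fun i _ => Finset.sum_nonneg fun j _ =>
    mul_nonneg (hc i j).le (mul_self_nonneg _)

theorem le_weightedSq {p q : ℕ} {c : Matrix (Fin p) (Fin q) ℝ} (hc : ∀ i j, 0 < c i j)
    (X : Matrix (Fin p) (Fin q) ℝ) (i : Fin p) (j : Fin q) :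
    c i j * (X i j * X i j) ≤ weightedSq c X := by
  have hnn : ∀ i j, 0 ≤ c i j * (X i j * X i j) := fun i j =>
    mul_nonneg (hc i j).le (mul_self_nonneg _)
  refine (Finset.single_le_sum (f := fun j => c i j * (X i j * X i j)) (fun j _ => hnn i j)
    (Finset.mem_univ j)).trans ?_
  exact Finset.single_le_sum (f := fun i => ∑ j, c i j * (X i j * X i j))
    (fun i _ => Finset.sum_nonneg fun j _ => hnn i j) (Finset.mem_univ i)

theorem IsPrimitiveOn.weightedSq {p q : ℕ} {T : ℝ} (hT : 0 ≤ T) (c Xs : Matrix (Fin p) (Fin q) ℝ)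
    {X X' : ℝ → Matrix (Fin p) (Fin q) ℝ}
    (h : ∀ i j, IsPrimitiveOn T (fun t => X t i j) fun t => X' t i j) :
    IsPrimitiveOn T (fun t => weightedSq c (X t - Xs))
      fun t => 2 * ∑ i, ∑ j, c i j * ((X t - Xs) i j * X' t i j) := by
  have h0 : ∀ i j, IsPrimitiveOn T (fun t => (X t - Xs) i j) fun t => X' t i j - 0 := fun i j =>
    (h i j).sub (IsPrimitiveOn.const T (Xs i j))
  have h1 : IsPrimitiveOn T (fun t => AdaptiveControl.weightedSq c (X t - Xs)) _ :=
    IsPrimitiveOn.sum _ fun i _ => IsPrimitiveOn.sum _ fun j _ =>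
      ((h0 i j).mul hT (h0 i j)).const_mul (c i j)
  refine h1.congr_deriv hT fun t _ => ?_
  simp only [Finset.mul_sum]
  refine Finset.sum_congr rfl fun i _ => Finset.sum_congr rfl fun j _ => ?_
  ring

/-- The weights of the parameter errors in the Lyapunov function. -/
noncomputable def gainWeight {p : ℕ} (Λ : Matrix (Fin m) (Fin m) ℝ)
    (Γ : Matrix (Fin p) (Fin p) ℝ) : Matrix (Fin p) (Fin m) ℝ :=
  Matrix.of fun i j => Λ j j / Γ i i

theorem gainWeight_pos {p : ℕ} {Γ : Matrix (Fin p) (Fin p) ℝ} (hΛ : IsPosDiagonal Λ)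
    (hΓ : IsPosDiagonal Γ) (i : Fin p) (j : Fin m) : 0 < gainWeight Λ Γ i j :=
  div_pos (hΛ.2 j) (hΓ.2 i)

/-- Along the adaptation law, the parameter errors contribute the negative of the cross term. -/
theorem sum_gainWeight_update {p : ℕ} {Γ : Matrix (Fin p) (Fin p) ℝ} (hΛ : IsPosDiagonal Λ)
    (hΓ : IsPosDiagonal Γ) (X : Matrix (Fin p) (Fin m) ℝ) (v : Fin p → ℝ) (y : Fin m → ℝ)
    (M : Matrix (Fin m) (Fin m) ℝ) :
    ∑ i, ∑ j, gainWeight Λ Γ i j * (X i j * (-(Γ * vecMulVec v y * M)) i j) =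
      -((Mᵀ *ᵥ y) ⬝ᵥ (Λ *ᵥ (Xᵀ *ᵥ v))) := by
  have hΛd : Λ = diagonal fun j => Λ j j := (hΛ.1.diagonal_diag).symm
  have hΓd : Γ = diagonal fun i => Γ i i := (hΓ.1.diagonal_diag).symm
  have h1 : ∀ i j, (Γ * vecMulVec v y * M) i j = Γ i i * (v i * (Mᵀ *ᵥ y) j) := by
    intro i j
    rw [hΓd, Matrix.mul_assoc, diagonal_mul, vecMulVec_mul, vecMulVec_apply, mulVec_transpose,
      diagonal_apply_eq]
  have h2 : ∀ j, (Λ *ᵥ (Xᵀ *ᵥ v)) j = Λ j j * ∑ i, X i j * v i := by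
    intro j
    rw [hΛd, mulVec_diagonal, diagonal_apply_eq]
    rfl
  rw [Finset.sum_comm, dotProduct, ← Finset.sum_neg_distrib]
  refine Finset.sum_congr rfl fun j _ => ?_
  rw [h2, Finset.mul_sum, Finset.mul_sum, ← Finset.sum_neg_distrib]
  refine Finset.sum_congr rfl fun i _ => ?_
  rw [Matrix.neg_apply, h1, gainWeight, Matrix.of_apply]
  have := (hΓ.2 i).ne'
  field_simp

/-- The Lyapunov function of the adaptive system. -/
noncomputable def lyapunovFun (P : Matrix (Fin n) (Fin n) ℝ) (Λ : Matrix (Fin m) (Fin m) ℝ)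
    (Γθ : Matrix (Fin n) (Fin n) ℝ) (Γk : Matrix (Fin m) (Fin m) ℝ)
    (Θs : Matrix (Fin n) (Fin m) ℝ) (Ks : Matrix (Fin m) (Fin m) ℝ) (z : StateIndex n m → ℝ) : ℝ :=
  trackingError z ⬝ᵥ (P *ᵥ trackingError z) +
    weightedSq (gainWeight Λ Γθ) (feedbackGain z - Θs) +
    weightedSq (gainWeight Λ Γk) (feedforwardGain z - Ks)

end ClosedLoop

/-! ### Boundedness and convergence of the closed loop. -/

section Stability

open MeasureTheory

variable {n m : ℕ} {A Am : Matrix (Fin n) (Fin n) ℝ} {B C : Matrix (Fin n) (Fin m) ℝ}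
  {Λ : Matrix (Fin m) (Fin m) ℝ} {L : Matrix (Fin n) (Fin m) ℝ} {Γθ : Matrix (Fin n) (Fin n) ℝ}
  {Γk : Matrix (Fin m) (Fin m) ℝ} {P : Matrix (Fin n) (Fin n) ℝ}
  {Θs : Matrix (Fin n) (Fin m) ℝ} {Ks : Matrix (Fin m) (Fin m) ℝ} {c : ℝ}

/-- The derivative of the Lyapunov function along the closed loop. -/
noncomputable def lyapunovDeriv (A Am : Matrix (Fin n) (Fin n) ℝ) (B C : Matrix (Fin n) (Fin m) ℝ)
    (Λ : Matrix (Fin m) (Fin m) ℝ) (L : Matrix (Fin n) (Fin m) ℝ) (Γθ : Matrix (Fin n) (Fin n) ℝ)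
    (Γk : Matrix (Fin m) (Fin m) ℝ) (P : Matrix (Fin n) (Fin n) ℝ)
    (Θs : Matrix (Fin n) (Fin m) ℝ) (Ks : Matrix (Fin m) (Fin m) ℝ) (r : Fin m → ℝ)
    (z : StateIndex n m → ℝ) : ℝ :=
  2 * (trackingError z ⬝ᵥ (P *ᵥ trackingError (closedLoopField A Am B C Λ L Γθ Γk r z))) +
    2 * (∑ i, ∑ j, gainWeight Λ Γθ i j * ((feedbackGain z - Θs) i j *
      feedbackGain (closedLoopField A Am B C Λ L Γθ Γk r z) i j)) +
    2 * (∑ i, ∑ j, gainWeight Λ Γk i j * ((feedforwardGain z - Ks) i j *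
      feedforwardGain (closedLoopField A Am B C Λ L Γθ Γk r z) i j))

theorem isPrimitiveOn_lyapunovFun (hP : P.PosDef) {r : ℝ → Fin m → ℝ} {T : ℝ} (hT : 0 ≤ T)
    {z : ℝ → StateIndex n m → ℝ}
    (h : IsSolutionOn (closedLoopField A Am B C Λ L Γθ Γk) r T z) :
    IsPrimitiveOn T (fun t => lyapunovFun P Λ Γθ Γk Θs Ks (z t))
      fun t => lyapunovDeriv A Am B C Λ L Γθ Γk P Θs Ks (r t) (z t) := by
  have hPT : Pᵀ = P := by simpa [IsHermitian] using hP.1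
  exact ((IsPrimitiveOn.quadForm hT hPT (isPrimitiveOn_trackingError h)).add
    (IsPrimitiveOn.weightedSq hT _ Θs fun i j => h (Sum.inr (Sum.inr (Sum.inl (i, j)))))).add
    (IsPrimitiveOn.weightedSq hT _ Ks fun i j => h (Sum.inr (Sum.inr (Sum.inr (i, j)))))

/-- The weights `Λ j j / Γ i i` cancel the adaptation gains, so the parameter terms are exactly
opposite to the parameter-error term in the derivative of `eᵀ P e`. -/
theorem lyapunovDeriv_le (h4 : A + B * Λ * Θsᵀ = Am) (h4' : Λ * Ksᵀ = 1) (hΛ : IsPosDiagonal Λ)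
    (hΓθ : IsPosDiagonal Γθ) (hΓk : IsPosDiagonal Γk)
    (hPB : ∀ e y, e ⬝ᵥ (P *ᵥ (B *ᵥ y)) = ((mixing B C)ᵀ *ᵥ (Cᵀ *ᵥ e)) ⬝ᵥ y)
    (hdecay : ∀ e, 2 * (e ⬝ᵥ (P *ᵥ ((Am + L * Cᵀ) *ᵥ e - (B * Λ) *ᵥ (Θsᵀ *ᵥ e)))) ≤
      -c * (e ⬝ᵥ e)) (r : Fin m → ℝ) (z : StateIndex n m → ℝ) :
    lyapunovDeriv A Am B C Λ L Γθ Γk P Θs Ks r z ≤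
      -c * (trackingError z ⬝ᵥ trackingError z) := by
  have h1 : feedbackGain (closedLoopField A Am B C Λ L Γθ Γk r z) =
      -(Γθ * vecMulVec (modelState z) (Cᵀ *ᵥ trackingError z) * mixing B C) := by
    rw [← outputError_eq]
    rfl
  have h2 : feedforwardGain (closedLoopField A Am B C Λ L Γθ Γk r z) =
      -(Γk * vecMulVec r (Cᵀ *ᵥ trackingError z) * mixing B C) := by
    rw [← outputError_eq]
    rfl
  rw [lyapunovDeriv, h1, h2, sum_gainWeight_update hΛ hΓθ, sum_gainWeight_update hΛ hΓk,
    trackingError_closedLoopField h4 h4', mulVec_add P, dotProduct_add, hPB, mulVec_add Λ,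
    dotProduct_add]
  have := hdecay (trackingError z)
  linarith

theorem abs_le_sqrt_of_mul_le {p a V : ℝ} (hp : 0 < p) (h : p * (a * a) ≤ V) :
    |a| ≤ √(V / p) := by
  refine Real.abs_le_sqrt ?_
  rw [le_div_iff₀ hp, sq]
  linarith

/-- The reference model with a bounded forcing has bounded states. -/
theorem IsHurwitz.exists_bound (hAm : IsHurwitz Am) {K : Set ((Fin m → ℝ) × (Fin n → ℝ))}
    (hK : IsCompact K) {d : (Fin m → ℝ) × (Fin n → ℝ) → Fin n → ℝ} (hd : Continuous d)
    (v₀ : Fin n → ℝ) :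
    ∃ b, ∀ T, 0 ≤ T → ∀ (v : ℝ → Fin n → ℝ) (w : ℝ → (Fin m → ℝ) × (Fin n → ℝ)), v 0 = v₀ →
      (∀ i, IsPrimitiveOn T (fun t => v t i) fun t => (Am *ᵥ v t + d (w t)) i) →
      (∀ t ∈ Icc 0 T, w t ∈ K) → ∀ t ∈ Icc 0 T, ∀ i, |v t i| ≤ b := by
  obtain ⟨S, hS, hSA⟩ := hAm.exists_lyapunov
  have hST : Sᵀ = S := by simpa [IsHermitian] using hS.1
  obtain ⟨p, hp, hpS⟩ := exists_pos_mul_le_quadForm hS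
  obtain ⟨s, hs, hsS⟩ := exists_quadForm_le_mul S
  have hcont : Continuous fun w => (S *ᵥ d w) ⬝ᵥ (S *ᵥ d w) :=
    (continuous_const.matrix_mulVec hd).dotProduct (continuous_const.matrix_mulVec hd)
  obtain ⟨Y, hY⟩ := hK.exists_bound_of_continuousOn hcont.continuousOn
  refine ⟨√(max (v₀ ⬝ᵥ (S *ᵥ v₀)) (s * (4 * Y)) / p), fun T hT v w hv0 hv hw t ht i => ?_⟩
  have hU := IsPrimitiveOn.quadForm hT hST hv
  -- Above the level `4 s Y` one has `|v|² > 4 Y ≥ 4 |S d|²`, so the damping `-|v|²` dominates the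
  -- forcing term `2 v · S d`.
  have h1 := hU.le_max_of_deriv_nonpos (κ := s * (4 * Y)) (fun τ hτ hκ => by
    have hY' : (S *ᵥ d (w τ)) ⬝ᵥ (S *ᵥ d (w τ)) ≤ Y := (le_abs_self _).trans (hY _ (hw τ hτ))
    have h2 : 4 * Y < v τ ⬝ᵥ v τ :=
      lt_of_mul_lt_mul_left (hκ.trans_le (hsS (v τ))) hs.le
    have h3 : 2 * (v τ ⬝ᵥ (S *ᵥ (Am *ᵥ v τ))) = -(v τ ⬝ᵥ v τ) := by
      have := congrArg (fun X => v τ ⬝ᵥ (X *ᵥ v τ)) hSA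
      simp only [neg_mulVec, one_mulVec, dotProduct_neg] at this
      rw [← this, add_mulVec, dotProduct_add, ← mulVec_mulVec, ← mulVec_mulVec,
        dotProduct_mulVec_transpose, dotProduct_mulVec_comm hST (Am *ᵥ v τ)]
      ring
    have h4 := dotProduct_self_nonneg' (v τ - (2 : ℝ) • (S *ᵥ d (w τ)))
    simp only [sub_dotProduct, dotProduct_sub, smul_dotProduct, dotProduct_smul,
      smul_eq_mul] at h4
    rw [dotProduct_comm (S *ᵥ d (w τ)) (v τ)] at h4
    rw [mulVec_add, dotProduct_add]
    linarith) ht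
  refine abs_le_sqrt_of_mul_le hp ?_
  have h5 := hpS (v t)
  have h6 := mul_le_mul_of_nonneg_left (sq_le_dotProduct_self (v t) i) hp.le
  rw [sq] at h6
  rw [hv0] at h1
  linarith

variable (hAm : IsHurwitz Am) (hP : P.PosDef) (hΛ : IsPosDiagonal Λ) (hΓθ : IsPosDiagonal Γθ)
  (hΓk : IsPosDiagonal Γk)

include hAm hP hΛ hΓθ hΓk

/-- The a priori bound for the closed loop. -/
theorem exists_apriori_bound (hc : 0 ≤ c)
    (hV : ∀ r z, lyapunovDeriv A Am B C Λ L Γθ Γk P Θs Ks r z ≤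
      -c * (trackingError z ⬝ᵥ trackingError z)) (D : ℝ) (z₀ : StateIndex n m → ℝ) :
    ∃ R, ∀ r : ℝ → Fin m → ℝ, (∀ t, 0 ≤ t → ‖r t‖ ≤ D) → ∀ T, 0 ≤ T → ∀ z, z 0 = z₀ →
      IsSolutionOn (closedLoopField A Am B C Λ L Γθ Γk) r T z → ∀ t ∈ Icc 0 T, ‖z t‖ ≤ R := by
  obtain ⟨p, hp, hpP⟩ := exists_pos_mul_le_quadForm hP
  set V₀ := lyapunovFun P Λ Γθ Γk Θs Ks z₀
  have hdec : ∀ {r : ℝ → Fin m → ℝ} {T : ℝ} {z : ℝ → StateIndex n m → ℝ}, 0 ≤ T → z 0 = z₀ →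
      IsSolutionOn (closedLoopField A Am B C Λ L Γθ Γk) r T z → ∀ t ∈ Icc 0 T,
        lyapunovFun P Λ Γθ Γk Θs Ks (z t) ≤ V₀ := by
    intro r T z hT hz0 hz t ht
    have := (isPrimitiveOn_lyapunovFun (Θs := Θs) (Ks := Ks) hP hT hz).le_of_deriv_nonpos
      le_rfl ht.1 ht.2 fun τ _ => (hV (r τ) (z τ)).trans (by
        have := mul_nonneg hc (dotProduct_self_nonneg' (trackingError (z τ)))
        linarith)
    rwa [hz0] at this
  have hePnn : ∀ z : StateIndex n m → ℝ, 0 ≤ trackingError z ⬝ᵥ (P *ᵥ trackingError z) :=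
    fun z => by simpa using hP.posSemidef.dotProduct_mulVec_nonneg (trackingError z)
  have hWθ := fun z : StateIndex n m → ℝ =>
    weightedSq_nonneg (gainWeight_pos hΛ hΓθ) (feedbackGain z - Θs)
  have hWk := fun z : StateIndex n m → ℝ =>
    weightedSq_nonneg (gainWeight_pos hΛ hΓk) (feedforwardGain z - Ks)
  have hE : ∀ {z : StateIndex n m → ℝ}, lyapunovFun P Λ Γθ Γk Θs Ks z ≤ V₀ →
      ∀ i, |trackingError z i| ≤ √(V₀ / p) := by
    intro z hz i
    refine abs_le_sqrt_of_mul_le hp ?_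
    have h1 := hpP (trackingError z)
    have h2 := mul_le_mul_of_nonneg_left (sq_le_dotProduct_self (trackingError z) i) hp.le
    rw [sq] at h2
    have := hWθ z
    have := hWk z
    unfold lyapunovFun at hz
    linarith
  have hd : Continuous fun w : (Fin m → ℝ) × (Fin n → ℝ) => B *ᵥ w.1 - L *ᵥ (Cᵀ *ᵥ w.2) :=
    (continuous_const.matrix_mulVec continuous_fst).sub
      (continuous_const.matrix_mulVec (continuous_const.matrix_mulVec continuous_snd))
  -- The reference model is a Hurwitz system driven by `B r - L e_y`, and `V ≤ V₀` already bounds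
  -- `e`, hence `e_y`.
  obtain ⟨b, hb⟩ := hAm.exists_bound ((isCompact_closedBall (0 : Fin m → ℝ) D).prod
    (isCompact_closedBall (0 : Fin n → ℝ) √(V₀ / p))) hd (modelState z₀)
  have hxm : ∀ {r : ℝ → Fin m → ℝ} {T : ℝ} {z : ℝ → StateIndex n m → ℝ},
      (∀ t, 0 ≤ t → ‖r t‖ ≤ D) → 0 ≤ T → z 0 = z₀ →
      IsSolutionOn (closedLoopField A Am B C Λ L Γθ Γk) r T z → ∀ t ∈ Icc 0 T, ∀ i,
        |modelState (z t) i| ≤ b := by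
    intro r T z hr hT hz0 hz
    refine hb T hT (fun t => modelState (z t)) (fun t => (r t, trackingError (z t)))
      (congrArg modelState hz0) (fun i => ?_) fun t ht => ⟨?_, ?_⟩
    · refine (hz (Sum.inr (Sum.inl i))).congr_deriv hT fun t _ => ?_
      change (Am *ᵥ modelState (z t) + B *ᵥ r t -
        L *ᵥ outputError C (plantState (z t)) (modelState (z t))) i = _
      rw [outputError_eq, add_sub_assoc]
    · simpa using hr t ht.1
    · rw [mem_closedBall_zero_iff, pi_norm_le_iff_of_nonneg (Real.sqrt_nonneg _)]
      exact hE (hdec hT hz0 hz t ht)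
  -- Each bound is chosen before `r`, `T` and `z`, so it is uniform over all horizons.
  have key : ∀ idx, ∃ b, ∀ r : ℝ → Fin m → ℝ, (∀ t, 0 ≤ t → ‖r t‖ ≤ D) → ∀ T, 0 ≤ T →
      ∀ z, z 0 = z₀ → IsSolutionOn (closedLoopField A Am B C Λ L Γθ Γk) r T z →
        ∀ t ∈ Icc 0 T, |z t idx| ≤ b := by
    rintro (i | i | ⟨i, j⟩ | ⟨i, j⟩)
    · refine ⟨√(V₀ / p) + b, fun r hr T hT z hz0 hz t ht => ?_⟩
      have h1 := hE (hdec hT hz0 hz t ht) i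
      have h2 := hxm hr hT hz0 hz t ht i
      have h3 : z t (Sum.inl i) = trackingError (z t) i + modelState (z t) i :=
        (sub_add_cancel _ _).symm
      rw [h3]
      exact (abs_add_le _ _).trans (add_le_add h1 h2)
    · exact ⟨b, fun r hr T hT z hz0 hz t ht => hxm hr hT hz0 hz t ht i⟩
    · refine ⟨√(V₀ / gainWeight Λ Γθ i j) + |Θs i j|, fun r hr T hT z hz0 hz t ht => ?_⟩
      have h1 := hdec hT hz0 hz t ht
      have h2 := le_weightedSq (gainWeight_pos hΛ hΓθ) (feedbackGain (z t) - Θs) i j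
      have h3 : |(feedbackGain (z t) - Θs) i j| ≤ √(V₀ / gainWeight Λ Γθ i j) := by
        refine abs_le_sqrt_of_mul_le (gainWeight_pos hΛ hΓθ i j) ?_
        have := hePnn (z t)
        have := hWk (z t)
        unfold lyapunovFun at h1
        linarith
      have h4 : z t (Sum.inr (Sum.inr (Sum.inl (i, j)))) =
          (feedbackGain (z t) - Θs) i j + Θs i j := (sub_add_cancel _ _).symm
      rw [h4]
      exact (abs_add_le _ _).trans (add_le_add h3 le_rfl)
    · refine ⟨√(V₀ / gainWeight Λ Γk i j) + |Ks i j|, fun r hr T hT z hz0 hz t ht => ?_⟩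
      have h1 := hdec hT hz0 hz t ht
      have h2 := le_weightedSq (gainWeight_pos hΛ hΓk) (feedforwardGain (z t) - Ks) i j
      have h3 : |(feedforwardGain (z t) - Ks) i j| ≤ √(V₀ / gainWeight Λ Γk i j) := by
        refine abs_le_sqrt_of_mul_le (gainWeight_pos hΛ hΓk i j) ?_
        have := hePnn (z t)
        have := hWθ (z t)
        unfold lyapunovFun at h1
        linarith
      have h4 : z t (Sum.inr (Sum.inr (Sum.inr (i, j)))) =
          (feedforwardGain (z t) - Ks) i j + Ks i j := (sub_add_cancel _ _).symm
      rw [h4]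
      exact (abs_add_le _ _).trans (add_le_add h3 le_rfl)
  choose β hβ using key
  refine ⟨∑ idx, |β idx|, fun r hr T hT z hz0 hz t ht => ?_⟩
  refine (pi_norm_le_iff_of_nonneg (Finset.sum_nonneg fun _ _ => abs_nonneg _)).2 fun idx => ?_
  refine ((hβ idx r hr T hT z hz0 hz t ht).trans (le_abs_self _)).trans ?_
  exact Finset.single_le_sum (f := fun idx => |β idx|) (fun _ _ => abs_nonneg _)
    (Finset.mem_univ idx)

/-- The tracking error of a global solution vanishes asymptotically. -/
theorem tendsto_trackingError (hc : 0 < c)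
    (hV : ∀ r z, lyapunovDeriv A Am B C Λ L Γθ Γk P Θs Ks r z ≤
      -c * (trackingError z ⬝ᵥ trackingError z)) {D : ℝ} {r : ℝ → Fin m → ℝ}
    (hr : ∀ t, 0 ≤ t → ‖r t‖ ≤ D) {z : ℝ → StateIndex n m → ℝ}
    (hz : ∀ T, 0 ≤ T → IsSolutionOn (closedLoopField A Am B C Λ L Γθ Γk) r T z) :
    Tendsto (fun t => trackingError (z t)) atTop (𝓝 0) := by
  obtain ⟨R, hR⟩ := exists_apriori_bound hAm hP hΛ hΓθ hΓk hc.le hV D (z 0)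
  have hzR : ∀ t, 0 ≤ t → ‖z t‖ ≤ R := fun t ht => hR r hr t ht z rfl (hz t ht) t ⟨ht, le_rfl⟩
  have hcE : Continuous (trackingError : (StateIndex n m → ℝ) → Fin n → ℝ) :=
    continuous_pi fun i => (continuous_apply _).sub (continuous_apply _)
  -- The derivative of `|e|²` is a continuous function of `(r, z)`, hence bounded on the compact set
  -- where the trajectory lives. The matrix `1` allows reuse of `IsPrimitiveOn.quadForm`.
  have hcont : Continuous fun w : (Fin m → ℝ) × (StateIndex n m → ℝ) =>
      2 * (trackingError w.2 ⬝ᵥ ((1 : Matrix (Fin n) (Fin n) ℝ) *ᵥ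
        trackingError (closedLoopField A Am B C Λ L Γθ Γk w.1 w.2))) :=
    continuous_const.mul ((hcE.comp continuous_snd).dotProduct
      (continuous_const.matrix_mulVec (hcE.comp contDiff_closedLoopField.continuous)))
  obtain ⟨D', hD'⟩ := ((isCompact_closedBall (0 : Fin m → ℝ) D).prod
    (isCompact_closedBall (0 : StateIndex n m → ℝ) R)).exists_bound_of_continuousOn
    hcont.continuousOn
  have hφ : Tendsto (fun t => trackingError (z t) ⬝ᵥ
      ((1 : Matrix (Fin n) (Fin n) ℝ) *ᵥ trackingError (z t))) atTop (𝓝 0) := by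
    refine tendsto_zero_of_dissipation hc
      (fun T hT => isPrimitiveOn_lyapunovFun (Θs := Θs) (Ks := Ks) hP hT (hz T hT))
      (fun T hT => IsPrimitiveOn.quadForm hT transpose_one (isPrimitiveOn_trackingError (hz T hT)))
      (fun t _ => ?_) (fun t _ => ?_)
      (fun t ht => hD' (r t, z t) ⟨by simpa using hr t ht, by simpa using hzR t ht⟩)
      (fun t _ => ?_)
    · have h1 : 0 ≤ trackingError (z t) ⬝ᵥ (P *ᵥ trackingError (z t)) := by
        simpa using hP.posSemidef.dotProduct_mulVec_nonneg (trackingError (z t))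
      exact add_nonneg (add_nonneg h1 (weightedSq_nonneg (gainWeight_pos hΛ hΓθ) _))
        (weightedSq_nonneg (gainWeight_pos hΛ hΓk) _)
    · rw [one_mulVec]
      exact dotProduct_self_nonneg' _
    · rw [one_mulVec]
      exact hV _ _
  refine tendsto_pi_nhds.2 fun i => ?_
  rw [Pi.zero_apply, tendsto_zero_iff_abs_tendsto_zero]
  have h1 : Tendsto (fun t => √(trackingError (z t) ⬝ᵥ
      ((1 : Matrix (Fin n) (Fin n) ℝ) *ᵥ trackingError (z t)))) atTop (𝓝 0) := by
    simpa using hφ.sqrt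
  refine squeeze_zero (fun t => abs_nonneg _) (fun t => Real.abs_le_sqrt ?_) h1
  rw [one_mulVec]
  exact sq_le_dotProduct_self _ i

end Stability

end AdaptiveControl

/-! ### Stability of the closed-loop reference model adaptive system. -/

open AdaptiveControl in
theorem theorem2 (n m : ℕ)
    (A Am : Matrix (Fin n) (Fin n) ℝ) (B C : Matrix (Fin n) (Fin m) ℝ)
    (Λ : Matrix (Fin m) (Fin m) ℝ)
    (Θstar : Matrix (Fin n) (Fin m) ℝ) (Kstar : Matrix (Fin m) (Fin m) ℝ) (θbar lbar : ℝ)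
    (Γθ : Matrix (Fin n) (Fin n) ℝ) (Γk : Matrix (Fin m) (Fin m) ℝ)
    (hΓθ : IsPosDiagonal Γθ) (hΓk : IsPosDiagonal Γk)
    (hAm : IsHurwitz Am)
    (h1 : (Cᵀ * B).rank = m)
    (h2 : IsObservable Am Cᵀ)
    (h3 : IsMinimumPhase A B Cᵀ)
    (h4 : A + B * Λ * Θstarᵀ = Am) (h4' : Λ * Kstarᵀ = 1)
    (h5 : IsPosDiagonal Λ)
    (h6 : inducedNorm Θstar ≤ θbar) (h6' : inducedNorm Λ ≤ lbar) :
    (∃ Ls : Matrix (Fin n) (Fin m) ℝ, IsSPRGain Am B C Ls) ∧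
    ∀ Ls : Matrix (Fin n) (Fin m) ℝ, IsSPRGain Am B C Ls →
      (∃ P Qs : Matrix (Fin n) (Fin n) ℝ, IsLyapunovPair Am B C Ls P Qs) ∧
      ∀ P Qs : Matrix (Fin n) (Fin n) ℝ, IsLyapunovPair Am B C Ls P Qs →
        ∀ ρ : ℝ, rhoStar lbar θbar Qs < ρ →
        ∀ r : ℝ → Fin m → ℝ, Measurable r → IsBoundedSignal r →
          (∀ (x₀ xm₀ : Fin n → ℝ) (Θ₀ : Matrix (Fin n) (Fin m) ℝ)
              (K₀ : Matrix (Fin m) (Fin m) ℝ),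
            ∃ (x xm : ℝ → Fin n → ℝ) (Θ : ℝ → Matrix (Fin n) (Fin m) ℝ)
              (K : ℝ → Matrix (Fin m) (Fin m) ℝ),
              IsClosedLoopSolution A Am B C Λ (Ls - ρ • (B * (mixing B C)ᵀ)) Γθ Γk r x xm Θ K ∧
              x 0 = x₀ ∧ xm 0 = xm₀ ∧ Θ 0 = Θ₀ ∧ K 0 = K₀) ∧
          (∀ (x xm : ℝ → Fin n → ℝ) (Θ : ℝ → Matrix (Fin n) (Fin m) ℝ)
              (K : ℝ → Matrix (Fin m) (Fin m) ℝ),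
            IsClosedLoopSolution A Am B C Λ (Ls - ρ • (B * (mixing B C)ᵀ)) Γθ Γk r x xm Θ K →
              IsBoundedSignal x ∧ IsBoundedSignal xm ∧
              IsBoundedMatrixSignal Θ ∧ IsBoundedMatrixSignal K ∧
              Tendsto (fun t => outputError C (x t) (xm t)) atTop (𝓝 0)) := by
  have hM : IsUnit (mixing B C).det := isUnit_det_of_rank_eq h1
  -- `Am` differs from `A` by the state feedback `Λ * Θstarᵀ`, so the zeros remain stable.
  have hz : HasStableZeros Am B Cᵀ := by
    rw [← h4, Matrix.mul_assoc]
    exact h3.hasStableZeros.add_input_mul _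
  refine ⟨exists_isSPRGain hM hz, fun Ls hLs => ⟨exists_isLyapunovPair hM hz hLs,
    fun P Qs hPQ ρ hρ r hrm hrb => ?_⟩⟩
  obtain ⟨D, hD⟩ := norm_le_of_isBoundedSignal hrb
  obtain ⟨c, hc, hdecay⟩ := hPQ.exists_decay_rate h5 h6 h6' hρ
  have hV := lyapunovDeriv_le h4 h4' h5 hΓθ hΓk hPQ.dotProduct_mulVec_input hdecay
  constructor
  · intro x₀ xm₀ Θ₀ K₀
    obtain ⟨R, hR⟩ := exists_apriori_bound hAm hPQ.posDef_P h5 hΓθ hΓk hc.le hV D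
      (packState x₀ xm₀ Θ₀ K₀)
    obtain ⟨z, hz0, hzc, hz⟩ := exists_global_solution contDiff_closedLoopField hrm hD _ (hR r hD)
    refine ⟨_, _, _, _, isClosedLoopSolution_of_isSolutionOn hzc hz, ?_, ?_, ?_, ?_⟩ <;>
    rw [hz0] <;> rfl
  · intro x xm Θ K hsol
    have hz := fun T hT => hsol.isSolutionOn hrm hD (T := T) hT
    obtain ⟨R, hR⟩ := exists_apriori_bound hAm hPQ.posDef_P h5 hΓθ hΓk hc.le hV D
      (packState (x 0) (xm 0) (Θ 0) (K 0))
    have hb : ∀ t, 0 ≤ t → ∀ idx, |packState (x t) (xm t) (Θ t) (K t) idx| ≤ R :=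
      fun t ht idx => (norm_le_pi_norm _ idx).trans
        (hR r hD t ht _ rfl (hz t ht) t ⟨ht, le_rfl⟩)
    refine ⟨⟨R, fun t ht i => hb t ht (Sum.inl i)⟩, ⟨R, fun t ht i => hb t ht (Sum.inr (Sum.inl i))⟩,
      ⟨R, fun t ht i j => hb t ht (Sum.inr (Sum.inr (Sum.inl (i, j))))⟩,
      ⟨R, fun t ht i j => hb t ht (Sum.inr (Sum.inr (Sum.inr (i, j))))⟩, ?_⟩
    have he := tendsto_trackingError hAm hPQ.posDef_P h5 hΓθ hΓk hc hV hD hz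
    have hC : Continuous fun e : Fin n → ℝ => Cᵀ *ᵥ e :=
      continuous_const.matrix_mulVec continuous_id
    have := (hC.tendsto 0).comp he
    rw [mulVec_zero] at this
    exact this.congr fun t => (outputError_eq _).symm
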